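/- Let $K$ be a field of characteristic $0$ and let $h,g$ be formal parameters. Let $\mathfrak{sl}(1/2)$ be the Lie superalgebra over $K$ with even basis $Z,H,X_\pm$ and odd basis $v_\pm,\bar v_\pm$ and relations $$[H,X_\pm]=\pm2X_\pm,\quad [X_+,X_-]=H,\quad [Z,H]=[Z,X_\pm]=0,\quad [X_\pm,v_\mp]=-v_\pm,\quad [X_\pm,\bar v_\mp]=\bar v_\pm,$$ $$[Z,v_\pm]=v_\pm,\quad [Z,\bar v_\pm]=-\bar v_\pm,\quad [H,v_\pm]=\pm v_\pm,\quad [H,\bar v_\pm]=\pm\bar v_\pm,\quad [X_\pm,v_\pm]=[X_\pm,\bar v_\pm]=0,$$ $$\{v_\pm,v_\pm\}=\{\bar v_\pm,\bar v_\pm\}=\{v_\pm,v_\mp\}=\{\bar v_\pm,\bar v_\mp\}=0,\quad \{v_\pm,\bar v_\pm\}=X_\pm,\quad \{\bar v_\pm,v_\mp\}=\tfrac12(Z\pm H).$$ Here $Z,H,X_\pm$ span a copy of $gl(2)$. Let $U=U(\mathfrak{sl}(1/2))$ be the enveloping superalgebra with its standard Hopf superalgebra structure $\Delta_0,\epsilon_0,S_0$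 (all basis elements primitive), and let $U[[h,g]]$ be the algebra of formal power series over $U$; tensor products are super tensor products, completed in the $(h,g)$-adic sense. Put $\sigma=-\ln(1-2hX_+)$; since $\sigma$ is divisible by $2h$, the element $\frac{g}{2h}\sigma$ lies in $U[[h,g]]$. Let $$\mathcal F=\exp\Big(\frac{g}{2h}\sigma\otimes Z\Big)\exp\Big(-\frac12H\otimes\sigma\Big),$$ i.e. the image of the element of $(U(gl(2))\otimes U(gl(2)))[[h,g]]$ given by the same formula, and let $$\Delta=\mathcal F\Delta_0\mathcal F^{-1},\qquad \epsilon=\epsilon_0,\qquad S=uS_0u^{-1}\ \text{ with } u=m(\mathrm{id}\otimes S_0)(\mathcal F),\qquad \mathcal R=\mathcal F_{21}\mathcal F^{-1}.$$ Then: 1. $U$ is generated as an algebra by $Z,H,X_\pm,\bar v_+,v_-$. The element $\mathcal F$ is even and invertible, and $$(\epsilon_0\otimes\mathrm{id})(\mathcal F)=(\mathrm{id}\otimes\epsilon_0)(\mathcal F)=1,\qquad \mathcal F_{12}(\Delta_0\otimes\mathrm{id})(\mathcal F)=\mathcal F_{23}(\mathrm{id}\otimes\Delta_0)(\mathcal F).$$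 2. $U[[h,g]]$ with $\Delta,\epsilon,S,\mathcal R$ is a triangular (topological) Hopf superalgebra over $K[[h,g]]$. Modulo $(h,g)$, the maps $\Delta,S$ reduce to $\Delta_0,S_0$ and $\mathcal R$ reduces to $1\otimes1$. The element $\mathcal R$ is the image of the corresponding element $\mathcal F_{21}\mathcal F^{-1}$ for $gl(2)$, and $$\mathcal R=\exp\Big(\frac{g}{2h}Z\otimes\sigma\Big)\exp\Big(-\frac12\sigma\otimes H\Big)\exp\Big(\frac12H\otimes\sigma\Big)\exp\Big(-\frac{g}{2h}\sigma\otimes Z\Big).$$ 3. On the odd generators, $$\Delta(\bar v_+)=\bar v_+\otimes e^{-\sigma/2}+e^{-\frac{g}{2h}\sigma}\otimes\bar v_+,$$ $$\Delta(v_-)=v_-\otimes e^{\sigma/2}+e^{\frac{g}{2h}\sigma}\otimes v_-+hHe^{\frac{g}{2h}\sigma}\otimes v_+e^{\sigma}-gv_+e^{\sigma}\otimes Ze^{\sigma/2}-g(e^\sigma-1)e^{\frac{g}{2h}\sigma}\otimes Zv_+e^\sigma,$$ $$S(\bar v_+)=-\bar v_+e^{\frac{1}{2h}(h+g)\sigma},\qquad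 S(v_-)=-\big(v_--hHv_++gv_+(1+Z)\big)e^{-\frac1{2h}(h+g)\sigma},\qquad \epsilon(\bar v_+)=\epsilon(v_-)=0.$$ 4. Let $V$ be the fundamental representation of $\mathfrak{sl}(1/2)$, with even basis vector $e_0$ and odd basis vectors $e_1,e_2$, in which, with matrix units $E_{ij}$, $Z=2E_{00}+E_{11}+E_{22}$, $H=E_{11}-E_{22}$, $X_+=E_{12}$, $X_-=E_{21}$, $v_+=E_{02}$, $v_-=E_{01}$, $\bar v_+=E_{10}$, $\bar v_-=E_{20}$. In the ordered basis $e_0\otimes e_0;\ e_0\otimes e_1,e_0\otimes e_2;\ e_1\otimes e_0,e_2\otimes e_0;\ e_1\otimes e_1,e_1\otimes e_2,e_2\otimes e_1,e_2\otimes e_2$ of $V\otimes V$ the matrix of $\mathcal R$ is $(1)\oplus\check R\oplus\check R^{-1}\oplus\bar R$, where $$\check R=\begin{pmatrix}1&2g\\0&1\end{pmatrix},\qquad \bar R=\begin{pmatrix}1&h+g&-h-g&h^2-g^2\\0&1&0&h-g\\0&0&1&-h+g\\0&0&0&1\end{pmatrix}.$$ -/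

import Mathlib

namespace TwistedSl12

open scoped TensorProduct

noncomputable section

/-- A superalgebra over a field of characteristic zero, given by its parity involution:
the even (odd) elements are those fixed (negated) by `parity`. In characteristic different from two
this is the same as a `ℤ/2`-grading; see the `GradedAlgebra` instance below. -/
class Superalgebra (K A : Type*) [Field K] [Ring A] [Algebra K A] where
  parity : A →ₐ[K] A
  parity_parity : ∀ a, parity (parity a) = a

theorem half_add_half (K : Type*) [Field K] [CharZero K] {A : Type*} [Ring A] [Algebra K A]
    (a : A) : (2⁻¹ : K) • a + (2⁻¹ : K) • a = a := by
  rw [← add_smul, ← two_mul, mul_inv_cancel₀ two_ne_zero, one_smul]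

section Super
variable (K : Type*) [Field K] {A : Type*} [Ring A] [Algebra K A] [Superalgebra K A]

def parity : A →ₐ[K] A := Superalgebra.parity

theorem parity_parity (a : A) : parity K (parity K a) = a := Superalgebra.parity_parity a

variable (A)
/-- The homogeneous component of degree `i ∈ ℤ/2`. -/
def homogeneous (i : ZMod 2) : Submodule K A where
  carrier := {a | parity K a = ((-1 : ℤˣ) ^ i) • a}
  add_mem' {a b} ha hb := by simp_all [smul_add]
  zero_mem' := by simp
  smul_mem' c a ha := by
    simp only [Set.mem_ofPred_eq] at ha ⊢
    rw [map_smul, ha, smul_comm]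

variable {A}
theorem mem_homogeneous {i : ZMod 2} {a : A} :
    a ∈ homogeneous K A i ↔ parity K a = ((-1 : ℤˣ) ^ i) • a := Iff.rfl

theorem mem_even {a : A} : a ∈ homogeneous K A 0 ↔ parity K a = a := by
  simp [mem_homogeneous]

theorem mem_odd {a : A} : a ∈ homogeneous K A 1 ↔ parity K a = -a := by
  simp [mem_homogeneous]

instance : SetLike.GradedMonoid (homogeneous K A) where
  one_mem := by simp [mem_even]
  mul_mem i j a b ha hb := by
    rw [mem_homogeneous] at *
    rw [map_mul, ha, hb, uzpow_add, smul_mul_smul_comm]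

variable {K} in
theorem map_mem {B : Type*} [Ring B] [Algebra K B] [Superalgebra K B] {f : A →ₐ[K] B}
    (hf : ∀ a, f (parity K a) = parity K (f a)) {i : ZMod 2} {a : A}
    (ha : a ∈ homogeneous K A i) : f a ∈ homogeneous K B i := by
  rw [mem_homogeneous] at *
  rw [← hf, ha, Units.smul_def, Units.smul_def, map_zsmul]

variable [CharZero K]

def evenPart : A →ₗ[K] homogeneous K A 0 :=
  LinearMap.codRestrict _ ((2⁻¹ : K) • (LinearMap.id + (parity K).toLinearMap)) fun a => by
    rw [mem_even]; simp [parity_parity, add_comm]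

def oddPart : A →ₗ[K] homogeneous K A 1 :=
  LinearMap.codRestrict _ ((2⁻¹ : K) • (LinearMap.id - (parity K).toLinearMap)) fun a => by
    rw [mem_odd]; simp [parity_parity, ← smul_neg]

def decomposeSuper : A →ₗ[K] DirectSum (ZMod 2) fun i => homogeneous K A i :=
  DirectSum.lof K _ (fun i => homogeneous K A i) 0 ∘ₗ evenPart K +
    DirectSum.lof K _ (fun i => homogeneous K A i) 1 ∘ₗ oddPart K

instance : GradedAlgebra (homogeneous K A) where
  toDecomposition := DirectSum.Decomposition.ofLinearMap (homogeneous K A) (decomposeSuper K)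
    (by
      ext a
      simp only [decomposeSuper, LinearMap.comp_apply, LinearMap.add_apply, map_add,
        DirectSum.coeLinearMap_lof, evenPart, oddPart, LinearMap.codRestrict_apply,
        LinearMap.smul_apply, LinearMap.sub_apply, LinearMap.id_apply, ← smul_add]
      rw [add_add_sub_cancel, ← two_smul K a, smul_smul]
      simp)
    (by
      ext i a : 2
      obtain ⟨a, ha⟩ := a
      simp only [decomposeSuper, LinearMap.comp_apply, LinearMap.add_apply,
        DirectSum.coeLinearMap_lof, LinearMap.id_apply]
      have hi : i = 0 ∨ i = 1 := (by decide : ∀ k : ZMod 2, k = 0 ∨ k = 1) i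
      obtain rfl | rfl := hi
      · have h0 : evenPart K a = ⟨a, ha⟩ := by
          rw [mem_even] at ha
          ext
          simp [evenPart, ha, half_add_half]
        have h1 : oddPart K a = 0 := by
          rw [mem_even] at ha
          ext
          simp [oddPart, ha]
        rw [h0, h1]; simp
      · have h0 : evenPart K a = 0 := by
          rw [mem_odd] at ha
          ext
          simp [evenPart, ha]
        have h1 : oddPart K a = ⟨a, ha⟩ := by
          rw [mem_odd] at ha
          ext
          simp [oddPart, ha, half_add_half]
        rw [h0, h1]; simp)

end Super

section Tensor
variable (K : Type*) [Field K] [CharZero K]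
variable (A : Type*) [Ring A] [Algebra K A] [Superalgebra K A]
variable (B : Type*) [Ring B] [Algebra K B] [Superalgebra K B]

/-- The super tensor product, with `(a ⊗ b)(a' ⊗ b') = (-1)^(|b||a'|) aa' ⊗ bb'`. -/
abbrev SuperTensor : Type _ := homogeneous K A ᵍ⊗[K] homogeneous K B

/-- `a ↦ a ⊗ 1`. -/
def tensorInl : A →ₐ[K] SuperTensor K A B :=
  GradedTensorProduct.includeLeft (homogeneous K A) (homogeneous K B)

/-- `b ↦ 1 ⊗ b`. -/
def tensorInr : B →ₐ[K] SuperTensor K A B :=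
  GradedTensorProduct.includeRight (homogeneous K A) (homogeneous K B)

variable {A B}

theorem inl_mul_inr (a : A) (b : B) :
    tensorInl K A B a * tensorInr K A B b = (a ᵍ⊗ₜ[K] b : SuperTensor K A B) :=
  GradedTensorProduct.tmul_one_mul_one_tmul _ _ a b

theorem inr_mul_inl {i j : ZMod 2} {a : A} {b : B} (ha : a ∈ homogeneous K A i)
    (hb : b ∈ homogeneous K B j) :
    tensorInr K A B b * tensorInl K A B a = ((-1 : ℤˣ) ^ (j * i)) • (tensorInl K A B a * tensorInr K A B b) := by
  have := GradedTensorProduct.tmul_coe_mul_coe_tmul (R := K) (homogeneous K A) (homogeneous K B)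
    1 ⟨b, hb⟩ ⟨a, ha⟩ 1
  rw [inl_mul_inr]
  simp only [mul_one, one_mul] at this
  exact this

theorem inl_mul_inr' {i j : ZMod 2} {a : A} {b : B} (ha : a ∈ homogeneous K A i)
    (hb : b ∈ homogeneous K B j) :
    tensorInl K A B a * tensorInr K A B b = ((-1 : ℤˣ) ^ (j * i)) • (tensorInr K A B b * tensorInl K A B a) := by
  rw [inr_mul_inl K ha hb, smul_smul, Int.units_mul_self, one_smul]

instance : Superalgebra K (SuperTensor K A B) where
  parity := GradedTensorProduct.lift _ _ ((tensorInl K A B).comp (parity K)) ((tensorInr K A B).comp (parity K))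
    fun i j a b => by
      simpa using inl_mul_inr' K (map_mem (f := parity K) (fun _ => rfl) a.2)
        (map_mem (f := parity K) (fun _ => rfl) b.2)
  parity_parity x := by
    rw [← AlgHom.comp_apply]
    conv_rhs => rw [← AlgHom.id_apply (R := K) x]
    congr 1
    ext a
    · simp [parity_parity, tensorInl]
    · simp [parity_parity, tensorInr]

theorem parity_inl (a : A) : parity K (tensorInl K A B a) = tensorInl K A B (parity K a) := by
  change tensorInl K A B (parity K a) * tensorInr K A B (parity K 1) = _
  simp

theorem parity_inr (b : B) : parity K (tensorInr K A B b) = tensorInr K A B (parity K b) := by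
  change tensorInl K A B (parity K 1) * tensorInr K A B (parity K b) = _
  simp

theorem inl_mem {i : ZMod 2} {a : A} (ha : a ∈ homogeneous K A i) :
    tensorInl K A B a ∈ homogeneous K (SuperTensor K A B) i :=
  map_mem (fun a => (parity_inl K a).symm) ha

theorem inr_mem {i : ZMod 2} {b : B} (hb : b ∈ homogeneous K B i) :
    tensorInr K A B b ∈ homogeneous K (SuperTensor K A B) i :=
  map_mem (fun b => (parity_inr K b).symm) hb

/-- The tensor product of two parity-preserving algebra morphisms. -/
def tensorMap {A' B' : Type*} [Ring A'] [Algebra K A'] [Superalgebra K A'] [Ring B'] [Algebra K B']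
    [Superalgebra K B'] (f : A →ₐ[K] A') (g : B →ₐ[K] B')
    (hf : ∀ a, f (parity K a) = parity K (f a)) (hg : ∀ b, g (parity K b) = parity K (g b)) :
    SuperTensor K A B →ₐ[K] SuperTensor K A' B' :=
  GradedTensorProduct.lift _ _ ((tensorInl K A' B').comp f) ((tensorInr K A' B').comp g) fun _ _ a b =>
    inl_mul_inr' K (map_mem hf a.2) (map_mem hg b.2)

/-- The super flip `a ⊗ b ↦ (-1)^(|a||b|) b ⊗ a`. -/
def superFlip : SuperTensor K A B ≃ₐ[K] SuperTensor K B A :=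
  GradedTensorProduct.comm (homogeneous K A) (homogeneous K B)

variable (A)
abbrev Tensor₃ : Type _ := SuperTensor K (SuperTensor K A A) A

/-- The embeddings of `A` and `A ⊗ A` in the indicated legs of `A ⊗ A ⊗ A`. -/
def leg₁ : A →ₐ[K] Tensor₃ K A := (tensorInl K (SuperTensor K A A) A).comp (tensorInl K A A)
def leg₂ : A →ₐ[K] Tensor₃ K A := (tensorInl K (SuperTensor K A A) A).comp (tensorInr K A A)
def leg₃ : A →ₐ[K] Tensor₃ K A := tensorInr K (SuperTensor K A A) A

def leg₁₂ : SuperTensor K A A →ₐ[K] Tensor₃ K A := tensorInl K (SuperTensor K A A) A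

def leg₁₃ : SuperTensor K A A →ₐ[K] Tensor₃ K A :=
  GradedTensorProduct.lift _ _ (leg₁ K A) (leg₃ K A) fun _ _ a b =>
    inl_mul_inr' K (inl_mem K a.2) b.2

def leg₂₃ : SuperTensor K A A →ₐ[K] Tensor₃ K A :=
  GradedTensorProduct.lift _ _ (leg₂ K A) (leg₃ K A) fun _ _ a b =>
    inl_mul_inr' K (inr_mem K a.2) b.2

end Tensor

section Series
variable (K : Type*) [Field K]
variable (A : Type*) [Ring A] [Algebra K A]
variable (B : Type*) [Ring B] [Algebra K B]

/-- Formal power series `A[[h, g]]` in two central variables, with coefficients in `A`. -/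
abbrev FPS (A : Type*) : Type _ := MvPowerSeries (Fin 2) A

/-- The deformation parameter `h`. -/
def parH : FPS A := MvPowerSeries.X 0

/-- The deformation parameter `g`. -/
def parG : FPS A := MvPowerSeries.X 1

variable {A B}

/-- The coefficientwise extension of a linear map. -/
def mapSeries (φ : A →ₗ[K] B) : FPS A →ₗ[K] FPS B where
  toFun f := fun n => φ (MvPowerSeries.coeff n f)
  map_add' _ _ := funext fun _ => map_add φ _ _
  map_smul' c _ := funext fun _ => map_smul φ c _

/-- Elements of `A` as constant series. -/
def constSeries : A →ₗ[K] FPS A where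
  toFun a := MvPowerSeries.C a
  map_add' := map_add _
  map_smul' c a := by
    ext n
    classical
    simp [MvPowerSeries.coeff_C]

/-- A scalar series `c ∈ K[[h, g]]` as an element of `A[[h, g]]`. -/
def scalar (c : FPS K) : FPS A := mapSeries K (Algebra.linearMap K A) c

/-- The `K[[h, g]]`-linear (and continuous) extension `A[[h, g]] → B[[h, g]]` of `φ`. -/
def extendSeries (φ : A →ₗ[K] FPS B) : FPS A →ₗ[K] FPS B where
  toFun f := fun n => ∑ p ∈ Finset.HasAntidiagonal.antidiagonal n,
    MvPowerSeries.coeff p.2 (φ (MvPowerSeries.coeff p.1 f))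
  map_add' f f' := by
    funext n
    simp only [map_add]
    exact Finset.sum_add_distrib
  map_smul' c f := by
    funext n
    refine Eq.trans (Finset.sum_congr rfl fun p _ => ?_) (Finset.smul_sum (r := c)).symm
    change MvPowerSeries.coeff p.2 (φ (c • MvPowerSeries.coeff p.1 f)) = _
    rw [map_smul]
    rfl

/-- The substitution `f(x)` for `x ∈ A[[h, g]]` without constant term: then `x ^ k` has no
coefficients in total degree `< k`, so that the sum below is the full one. -/
def substSeries (f : PowerSeries K) (x : FPS A) : FPS A := fun n =>
  ∑ k ∈ Finset.range (n.degree + 1), PowerSeries.coeff k f • MvPowerSeries.coeff n (x ^ k)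

/-- `exp x`, for `x` without constant term. -/
def expSeries [CharZero K] (x : FPS A) : FPS A := substSeries K (PowerSeries.exp K) x

/-- `σ = -ln(1 - 2 h X₊)`. -/
def sigma [CharZero K] (Xp : A) : FPS A :=
  -substSeries K (PowerSeries.log K) (-(2 * parH A * constSeries K Xp))

/-- `τ = σ / (2h) = ∑ (2h)ⁿ X₊ⁿ⁺¹ / (n + 1)`, so that `(g / 2h) σ = g τ`. -/
def tau (Xp : A) : FPS A :=
  constSeries K Xp * substSeries K (PowerSeries.mk fun m => ((m : K) + 1)⁻¹) (2 * parH A * constSeries K Xp)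

theorem two_h_mul_tau [CharZero K] (Xp : A) : 2 * parH A * tau K Xp = sigma K Xp := by
  set x : FPS A := 2 * parH A * constSeries K Xp with hx
  have h0 : MvPowerSeries.constantCoeff x = 0 := by
    simp [hx, parH]
  have hord : ∀ (k : ℕ) (n : Fin 2 →₀ ℕ), n.degree < k → MvPowerSeries.coeff n (x ^ k) = 0 :=
    fun k n hn => MvPowerSeries.coeff_of_lt_order <| lt_of_lt_of_le (by exact_mod_cast hn)
      (MvPowerSeries.le_order_pow_of_constantCoeff_eq_zero k h0)
  rw [tau, ← mul_assoc, ← hx, sigma, ← hx]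
  ext n
  rw [MvPowerSeries.coeff_mul]
  have h1 : ∀ p ∈ Finset.HasAntidiagonal.antidiagonal n,
      MvPowerSeries.coeff p.1 x * MvPowerSeries.coeff p.2
        (substSeries K (PowerSeries.mk fun m => ((m : K) + 1)⁻¹) x) =
      ∑ k ∈ Finset.range (n.degree + 1),
        ((k : K) + 1)⁻¹ • (MvPowerSeries.coeff p.1 x * MvPowerSeries.coeff p.2 (x ^ k)) := by
    intro p hp
    have hle : p.2.degree ≤ n.degree := by
      rw [← Finset.HasAntidiagonal.mem_antidiagonal.1 hp, map_add]; omega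
    change _ * (∑ k ∈ Finset.range (p.2.degree + 1), _) = _
    rw [Finset.mul_sum, Finset.sum_subset (Finset.range_mono (Nat.add_le_add_right hle 1))]
    · simp
    · intro k _ hk
      rw [hord k p.2 (by simpa using hk)]
      simp
  rw [Finset.sum_congr rfl h1, Finset.sum_comm]
  simp_rw [← Finset.smul_sum, ← MvPowerSeries.coeff_mul, ← pow_succ']
  change _ = -(∑ k ∈ Finset.range (n.degree + 1), _)
  rw [Finset.sum_range_succ, hord _ n (Nat.lt_succ_self _), Finset.sum_range_succ' _ n.degree]
  simp only [smul_zero, add_zero]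
  rw [neg_add, ← Finset.sum_neg_distrib]
  simp only [PowerSeries.coeff_log, Nat.succ_ne_zero, if_true, if_false, zero_smul, neg_zero,
    add_zero, neg_pow x]
  refine Finset.sum_congr rfl fun k _ => ?_
  rcases Nat.even_or_odd k with hk | hk <;>
    simp [pow_succ, hk.neg_one_pow, neg_div]

end Series

section Hopf
variable (K : Type*) [Field K] [CharZero K]
variable {A : Type*} [Ring A] [Algebra K A] [Superalgebra K A]
variable {B : Type*} [Ring B] [Algebra K B] [Superalgebra K B]
variable {Q : Type*} [Ring Q] [Algebra K Q]

/-- `a ⊗ b` for series `a`, `b` (topological tensor product, `A[[h, g]] ⊗ B[[h, g]]` being completed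
to `(A ⊗ B)[[h, g]]`). -/
def ten (a : FPS A) (b : FPS B) : FPS (SuperTensor K A B) :=
  mapSeries K (tensorInl K A B).toLinearMap a * mapSeries K (tensorInr K A B).toLinearMap b

/-- `m ∘ (p ⊗ q)` for `K[[h, g]]`-linear maps `p` and `q` to the algebra `Q[[h, g]]`, i.e. the
continuous extension of `a ⊗ b ↦ p(a) q(b)`. -/
def mulTensor (p : FPS A →ₗ[K] FPS Q) (q : FPS B →ₗ[K] FPS Q) :
    FPS (SuperTensor K A B) →ₗ[K] FPS Q :=
  extendSeries K (LinearMap.mul' K (FPS Q) ∘ₗ TensorProduct.map (p ∘ₗ constSeries K) (q ∘ₗ constSeries K) ∘ₗ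
    (GradedTensorProduct.of K (homogeneous K A) (homogeneous K B)).symm.toLinearMap)

variable {K}

/-- `Δ ⊗ id`. -/
def comulLeft (Δ : FPS A →ₗ[K] FPS (SuperTensor K A A)) :
    FPS (SuperTensor K A A) →ₗ[K] FPS (Tensor₃ K A) :=
  mulTensor K (mapSeries K (leg₁₂ K A).toLinearMap ∘ₗ Δ) (mapSeries K (leg₃ K A).toLinearMap)

/-- `id ⊗ Δ`. -/
def comulRight (Δ : FPS A →ₗ[K] FPS (SuperTensor K A A)) :
    FPS (SuperTensor K A A) →ₗ[K] FPS (Tensor₃ K A) :=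
  mulTensor K (mapSeries K (leg₁ K A).toLinearMap) (mapSeries K (leg₂₃ K A).toLinearMap ∘ₗ Δ)

/-- `ε ⊗ id`. -/
def counitLeft (ε : FPS A →ₗ[K] FPS K) : FPS (SuperTensor K A A) →ₗ[K] FPS A :=
  mulTensor K (mapSeries K (Algebra.linearMap K A) ∘ₗ ε) LinearMap.id

/-- `id ⊗ ε`. -/
def counitRight (ε : FPS A →ₗ[K] FPS K) : FPS (SuperTensor K A A) →ₗ[K] FPS A :=
  mulTensor K LinearMap.id (mapSeries K (Algebra.linearMap K A) ∘ₗ ε)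

/-- The algebra `A[[h, g]]` with these structure maps is a triangular (topological) Hopf
superalgebra over `K[[h, g]]`, with universal R-matrix `R`. -/
structure IsTriangularHopfSuperalgebra (Δ : FPS A →ₗ[K] FPS (SuperTensor K A A)) (ε : FPS A →ₗ[K] FPS K)
    (S : FPS A →ₗ[K] FPS A) (R : FPS (SuperTensor K A A)) : Prop where
  comul_scalar : ∀ c x, Δ (scalar K c * x) = scalar K c * Δ x
  comul_one : Δ 1 = 1
  comul_mul : ∀ x y, Δ (x * y) = Δ x * Δ y
  comul_parity : ∀ x, Δ (mapSeries K (parity K).toLinearMap x) =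
    mapSeries K (parity K).toLinearMap (Δ x)
  counit_scalar : ∀ c x, ε (scalar K c * x) = c * ε x
  counit_one : ε 1 = 1
  counit_mul : ∀ x y, ε (x * y) = ε x * ε y
  counit_parity : ∀ x, ε (mapSeries K (parity K).toLinearMap x) = ε x
  coassoc : ∀ x, comulLeft Δ (Δ x) = comulRight Δ (Δ x)
  counit_left : ∀ x, counitLeft ε (Δ x) = x
  counit_right : ∀ x, counitRight ε (Δ x) = x
  antipode_scalar : ∀ c x, S (scalar K c * x) = scalar K c * S x
  antipode_parity : ∀ x, S (mapSeries K (parity K).toLinearMap x) =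
    mapSeries K (parity K).toLinearMap (S x)
  antipode_left : ∀ x, mulTensor K S LinearMap.id (Δ x) = scalar K (ε x)
  antipode_right : ∀ x, mulTensor K LinearMap.id S (Δ x) = scalar K (ε x)
  isUnit_R : IsUnit R
  parity_R : mapSeries K (parity K).toLinearMap R = R
  R_comul : ∀ x, R * Δ x = mapSeries K (superFlip K).toLinearMap (Δ x) * R
  comulLeft_R : comulLeft Δ R =
    mapSeries K (leg₁₃ K A).toLinearMap R * mapSeries K (leg₂₃ K A).toLinearMap R
  comulRight_R : comulRight Δ R =
    mapSeries K (leg₁₃ K A).toLinearMap R * mapSeries K (leg₁₂ K A).toLinearMap R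
  triangular : mapSeries K (superFlip K).toLinearMap R * R = 1

/-- `F` is an (even) Drinfeld twist for the Hopf superalgebra with coproduct `Δ₀`, counit `ε₀`. -/
structure IsTwist (Δ₀ : A →ₗ[K] SuperTensor K A A) (ε₀ : A →ₗ[K] K) (F : FPS (SuperTensor K A A)) :
    Prop where
  isUnit : IsUnit F
  parity_eq : mapSeries K (parity K).toLinearMap F = F
  counit_left : counitLeft (mapSeries K ε₀) F = 1
  counit_right : counitRight (mapSeries K ε₀) F = 1
  cocycle : mapSeries K (leg₁₂ K A).toLinearMap F * comulLeft (mapSeries K Δ₀) F =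
    mapSeries K (leg₂₃ K A).toLinearMap F * comulRight (mapSeries K Δ₀) F

/-- `x ↦ u x u⁻¹`. -/
def conjBy (u : FPS B) : FPS B →ₗ[K] FPS B :=
  LinearMap.mulLeft K u ∘ₗ LinearMap.mulRight K (Ring.inverse u)

/-- `Δ = F Δ₀ F⁻¹`. -/
def twistedComul (Δ₀ : A →ₗ[K] SuperTensor K A A) (F : FPS (SuperTensor K A A)) :
    FPS A →ₗ[K] FPS (SuperTensor K A A) :=
  conjBy F ∘ₗ mapSeries K Δ₀

/-- `S = u S₀ u⁻¹` with `u = m(id ⊗ S₀)(F)`. -/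
def twistedAntipode (S₀ : A →ₗ[K] A) (F : FPS (SuperTensor K A A)) : FPS A →ₗ[K] FPS A :=
  conjBy (mulTensor K LinearMap.id (mapSeries K S₀) F) ∘ₗ mapSeries K S₀

/-- `R = F₂₁ F⁻¹`. -/
def twistedR (F : FPS (SuperTensor K A A)) : FPS (SuperTensor K A A) :=
  mapSeries K (superFlip K).toLinearMap F * Ring.inverse F

variable (K)

/-- `F = exp((g / 2h) σ ⊗ Z) exp(-(1 / 2) H ⊗ σ)`. -/
def twistElement (Z H Xp : A) : FPS (SuperTensor K A A) :=
  expSeries K (parG _ * ten K (tau K Xp) (constSeries K Z)) *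
    expSeries K (-((2⁻¹ : K) • ten K (constSeries K H) (sigma K Xp)))

end Hopf


section Presentation
variable (K : Type*) [Field K]

/-- The free generator `x`. -/
def letter {G : Type*} (x : G) : FreeAlgebra K G := FreeAlgebra.ι K x

/-- The word `xy - yx`. -/
def commWord {G : Type*} (x y : G) : FreeAlgebra K G :=
  letter K x * letter K y - letter K y * letter K x

/-- The word `xy + yx`. -/
def antiWord {G : Type*} (x y : G) : FreeAlgebra K G :=
  letter K x * letter K y + letter K y * letter K x

variable {K} {G : Type*} (r : FreeAlgebra K G → FreeAlgebra K G → Prop)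

/-- The algebra generated by `G` with relations `r`. -/
def Presented : Type _ := RingQuot r

instance : Ring (Presented r) := inferInstanceAs (Ring (RingQuot r))

instance : Algebra K (Presented r) := inferInstanceAs (Algebra K (RingQuot r))

/-- The generator `x`. -/
def gen (x : G) : Presented r := RingQuot.mkAlgHom K r (FreeAlgebra.ι K x)

variable {r}

theorem rel_eq {x y : FreeAlgebra K G} (h : r x y) :
    FreeAlgebra.lift K (gen r) x = FreeAlgebra.lift K (gen r) y := by
  have : FreeAlgebra.lift K (gen r) = RingQuot.mkAlgHom K r := by
    ext x
    exact FreeAlgebra.lift_ι_apply _ _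
  rw [this]
  exact RingQuot.mkAlgHom_rel K h

/-- The algebra morphism with given values on generators. -/
def liftGen {B : Type*} [Ring B] [Algebra K B] (f : G → B)
    (h : ∀ ⦃x y⦄, r x y → FreeAlgebra.lift K f x = FreeAlgebra.lift K f y) :
    Presented r →ₐ[K] B :=
  RingQuot.liftAlgHom K ⟨FreeAlgebra.lift K f, h⟩

theorem liftGen_gen {B : Type*} [Ring B] [Algebra K B] (f : G → B)
    (h : ∀ ⦃x y⦄, r x y → FreeAlgebra.lift K f x = FreeAlgebra.lift K f y) (x : G) :
    liftGen f h (gen r x) = f x :=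
  (RingQuot.liftAlgHom_mkAlgHom_apply K _ _ _).trans (FreeAlgebra.lift_ι_apply _ _)

theorem algHom_ext_gen {B : Type*} [Ring B] [Algebra K B] {f g : Presented r →ₐ[K] B}
    (h : ∀ x, f (gen r x) = g (gen r x)) : f = g := by
  refine RingQuot.ringQuot_ext' K f g ?_
  ext x
  exact h x

end Presentation

section Algebras

/-- The basis `Z, H, X₊, X₋` of `gl(2)`. -/
inductive GenGl2 | Z | H | Xp | Xm

/-- The basis `Z, H, X₊, X₋, v₊, v₋, v̄₊, v̄₋` of `sl(1/2)`; here `wp = v̄₊` and `wm = v̄₋`. -/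
inductive GenSl12 | Z | H | Xp | Xm | vp | vm | wp | wm

def GenSl12.isOdd : GenSl12 → Bool
  | .Z | .H | .Xp | .Xm => false
  | .vp | .vm | .wp | .wm => true

variable (K : Type*) [Field K]

/-- The commutation relations of `gl(2)`. -/
inductive RelGl2 : FreeAlgebra K GenGl2 → FreeAlgebra K GenGl2 → Prop
  | H_Xp : RelGl2 (commWord K .H .Xp) ((2 : K) • letter K .Xp)
  | H_Xm : RelGl2 (commWord K .H .Xm) (-((2 : K) • letter K .Xm))
  | Xp_Xm : RelGl2 (commWord K .Xp .Xm) (letter K .H)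
  | Z_H : RelGl2 (commWord K .Z .H) 0
  | Z_Xp : RelGl2 (commWord K .Z .Xp) 0
  | Z_Xm : RelGl2 (commWord K .Z .Xm) 0

/-- The (anti)commutation relations of `sl(1/2)`. -/
inductive RelSl12 : FreeAlgebra K GenSl12 → FreeAlgebra K GenSl12 → Prop
  | H_Xp : RelSl12 (commWord K .H .Xp) ((2 : K) • letter K .Xp)
  | H_Xm : RelSl12 (commWord K .H .Xm) (-((2 : K) • letter K .Xm))
  | Xp_Xm : RelSl12 (commWord K .Xp .Xm) (letter K .H)
  | Z_H : RelSl12 (commWord K .Z .H) 0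
  | Z_Xp : RelSl12 (commWord K .Z .Xp) 0
  | Z_Xm : RelSl12 (commWord K .Z .Xm) 0
  | Xp_vm : RelSl12 (commWord K .Xp .vm) (-letter K .vp)
  | Xm_vp : RelSl12 (commWord K .Xm .vp) (-letter K .vm)
  | Xp_wm : RelSl12 (commWord K .Xp .wm) (letter K .wp)
  | Xm_wp : RelSl12 (commWord K .Xm .wp) (letter K .wm)
  | Z_vp : RelSl12 (commWord K .Z .vp) (letter K .vp)
  | Z_vm : RelSl12 (commWord K .Z .vm) (letter K .vm)
  | Z_wp : RelSl12 (commWord K .Z .wp) (-letter K .wp)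
  | Z_wm : RelSl12 (commWord K .Z .wm) (-letter K .wm)
  | H_vp : RelSl12 (commWord K .H .vp) (letter K .vp)
  | H_vm : RelSl12 (commWord K .H .vm) (-letter K .vm)
  | H_wp : RelSl12 (commWord K .H .wp) (letter K .wp)
  | H_wm : RelSl12 (commWord K .H .wm) (-letter K .wm)
  | Xp_vp : RelSl12 (commWord K .Xp .vp) 0
  | Xm_vm : RelSl12 (commWord K .Xm .vm) 0
  | Xp_wp : RelSl12 (commWord K .Xp .wp) 0
  | Xm_wm : RelSl12 (commWord K .Xm .wm) 0
  | vp_vp : RelSl12 (antiWord K .vp .vp) 0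
  | vm_vm : RelSl12 (antiWord K .vm .vm) 0
  | wp_wp : RelSl12 (antiWord K .wp .wp) 0
  | wm_wm : RelSl12 (antiWord K .wm .wm) 0
  | vp_vm : RelSl12 (antiWord K .vp .vm) 0
  | wp_wm : RelSl12 (antiWord K .wp .wm) 0
  | vp_wp : RelSl12 (antiWord K .vp .wp) (letter K .Xp)
  | vm_wm : RelSl12 (antiWord K .vm .wm) (letter K .Xm)
  | wp_vm : RelSl12 (antiWord K .wp .vm) ((2⁻¹ : K) • (letter K .Z + letter K .H))
  | wm_vp : RelSl12 (antiWord K .wm .vp) ((2⁻¹ : K) • (letter K .Z - letter K .H))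

/-- The enveloping algebra `U(gl(2))`. -/
abbrev Ugl2 : Type _ := Presented (RelGl2 K)

/-- The enveloping algebra `U(sl(1/2))`. -/
abbrev Usl12 : Type _ := Presented (RelSl12 K)

def genGl2 (x : GenGl2) : Ugl2 K := gen (RelGl2 K) x

def genSl12 (x : GenSl12) : Usl12 K := gen (RelSl12 K) x

instance : Superalgebra K (Ugl2 K) where
  parity := AlgHom.id K _
  parity_parity _ := rfl

instance : Superalgebra K (Usl12 K) where
  parity := liftGen (fun x => if x.isOdd then -genSl12 K x else genSl12 K x) fun x y h => by
    have := rel_eq h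
    cases h <;> simp [commWord, antiWord, letter, GenSl12.isOdd, genSl12] at this ⊢ <;> grind
  parity_parity a := by
    rw [← AlgHom.comp_apply]
    conv_rhs => rw [← AlgHom.id_apply (R := K) a]
    congr 1
    refine algHom_ext_gen fun x => ?_
    cases x <;> simp [liftGen_gen, GenSl12.isOdd, genSl12]

theorem parity_gen (x : GenSl12) :
    parity K (genSl12 K x) = if x.isOdd then -genSl12 K x else genSl12 K x :=
  liftGen_gen _ _ x

theorem gen_mem (x : GenSl12) : genSl12 K x ∈ homogeneous K (Usl12 K) (if x.isOdd then 1 else 0) := by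
  cases x <;> simp [GenSl12.isOdd, mem_even, mem_odd, parity_gen]

/-- The morphism `U(gl(2)) → U(sl(1/2))` induced by `gl(2) ⊂ sl(1/2)`. -/
def embGl2 : Ugl2 K →ₐ[K] Usl12 K :=
  liftGen (fun
    | .Z => genSl12 K .Z
    | .H => genSl12 K .H
    | .Xp => genSl12 K .Xp
    | .Xm => genSl12 K .Xm) fun x y h => by
    cases h
    · simpa [commWord, letter, genSl12] using rel_eq (RelSl12.H_Xp (K := K))
    · simpa [commWord, letter, genSl12] using rel_eq (RelSl12.H_Xm (K := K))
    · simpa [commWord, letter, genSl12] using rel_eq (RelSl12.Xp_Xm (K := K))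
    · simpa [commWord, letter, genSl12] using rel_eq (RelSl12.Z_H (K := K))
    · simpa [commWord, letter, genSl12] using rel_eq (RelSl12.Z_Xp (K := K))
    · simpa [commWord, letter, genSl12] using rel_eq (RelSl12.Z_Xm (K := K))

theorem embGl2_parity (a : Ugl2 K) : embGl2 K (parity K a) = parity K (embGl2 K a) := by
  change embGl2 K a = ((parity K).comp (embGl2 K)) a
  congr 1
  refine algHom_ext_gen fun x => ?_
  cases x <;> simp [embGl2, liftGen_gen, parity_gen, GenSl12.isOdd]

variable [CharZero K]

theorem inr_mul_inl_gen (x y : GenSl12) :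
    tensorInr K (Usl12 K) (Usl12 K) (genSl12 K y) * tensorInl K (Usl12 K) (Usl12 K) (genSl12 K x) =
      if x.isOdd && y.isOdd then
        -(tensorInl K (Usl12 K) (Usl12 K) (genSl12 K x) * tensorInr K (Usl12 K) (Usl12 K) (genSl12 K y))
      else tensorInl K (Usl12 K) (Usl12 K) (genSl12 K x) * tensorInr K (Usl12 K) (Usl12 K) (genSl12 K y) := by
  rw [inr_mul_inl K (gen_mem K x) (gen_mem K y)]
  cases hx : x.isOdd <;> cases hy : y.isOdd <;> simp

/-- The undeformed coproduct, `x ↦ x ⊗ 1 + 1 ⊗ x` on generators. -/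
def comul₀ : Usl12 K →ₐ[K] SuperTensor K (Usl12 K) (Usl12 K) :=
  liftGen (fun x => tensorInl K _ _ (genSl12 K x) + tensorInr K _ _ (genSl12 K x)) fun x y h => by
    have h1 := congrArg (tensorInl K (Usl12 K) (Usl12 K)) (rel_eq h)
    have h2 := congrArg (tensorInr K (Usl12 K) (Usl12 K)) (rel_eq h)
    have h3 := inr_mul_inl_gen K
    rw [show gen (RelSl12 K) = genSl12 K from rfl] at h1 h2
    cases h <;> simp [commWord, antiWord, letter, mul_add, add_mul, h3, GenSl12.isOdd] at h1 h2 ⊢ <;>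
      first
      | (linear_combination (norm := skip) h1 + h2; abel1)
      | (linear_combination (norm := skip) h1 + h2; simp only [smul_add, smul_sub]; abel1)

/-- The undeformed counit, `x ↦ 0` on generators. -/
def counit₀ : Usl12 K →ₐ[K] K :=
  liftGen (fun _ => 0) fun x y h => by
    cases h <;> simp [commWord, antiWord, letter]

/-- The algebra morphism sending `a` to `b ↦ (-1)^(|a||b|) b S₀(a)`; so a generator `x` goes to
`b ↦ -(-1)^(|x||b|) b x`. -/
def antipodeAux : Usl12 K →ₐ[K] Module.End K (Usl12 K) :=
  liftGen (fun x => -(LinearMap.mulRight K (genSl12 K x) ∘ₗ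
    (if x.isOdd then (parity K).toLinearMap else LinearMap.id))) fun x y h => by
    have := rel_eq h
    have h1 := parity_gen K
    have h2 := parity_parity K (A := Usl12 K)
    rw [show gen (RelSl12 K) = genSl12 K from rfl] at this
    refine LinearMap.ext fun b => ?_
    have h3 := congrArg (fun z => b * z) this
    have h4 := congrArg (fun z => parity K b * z) this
    cases h <;> simp [commWord, antiWord, letter, GenSl12.isOdd, h1, h2, mul_add, mul_sub, mul_assoc,
      Module.End.mul_apply] at h3 h4 ⊢ <;>
      first
      | (linear_combination (norm := skip) h3; abel1)
      | (linear_combination (norm := skip) -h3; abel1)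
      | (linear_combination (norm := skip) h4; abel1)
      | (linear_combination (norm := skip) -h4; abel1)
      | (linear_combination (norm := skip) -h3; simp only [smul_add, smul_sub, mul_smul_comm, mul_add, mul_sub]; abel1)

/-- The undeformed antipode: the super-antimorphism with `S₀(x) = -x` on generators. -/
def antipode₀ : Usl12 K →ₗ[K] Usl12 K where
  toFun a := antipodeAux K a 1
  map_add' := by simp
  map_smul' := by simp

theorem antipode₀_one : antipode₀ K 1 = 1 := by simp [antipode₀]

theorem antipode₀_gen_mul (x : GenSl12) (b : Usl12 K) :
    antipode₀ K (genSl12 K x * b) =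
      -((if x.isOdd then parity K (antipode₀ K b) else antipode₀ K b) * genSl12 K x) := by
  change antipodeAux K (genSl12 K x * b) 1 = _
  rw [map_mul, Module.End.mul_apply, antipodeAux]
  erw [liftGen_gen]
  cases x <;> simp [GenSl12.isOdd] <;> rfl

/-- The defining `3 × 3` supermatrices (one even and two odd basis vectors). -/
def fundMatrix : GenSl12 → Matrix (Fin 3) (Fin 3) K
  | .Z => !![2, 0, 0; 0, 1, 0; 0, 0, 1]
  | .H => !![0, 0, 0; 0, 1, 0; 0, 0, -1]
  | .Xp => !![0, 0, 0; 0, 0, 1; 0, 0, 0]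
  | .Xm => !![0, 0, 0; 0, 0, 0; 0, 1, 0]
  | .vp => !![0, 0, 1; 0, 0, 0; 0, 0, 0]
  | .vm => !![0, 1, 0; 0, 0, 0; 0, 0, 0]
  | .wp => !![0, 0, 0; 1, 0, 0; 0, 0, 0]
  | .wm => !![0, 0, 0; 0, 0, 0; 1, 0, 0]

/-- The fundamental representation of `sl(1/2)`. -/
def fundRep : Usl12 K →ₐ[K] Matrix (Fin 3) (Fin 3) K :=
  liftGen (fundMatrix K) fun x y h => by
    cases h <;> simp [commWord, antiWord, letter, fundMatrix] <;> norm_num <;>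
      first
      | simp [funext_iff, Fin.forall_fin_succ]
      | (ext i j; fin_cases i <;> fin_cases j <;> rfl)

/-- The action of `U ⊗ U` on the tensor square of the fundamental representation,
`(a ⊗ b)(e_k ⊗ e_l) = (-1)^(|b||e_k|) a e_k ⊗ b e_l`; the index `0` is even, `1` and `2` are odd. -/
def tensorRep : SuperTensor K (Usl12 K) (Usl12 K) →ₗ[K]
    Matrix (Fin 3 × Fin 3) (Fin 3 × Fin 3) K :=
  TensorProduct.lift (LinearMap.mk₂ K
    (fun a b => Matrix.of fun p q : Fin 3 × Fin 3 =>
      fundRep K a p.1 q.1 * fundRep K (if q.1 = 0 then b else parity K b) p.2 q.2)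
    (fun a a' b => by ext; simp [add_mul])
    (fun c a b => by ext; simp [mul_assoc])
    (fun a b b' => by ext p q; by_cases h : q.1 = 0 <;> simp [h, mul_add])
    (fun c a b => by ext p q; by_cases h : q.1 = 0 <;> simp [h, mul_left_comm])) ∘ₗ
  (GradedTensorProduct.of K (homogeneous K (Usl12 K)) (homogeneous K (Usl12 K))).symm.toLinearMap

/-- The matrix of `R ∈ (U ⊗ U)[[h, g]]` in the tensor square of the fundamental representation. -/
def rMatrix (R : FPS (SuperTensor K (Usl12 K) (Usl12 K))) :
    Matrix (Fin 3 × Fin 3) (Fin 3 × Fin 3) (FPS K) :=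
  Matrix.of fun p q => fun n => tensorRep K (MvPowerSeries.coeff n R) p q

/-- The basis of the tensor square, ordered as
`e₀⊗e₀; e₀⊗e₁, e₀⊗e₂; e₁⊗e₀, e₂⊗e₀; e₁⊗e₁, e₁⊗e₂, e₂⊗e₁, e₂⊗e₂`. -/
def basisOrder : Fin 1 ⊕ Fin 2 ⊕ Fin 2 ⊕ Fin 4 → Fin 3 × Fin 3
  | .inl _ => (0, 0)
  | .inr (.inl j) => (0, j.succ)
  | .inr (.inr (.inl i)) => (i.succ, 0)
  | .inr (.inr (.inr k)) => ![(1, 1), (1, 2), (2, 1), (2, 2)] k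

theorem basisOrder_bijective : Function.Bijective basisOrder := by decide

/-- `A ⊕ B ⊕ C ⊕ D`. -/
def directSum₄ {R : Type*} [Zero R] (A : Matrix (Fin 1) (Fin 1) R)
    (B C : Matrix (Fin 2) (Fin 2) R) (D : Matrix (Fin 4) (Fin 4) R) :
    Matrix (Fin 1 ⊕ Fin 2 ⊕ Fin 2 ⊕ Fin 4) (Fin 1 ⊕ Fin 2 ⊕ Fin 2 ⊕ Fin 4) R :=
  Matrix.fromBlocks A 0 0 (Matrix.fromBlocks B 0 0 (Matrix.fromBlocks C 0 0 D))

/-- `U(gl(2)) ⊗ U(gl(2)) → U(sl(1/2)) ⊗ U(sl(1/2))`. -/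
def embTensor : SuperTensor K (Ugl2 K) (Ugl2 K) →ₐ[K] SuperTensor K (Usl12 K) (Usl12 K) :=
  tensorMap K (embGl2 K) (embGl2 K) (embGl2_parity K) (embGl2_parity K)

/-- The twist element of `gl(2)`. -/
def twistGl2 : FPS (SuperTensor K (Ugl2 K) (Ugl2 K)) :=
  twistElement K (genGl2 K .Z) (genGl2 K .H) (genGl2 K .Xp)

/-- The twist element of `gl(2)`, viewed inside `U(sl(1/2)) ⊗ U(sl(1/2))`. -/
def twistSl12 : FPS (SuperTensor K (Usl12 K) (Usl12 K)) :=
  mapSeries K (embTensor K).toLinearMap (twistGl2 K)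
end Algebras

end

end TwistedSl12

open TwistedSl12

/-!
The idea is Drinfeld's twisting, applied to a cocommutative Hopf superalgebra.

*Twisting.* `U = U(sl(1/2))` is a cocommutative Hopf superalgebra
(`isCocommutativeHopf_sl12`), and an even invertible `F` that satisfies the counit and cocycle
identities turns any such algebra into a triangular one (`isTriangular_twisted`). Everything there
follows from the element `Φ = F₁₂ (Δ₀ ⊗ id)(F) = F₂₃ (id ⊗ Δ₀)(F)`: iterating the twisted coproduct
conjugates the iterated coproduct of `U` by `Φ`, and as the latter is symmetric, each flip of
neighbouring legs multiplies `Φ` by the R-matrix in these legs, which yields the hexagon identities.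
For the antipode, `u S₀ u⁻¹` is a right and `v⁻¹ S₀ v` is a left convolution inverse of the
identity, where `u = m(id ⊗ S₀)(F)` and `v = m(S₀ ⊗ id)(F⁻¹)`; hence they agree
(`antipode_unique`). Identities between series are checked on constants, which suffices for maps
linear over `K[h, g]` (`IsParLinear.ext`).

*The cocycle.* Write `F = G J` with `G = exp(g τ ⊗ Z)`, `J = exp(-(1 / 2) H ⊗ σ)` and
`σ = 2h τ`. As `exp(-σ) = 1 - 2h X₊` and `J (X₊ ⊗ 1) J⁻¹ = X₊ ⊗ exp(-σ)`, the element
`exp(-Δ₀ σ) = 1 - 2h (X₊ ⊗ 1 + 1 ⊗ X₊)` is conjugated by `J` to `exp(-σ) ⊗ exp(-σ)`. So `J` carries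
`Δ₀ σ` to `σ ⊗ 1 + 1 ⊗ σ` (`twistJ_mul_sigma_add`). With this, both sides of the cocycle identity
become the same product of the factors `G` and `J` in pairs of legs (`twist_cocycle`), because `Z`
is central in `gl(2)`. The calculus of `exp`, `ln` and commutators that is used takes place with
polynomials modulo powers of `(h, g)` (`agreeBelow_substSeries`).

*Explicit formulas.* The coproducts of `v̄₊` and `v₋` result from conjugation by `J` and then by `G`
(`twistedComul_highest`, `twistedComul_vm`); either conjugation rescales weight vectors by
exponentials of `σ` or adds a single commutator with `σ` or `τ`. The antipodes are solved for from
`m(id ⊗ S)Δ = ε`, using that `exp(c σ)` is group-like and `Z` is primitive for `Δ`. In the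
fundamental representation `X₊² = 0`, so each of the four exponentials of `R` is `1` plus its
exponent, and its matrix is a product of four block matrices (`rMatrix_submatrix`).
-/

set_option linter.unusedSectionVars false

namespace TwistedSl12

open scoped TensorProduct

noncomputable section

/-! ### Substitution into one-variable power series -/

section Substitution
variable {K : Type*} [Field K]
variable {A : Type*} [Ring A] [Algebra K A]
variable {B : Type*} [Ring B] [Algebra K B]

/-- Two series are congruent modulo the `M`-th power of `(h, g)`. -/
def AgreeBelow (M : ℕ) (x y : FPS A) : Prop :=
  ∀ n : Fin 2 →₀ ℕ, n.degree < M → MvPowerSeries.coeff n x = MvPowerSeries.coeff n y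

namespace AgreeBelow
variable {M : ℕ} {x y z x' y' : FPS A}

theorem refl (x : FPS A) : AgreeBelow M x x := fun _ _ => rfl

theorem symm (h : AgreeBelow M x y) : AgreeBelow M y x := fun n hn => (h n hn).symm

theorem trans (h : AgreeBelow M x y) (h' : AgreeBelow M y z) : AgreeBelow M x z :=
  fun n hn => (h n hn).trans (h' n hn)

theorem mono {N : ℕ} (hN : N ≤ M) (h : AgreeBelow M x y) : AgreeBelow N x y :=
  fun n hn => h n (hn.trans_le hN)

theorem add (h : AgreeBelow M x y) (h' : AgreeBelow M x' y') : AgreeBelow M (x + x') (y + y') :=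
  fun n hn => by rw [map_add, map_add, h n hn, h' n hn]

theorem mul (h : AgreeBelow M x y) (h' : AgreeBelow M x' y') : AgreeBelow M (x * x') (y * y') := by
  intro n hn
  rw [MvPowerSeries.coeff_mul, MvPowerSeries.coeff_mul]
  refine Finset.sum_congr rfl fun p hp => ?_
  have hd : p.1.degree + p.2.degree = n.degree := by
    rw [← map_add, Finset.HasAntidiagonal.mem_antidiagonal.1 hp]
  rw [h _ (by omega), h' _ (by omega)]

theorem smul (c : K) (h : AgreeBelow M x y) : AgreeBelow M (c • x) (c • y) := fun n hn =>
  congrArg (c • ·) (h n hn)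

theorem pow (h : AgreeBelow M x y) (k : ℕ) : AgreeBelow M (x ^ k) (y ^ k) := by
  induction k with
  | zero => simpa using refl _
  | succ k ih => simpa [pow_succ] using ih.mul h

theorem sum {ι : Type*} {s : Finset ι} {f f' : ι → FPS A} (h : ∀ i ∈ s, AgreeBelow M (f i) (f' i)) :
    AgreeBelow M (∑ i ∈ s, f i) (∑ i ∈ s, f' i) := fun n hn => by
  rw [map_sum, map_sum]
  exact Finset.sum_congr rfl fun i hi => h i hi n hn

theorem eq (h : ∀ M, AgreeBelow M x y) : x = y := by
  ext n
  exact h (n.degree + 1) n (Nat.lt_succ_self _)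

theorem pow_zero_of_le (hx : MvPowerSeries.constantCoeff x = 0) {k : ℕ} (hk : M ≤ k) :
    AgreeBelow M (x ^ k) 0 := fun n hn => by
  rw [map_zero]
  exact MvPowerSeries.coeff_of_lt_order <|
    lt_of_lt_of_le (by exact_mod_cast hn.trans_le hk)
      (MvPowerSeries.le_order_pow_of_constantCoeff_eq_zero k hx)

theorem aeval_left (h : AgreeBelow M x y) (p : Polynomial K) :
    AgreeBelow M (Polynomial.aeval x p) (Polynomial.aeval y p) := by
  rw [Polynomial.aeval_eq_sum_range, Polynomial.aeval_eq_sum_range]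
  exact sum fun i _ => (h.pow i).smul _

theorem aeval_right (hx : MvPowerSeries.constantCoeff x = 0) {p q : Polynomial K}
    (h : ∀ k < M, p.coeff k = q.coeff k) :
    AgreeBelow M (Polynomial.aeval x p) (Polynomial.aeval x q) := by
  rw [Polynomial.aeval_eq_sum_range' (n := p.natDegree + q.natDegree + 1) (by omega),
    Polynomial.aeval_eq_sum_range' (n := p.natDegree + q.natDegree + 1) (by omega)]
  refine sum fun k _ => ?_
  rcases lt_or_ge k M with hk | hk
  · rw [h k hk]
    exact refl _
  · refine ((pow_zero_of_le hx hk).smul _).trans ?_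
    rw [smul_zero]
    refine AgreeBelow.symm (((pow_zero_of_le hx hk).smul _).trans ?_)
    rw [smul_zero]
    exact refl _

end AgreeBelow

variable {x y : FPS A}

/-- Modulo the `M`-th power of `(h, g)`, the value `f(x)` is that of any polynomial with the same
coefficients as `f` below degree `M`. This reduces identities between substitutions to polynomial
ones. -/
theorem agreeBelow_substSeries (hx : MvPowerSeries.constantCoeff x = 0) (f : PowerSeries K)
    {M : ℕ} {p : Polynomial K} (hp : ∀ k < M, p.coeff k = PowerSeries.coeff k f) :
    AgreeBelow M (substSeries K f x) (Polynomial.aeval x p) := by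
  have key : AgreeBelow M (substSeries K f x) (Polynomial.aeval x (PowerSeries.trunc M f)) := by
    intro n hn
    have h1 : (PowerSeries.trunc M f).natDegree < M ∨ M = 0 := by
      rcases Nat.eq_zero_or_pos M with h | h
      · exact Or.inr h
      · obtain ⟨m, rfl⟩ : ∃ m, M = m + 1 := ⟨M - 1, by omega⟩
        exact Or.inl (PowerSeries.natDegree_trunc_lt f m)
    rcases h1 with h1 | rfl
    swap
    · omega
    rw [Polynomial.aeval_eq_sum_range' h1]
    change (∑ k ∈ Finset.range (n.degree + 1), _ • _) = _
    rw [map_sum]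
    have hsub : Finset.range (n.degree + 1) ⊆ Finset.range M := Finset.range_mono hn
    rw [Finset.sum_subset hsub]
    · refine Finset.sum_congr rfl fun k hk => ?_
      rw [PowerSeries.coeff_trunc, if_pos (Finset.mem_range.1 hk)]
      rfl
    · intro k _ hk
      rw [(AgreeBelow.pow_zero_of_le hx (M := n.degree + 1) (by simpa using hk)) n (by omega)]
      simp
  refine key.trans (AgreeBelow.aeval_right hx fun k hk => ?_)
  rw [PowerSeries.coeff_trunc, if_pos hk, hp k hk]

theorem agreeBelow_substSeries_trunc (hx : MvPowerSeries.constantCoeff x = 0) (f : PowerSeries K)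
    (M : ℕ) : AgreeBelow M (substSeries K f x) (Polynomial.aeval x (PowerSeries.trunc M f)) :=
  agreeBelow_substSeries hx f fun k hk => by rw [PowerSeries.coeff_trunc, if_pos hk]

theorem substSeries_mul (hx : MvPowerSeries.constantCoeff x = 0) (f f' : PowerSeries K) :
    substSeries K (f * f') x = substSeries K f x * substSeries K f' x := by
  refine AgreeBelow.eq fun M => AgreeBelow.symm ?_
  refine ((agreeBelow_substSeries_trunc hx f M).mul (agreeBelow_substSeries_trunc hx f' M)).trans ?_
  rw [← map_mul]
  refine (agreeBelow_substSeries hx _ fun k hk => ?_).symm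
  rw [Polynomial.coeff_mul, PowerSeries.coeff_mul]
  refine Finset.sum_congr rfl fun p hp => ?_
  have := Finset.HasAntidiagonal.mem_antidiagonal.1 hp
  rw [PowerSeries.coeff_trunc, PowerSeries.coeff_trunc, if_pos (by omega), if_pos (by omega)]

theorem substSeries_coe (hx : MvPowerSeries.constantCoeff x = 0) (p : Polynomial K) :
    substSeries K (p : PowerSeries K) x = Polynomial.aeval x p :=
  AgreeBelow.eq fun _ => agreeBelow_substSeries hx _ fun k _ => by rw [Polynomial.coeff_coe]

theorem substSeries_subst (hx : MvPowerSeries.constantCoeff x = 0) (f : PowerSeries K)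
    {g : PowerSeries K} (hg : PowerSeries.constantCoeff g = 0)
    (hgx : MvPowerSeries.constantCoeff (substSeries K g x) = 0) :
    substSeries K f (substSeries K g x) = substSeries K (f.subst g) x := by
  refine AgreeBelow.eq fun M => ?_
  refine (agreeBelow_substSeries_trunc hgx f M).trans ?_
  refine ((agreeBelow_substSeries_trunc hx g M).aeval_left _).trans ?_
  rw [← Polynomial.aeval_comp]
  refine (agreeBelow_substSeries hx _ fun k hk => ?_).symm
  rw [PowerSeries.coeff_subst' (PowerSeries.HasSubst.of_constantCoeff_zero' hg),
    finsum_eq_sum_of_support_subset (s := Finset.range M), Polynomial.comp,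
    Polynomial.eval₂_eq_sum_range' (n := M + 1), Polynomial.finsetSum_coeff, Finset.sum_range_succ,
    PowerSeries.coeff_trunc, if_neg (lt_irrefl M), map_zero, zero_mul, Polynomial.coeff_zero,
    add_zero]
  · refine Finset.sum_congr rfl fun d hd => ?_
    rw [PowerSeries.coeff_trunc, if_pos (Finset.mem_range.1 hd), Polynomial.coeff_C_mul,
      smul_eq_mul]
    congr 1
    have h := congrArg (fun p => Polynomial.coeff p k) (PowerSeries.trunc_trunc_pow g M d)
    simp only [PowerSeries.coeff_trunc, if_pos hk] at h
    rw [← h, ← Polynomial.coe_pow, Polynomial.coeff_coe]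
  · rcases Nat.eq_zero_or_pos M with h | h
    · omega
    · obtain ⟨m, rfl⟩ : ∃ m, M = m + 1 := ⟨M - 1, by omega⟩
      exact (PowerSeries.natDegree_trunc_lt f m).trans (Nat.lt_succ_self _)
  · intro d hd
    by_contra hd'
    simp only [Finset.coe_range, Set.mem_Iio, not_lt] at hd'
    apply hd
    change _ • _ = _
    have hz : PowerSeries.coeff k (g ^ d) = 0 :=
      PowerSeries.coeff_of_lt_order k <| lt_of_lt_of_le (by exact_mod_cast hk.trans_le hd')
        (PowerSeries.le_order_pow_of_constantCoeff_eq_zero d hg)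
    rw [hz, smul_zero]

theorem constantCoeff_substSeries (f : PowerSeries K) (x : FPS A) :
    MvPowerSeries.constantCoeff (substSeries K f x) =
      algebraMap K A (PowerSeries.constantCoeff f) := by
  change ∑ k ∈ Finset.range (Finsupp.degree (0 : Fin 2 →₀ ℕ) + 1), _ = _
  simp [Algebra.smul_def]

theorem semiconj_substSeries {a a' b : FPS A} (ha : MvPowerSeries.constantCoeff a = 0)
    (ha' : MvPowerSeries.constantCoeff a' = 0) (h : a * b = b * a') (f : PowerSeries K) :
    substSeries K f a * b = b * substSeries K f a' := by
  refine AgreeBelow.eq fun M => ?_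
  refine ((agreeBelow_substSeries_trunc ha f M).mul (.refl b)).trans ?_
  refine AgreeBelow.symm (((AgreeBelow.refl b).mul (agreeBelow_substSeries_trunc ha' f M)).trans ?_)
  have hpow : ∀ k : ℕ, a ^ k * b = b * a' ^ k := fun k => by
    induction k with
    | zero => simp
    | succ k ih => rw [pow_succ, mul_assoc, h, ← mul_assoc, ih, mul_assoc, ← pow_succ]
  rw [Polynomial.aeval_eq_sum_range, Polynomial.aeval_eq_sum_range, Finset.mul_sum, Finset.sum_mul]
  simp only [mul_smul_comm, smul_mul_assoc, hpow]
  exact .refl _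

theorem commute_substSeries {a b : FPS A} (ha : MvPowerSeries.constantCoeff a = 0)
    (h : Commute a b) (f : PowerSeries K) : Commute (substSeries K f a) b :=
  semiconj_substSeries ha ha h f

/-- If `[a, b] = c` commutes with `a`, then `[f(a), b] = c f'(a)`. -/
theorem substSeries_mul_of_commutator {a b c : FPS A} (ha : MvPowerSeries.constantCoeff a = 0)
    (h : a * b = b * a + c) (hc : Commute a c) (f : PowerSeries K) :
    substSeries K f a * b =
      b * substSeries K f a + c * substSeries K (PowerSeries.derivative K f) a := by
  refine AgreeBelow.eq fun M => ?_
  refine (((agreeBelow_substSeries_trunc ha f (M + 1)).mono M.le_succ).mul (.refl b)).trans ?_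
  refine AgreeBelow.symm (((AgreeBelow.refl b).mul
    ((agreeBelow_substSeries_trunc ha f (M + 1)).mono M.le_succ)).add
    ((AgreeBelow.refl c).mul (agreeBelow_substSeries_trunc ha _ M)) |>.trans ?_)
  rw [PowerSeries.trunc_derivative]
  generalize PowerSeries.trunc (M + 1) f = p
  suffices h' : Polynomial.aeval a p * b =
      b * Polynomial.aeval a p + c * Polynomial.aeval a (Polynomial.derivative p) by
    rw [h']
    exact .refl _
  have hpow : ∀ k : ℕ, a ^ k * b = b * a ^ k + k • (c * a ^ (k - 1)) := fun k => by
    induction k with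
    | zero => simp
    | succ k ih =>
      rw [pow_succ', mul_assoc, ih, mul_add, ← mul_assoc, h, add_mul, mul_assoc, ← pow_succ',
        mul_smul_comm, ← mul_assoc a c, hc.eq, mul_assoc c a, add_assoc, Nat.add_sub_cancel]
      rcases k with _ | k
      · simp
      · rw [Nat.add_sub_cancel, ← pow_succ', add_smul (k + 1) 1, one_smul, add_comm (c * _)]
  induction p using Polynomial.induction_on' with
  | add p q hp hq => simp only [map_add, add_mul, mul_add, hp, hq]; abel
  | monomial k r =>
    rw [Polynomial.derivative_monomial, Polynomial.aeval_monomial, Polynomial.aeval_monomial,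
      mul_assoc, hpow, ← Algebra.smul_def, ← Algebra.smul_def, ← Algebra.smul_def, mul_smul_comm,
      mul_smul_comm, smul_add, mul_smul, Nat.cast_smul_eq_nsmul]

/-- Substitution is natural for coefficientwise algebra morphisms. -/
theorem map_substSeries (φ : A →ₐ[K] B) (f : PowerSeries K) (x : FPS A) :
    MvPowerSeries.mapAlgHom φ (substSeries K f x) =
      substSeries K f (MvPowerSeries.mapAlgHom (σ := Fin 2) φ x) := by
  ext n
  rw [MvPowerSeries.mapAlgHom_apply, MvPowerSeries.coeff_map]
  change φ (∑ k ∈ Finset.range (n.degree + 1), _) = ∑ k ∈ Finset.range (n.degree + 1), _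
  rw [map_sum]
  refine Finset.sum_congr rfl fun k _ => ?_
  rw [map_smul, ← map_pow, MvPowerSeries.mapAlgHom_apply, MvPowerSeries.coeff_map]
  rfl

end Substitution

/-! ### Exponential and logarithm -/

section ExpLog
variable (K : Type*) [Field K] [CharZero K]

theorem constantCoeff_exp_sub_one :
    PowerSeries.constantCoeff (PowerSeries.exp K - 1) = 0 := by simp

theorem derivative_log_mul_one_add_X :
    PowerSeries.derivative K (PowerSeries.log K) * (1 + PowerSeries.X) = 1 := by
  rw [PowerSeries.deriv_log, mul_add, mul_one]
  ext n
  rcases n with _ | n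
  · simp
  · rw [map_add, PowerSeries.coeff_succ_mul_X, PowerSeries.coeff_mk, PowerSeries.coeff_mk,
      PowerSeries.coeff_one, if_neg (Nat.succ_ne_zero n), ← map_add, pow_succ]
    simp

theorem log_subst_exp_sub_one :
    (PowerSeries.log K).subst (PowerSeries.exp K - 1) = PowerSeries.X := by
  have hs : PowerSeries.HasSubst (PowerSeries.exp K - 1) := PowerSeries.HasSubst.exp_sub_one
  apply PowerSeries.derivative.ext
  · rw [PowerSeries.derivative_subst hs, PowerSeries.derivative_X, map_sub,
      PowerSeries.derivative_exp, PowerSeries.derivative_one, sub_zero]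
    have h := congrArg (PowerSeries.substAlgHom hs) (derivative_log_mul_one_add_X K)
    rw [map_mul, map_add, map_one, PowerSeries.substAlgHom_X, PowerSeries.coe_substAlgHom,
      add_sub_cancel] at h
    exact h
  · have h : MvPowerSeries.constantCoeff (PowerSeries.exp K - 1) = 0 :=
      constantCoeff_exp_sub_one K
    rw [show PowerSeries.constantCoeff
        (PowerSeries.subst (PowerSeries.exp K - 1) (PowerSeries.log K)) = 0 from
      PowerSeries.constantCoeff_subst_eq_zero h _ PowerSeries.constantCoeff_log]
    simp

/-- `exp(ln(1 + X)) = 1 + X`: the left side `y` solves `(1 + X) y' = y` with `y(0) = 1`, and this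
differential equation determines its coefficients. -/
theorem exp_subst_log :
    (PowerSeries.exp K).subst (PowerSeries.log K) = 1 + PowerSeries.X := by
  have hs : PowerSeries.HasSubst (PowerSeries.log K) := PowerSeries.HasSubst.log
  set y := (PowerSeries.exp K).subst (PowerSeries.log K) with hy
  have hd : PowerSeries.derivative K y * (1 + PowerSeries.X) = y := by
    rw [hy, PowerSeries.derivative_subst hs, PowerSeries.derivative_exp, mul_assoc,
      derivative_log_mul_one_add_X, mul_one]
  have h0 : PowerSeries.constantCoeff y = 1 := by
    have h : (PowerSeries.exp K - 1).subst (PowerSeries.log K) = y - 1 := by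
      rw [PowerSeries.subst_sub hs, hy, ← PowerSeries.coe_substAlgHom hs, map_one]
    have h1 : PowerSeries.constantCoeff (y - 1) = 0 := by
      rw [← h]
      exact PowerSeries.constantCoeff_subst_eq_zero
        (show MvPowerSeries.constantCoeff (PowerSeries.log K) = 0 from
          PowerSeries.constantCoeff_log) _ (by simp)
    simpa [sub_eq_zero] using h1
  have h1 : PowerSeries.coeff 1 y = 1 := by
    have := congrArg (PowerSeries.coeff 0) hd
    rw [mul_add, mul_one, map_add, PowerSeries.coeff_zero_mul_X, PowerSeries.coeff_derivative,
      PowerSeries.coeff_zero_eq_constantCoeff_apply, h0] at this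
    simpa using this
  have hrec : ∀ n : ℕ, PowerSeries.coeff (n + 2) y = 0 := fun n => by
    induction n with
    | zero =>
      have := congrArg (PowerSeries.coeff 1) hd
      rw [mul_add, mul_one, map_add, PowerSeries.coeff_succ_mul_X, PowerSeries.coeff_derivative,
        PowerSeries.coeff_derivative, h1] at this
      norm_num at this
      exact this
    | succ n ih =>
      have := congrArg (PowerSeries.coeff (n + 2)) hd
      rw [mul_add, mul_one, map_add, PowerSeries.coeff_succ_mul_X, PowerSeries.coeff_derivative,
        PowerSeries.coeff_derivative, ih, zero_mul, add_zero] at this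
      exact (mul_eq_zero.1 this).resolve_right (by exact_mod_cast Nat.succ_ne_zero (n + 2))
  ext n
  rcases n with _ | _ | n
  · simpa using h0
  · simpa [PowerSeries.coeff_one] using h1
  · rw [hrec, map_add, PowerSeries.coeff_one, PowerSeries.coeff_X]
    simp

variable {K}
variable {A : Type*} [Ring A] [Algebra K A]
variable {B : Type*} [Ring B] [Algebra K B]
variable {x y : FPS A}

theorem constantCoeff_expSeries (x : FPS A) :
    MvPowerSeries.constantCoeff (expSeries K x) = 1 := by
  rw [expSeries, constantCoeff_substSeries]
  simp

theorem expSeries_zero : expSeries K (0 : FPS A) = 1 := by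
  ext n
  change (∑ k ∈ Finset.range (n.degree + 1), _) = _
  rw [Finset.sum_range_succ']
  simp

theorem map_expSeries (φ : A →ₐ[K] B) (x : FPS A) :
    MvPowerSeries.mapAlgHom φ (expSeries K x) =
      expSeries K (MvPowerSeries.mapAlgHom (σ := Fin 2) φ x) :=
  map_substSeries φ _ x

theorem expSeries_add (hx : MvPowerSeries.constantCoeff x = 0)
    (hy : MvPowerSeries.constantCoeff y = 0) (h : Commute x y) :
    expSeries K (x + y) = expSeries K x * expSeries K y := by
  have hxy : MvPowerSeries.constantCoeff (x + y) = 0 := by rw [map_add, hx, hy, add_zero]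
  refine AgreeBelow.eq fun M => (agreeBelow_substSeries_trunc hxy _ M).trans (AgreeBelow.symm ?_)
  refine ((agreeBelow_substSeries_trunc hx _ M).mul (agreeBelow_substSeries_trunc hy _ M)).trans ?_
  have haeval : ∀ z : FPS A, Polynomial.aeval z (PowerSeries.trunc M (PowerSeries.exp K)) =
      ∑ k ∈ Finset.range M, ((k.factorial : K)⁻¹) • z ^ k := fun z => by
    rw [Polynomial.aeval_def, PowerSeries.eval₂_trunc_eq_sum_range]
    refine Finset.sum_congr rfl fun k hk => ?_
    rw [PowerSeries.coeff_exp, ← Algebra.smul_def]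
    simp
  rw [haeval, haeval, haeval, Finset.sum_mul_sum, ← Finset.sum_product']
  have hterm : ∀ k : ℕ, ((k.factorial : K)⁻¹) • (x + y) ^ k =
      ∑ p ∈ Finset.HasAntidiagonal.antidiagonal k,
        (((p.1.factorial : K)⁻¹) • x ^ p.1) * (((p.2.factorial : K)⁻¹) • y ^ p.2) := fun k => by
    rw [h.add_pow', Finset.smul_sum]
    refine Finset.sum_congr rfl fun p hp => ?_
    have hk := Finset.HasAntidiagonal.mem_antidiagonal.1 hp
    rw [smul_mul_smul_comm, ← Nat.cast_smul_eq_nsmul K, smul_smul]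
    congr 1
    rw [← hk]
    have h1 := Nat.cast_ne_zero (R := K).2 p.1.factorial_ne_zero
    have h2 := Nat.cast_ne_zero (R := K).2 p.2.factorial_ne_zero
    have h3 := Nat.cast_ne_zero (R := K).2 (p.1 + p.2).factorial_ne_zero
    have h4 : ((p.1 + p.2).choose p.1 : K) * p.1.factorial * p.2.factorial =
        (p.1 + p.2).factorial := by
      rw [Nat.choose_symm_add]
      exact_mod_cast Nat.add_choose_mul_factorial_mul_factorial p.1 p.2
    have h5 : ((p.1 + p.2).choose p.1 : K) ≠ 0 :=
      Nat.cast_ne_zero.2 (Nat.choose_pos (Nat.le_add_right _ _)).ne'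
    rw [← h4]
    field_simp
  simp only [hterm]
  rw [Finset.sum_sigma', ← Finset.sum_filter_add_sum_filter_not (Finset.range M ×ˢ Finset.range M)
    (fun p => p.1 + p.2 < M)]
  -- the products of total degree at least `M` lie in the `M`-th power of `(h, g)`
  have hz : AgreeBelow M (∑ p ∈ Finset.range M ×ˢ Finset.range M with ¬ p.1 + p.2 < M,
      (((p.1.factorial : K)⁻¹) • x ^ p.1) * (((p.2.factorial : K)⁻¹) • y ^ p.2)) 0 := by
    rw [← Finset.sum_const_zero (s := (Finset.range M ×ˢ Finset.range M).filter
      fun p => ¬ p.1 + p.2 < M)]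
    refine AgreeBelow.sum fun p hp n hn => ?_
    have hp' := (Finset.mem_filter.1 hp).2
    rw [smul_mul_smul_comm, map_zero]
    change ((p.1.factorial : K)⁻¹ * (p.2.factorial : K)⁻¹) •
      MvPowerSeries.coeff n (x ^ p.1 * y ^ p.2) = 0
    rw [MvPowerSeries.coeff_of_lt_order, smul_zero]
    refine lt_of_lt_of_le ?_ MvPowerSeries.le_order_mul
    refine lt_of_lt_of_le (b := ((p.1 : ℕ∞) + p.2)) (by exact_mod_cast (by omega)) ?_
    exact add_le_add (MvPowerSeries.le_order_pow_of_constantCoeff_eq_zero _ hx)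
      (MvPowerSeries.le_order_pow_of_constantCoeff_eq_zero _ hy)
  refine ((AgreeBelow.refl _).add hz).trans ?_
  rw [add_zero]
  refine fun n _ => congrArg (MvPowerSeries.coeff n)
    (Finset.sum_nbij' (fun p => ⟨p.1 + p.2, p⟩) (fun s => s.2) ?_ ?_ ?_ ?_ ?_)
  · simp
  · rintro ⟨k, p⟩ hp
    simp only [Finset.mem_sigma, Finset.mem_range, Finset.HasAntidiagonal.mem_antidiagonal] at hp
    simp only [Finset.mem_filter, Finset.mem_product, Finset.mem_range]
    omega
  · simp
  · rintro ⟨k, p⟩ hp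
    simp only [Finset.mem_sigma, Finset.mem_range, Finset.HasAntidiagonal.mem_antidiagonal] at hp
    obtain ⟨_, rfl⟩ := hp
    rfl
  · simp

theorem expSeries_neg_mul (hx : MvPowerSeries.constantCoeff x = 0) :
    expSeries K (-x) * expSeries K x = 1 := by
  rw [← expSeries_add (by rw [map_neg, hx, neg_zero]) hx (Commute.refl x).neg_left, neg_add_cancel,
    expSeries_zero]

theorem expSeries_mul_neg (hx : MvPowerSeries.constantCoeff x = 0) :
    expSeries K x * expSeries K (-x) = 1 := by
  simpa using expSeries_neg_mul (K := K) (x := -x) (by rw [map_neg, hx, neg_zero])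

/-- If `a b = b a'`, then `exp(a) b = b exp(a')`. -/
theorem semiconj_expSeries {a a' b : FPS A} (ha : MvPowerSeries.constantCoeff a = 0)
    (ha' : MvPowerSeries.constantCoeff a' = 0) (h : a * b = b * a') :
    expSeries K a * b = b * expSeries K a' :=
  semiconj_substSeries ha ha' h _

theorem commute_expSeries {a b : FPS A} (ha : MvPowerSeries.constantCoeff a = 0)
    (h : Commute a b) : Commute (expSeries K a) b :=
  commute_substSeries ha h _

/-- If `[a, b] = c` commutes with `a`, then `exp(a) b exp(a)⁻¹ = b + c`. -/
theorem expSeries_mul_of_commutator {a b c : FPS A} (ha : MvPowerSeries.constantCoeff a = 0)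
    (h : a * b = b * a + c) (hc : Commute a c) :
    expSeries K a * b = (b + c) * expSeries K a := by
  have := substSeries_mul_of_commutator ha h hc (PowerSeries.exp K)
  rwa [PowerSeries.derivative_exp, ← add_mul] at this

/-- `exp` is injective on series without constant term: `ln(1 + (exp x - 1)) = x`. -/
theorem log_expSeries_sub_one (hx : MvPowerSeries.constantCoeff x = 0) :
    substSeries K (PowerSeries.log K) (expSeries K x - 1) = x := by
  have h : expSeries K x - 1 = substSeries K (PowerSeries.exp K - 1) x := by
    ext n
    have h1 : (1 : FPS A) = substSeries K 1 x := by
      simpa using (substSeries_coe hx (1 : Polynomial K)).symm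
    nth_rw 1 [h1]
    rw [map_sub]
    change ∑ k ∈ Finset.range (n.degree + 1), _ - ∑ k ∈ Finset.range (n.degree + 1), _ =
      ∑ k ∈ Finset.range (n.degree + 1), _
    rw [← Finset.sum_sub_distrib]
    exact Finset.sum_congr rfl fun k _ => by rw [map_sub, sub_smul]
  rw [h, substSeries_subst hx _ (constantCoeff_exp_sub_one K), log_subst_exp_sub_one]
  · have := substSeries_coe hx (Polynomial.X : Polynomial K)
    rwa [Polynomial.coe_X, Polynomial.aeval_X] at this
  · rw [constantCoeff_substSeries, constantCoeff_exp_sub_one, map_zero]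

theorem expSeries_log (hx : MvPowerSeries.constantCoeff x = 0) :
    expSeries K (substSeries K (PowerSeries.log K) x) = 1 + x := by
  rw [expSeries, substSeries_subst hx _ PowerSeries.constantCoeff_log, exp_subst_log]
  · have := substSeries_coe hx (1 + Polynomial.X : Polynomial K)
    rwa [Polynomial.coe_add, Polynomial.coe_one, Polynomial.coe_X, map_add, map_one,
      Polynomial.aeval_X] at this
  · rw [constantCoeff_substSeries, PowerSeries.constantCoeff_log, map_zero]

end ExpLog

/-! ### The series `σ` and `τ` -/

section Sigma
variable {K : Type*} [Field K]
variable {A : Type*} [Ring A] [Algebra K A]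
variable {B : Type*} [Ring B] [Algebra K B]

theorem mapAlgHom_C (φ : A →ₐ[K] B) (a : A) :
    MvPowerSeries.mapAlgHom φ (MvPowerSeries.C a : FPS A) = MvPowerSeries.C (φ a) :=
  MvPowerSeries.map_C _ a

theorem mapAlgHom_parH (φ : A →ₐ[K] B) : MvPowerSeries.mapAlgHom φ (parH A) = parH B :=
  MvPowerSeries.map_X _ _

theorem mapAlgHom_parG (φ : A →ₐ[K] B) : MvPowerSeries.mapAlgHom φ (parG A) = parG B :=
  MvPowerSeries.map_X _ _

theorem commute_parH (x : FPS A) : Commute (parH A) x := (MvPowerSeries.commute_X x 0).symm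

theorem commute_parG (x : FPS A) : Commute (parG A) x := (MvPowerSeries.commute_X x 1).symm

theorem constantCoeff_parH : MvPowerSeries.constantCoeff (parH A) = 0 :=
  MvPowerSeries.constantCoeff_X _

theorem constantCoeff_parG : MvPowerSeries.constantCoeff (parG A) = 0 :=
  MvPowerSeries.constantCoeff_X _

theorem parH_mul_cancel {x y : FPS A} (h : parH A * x = parH A * y) : x = y := by
  ext n
  have := congrArg (MvPowerSeries.coeff (Finsupp.single 0 1 + n)) h
  rw [parH, MvPowerSeries.X_def, MvPowerSeries.coeff_add_monomial_mul,
    MvPowerSeries.coeff_add_monomial_mul] at this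
  simpa using this

theorem two_parH_mul_cancel [CharZero K] {x y : FPS A} (h : 2 * parH A * x = 2 * parH A * y) :
    x = y := by
  refine parH_mul_cancel ?_
  have h2 : (2 : K) • (parH A * x) = (2 : K) • (parH A * y) := by
    rw [two_smul, two_smul, ← two_mul, ← two_mul, ← mul_assoc, ← mul_assoc, h]
  simpa [smul_smul] using congrArg ((2⁻¹ : K) • ·) h2

theorem map_tau (φ : A →ₐ[K] B) (a : A) :
    MvPowerSeries.mapAlgHom φ (tau K a) = tau K (φ a) := by
  rw [tau, map_mul, map_substSeries, map_mul, map_mul, mapAlgHom_parH, map_ofNat]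
  erw [mapAlgHom_C]
  rfl

theorem tau_zero : tau K (0 : A) = 0 := by
  rw [tau, map_zero, zero_mul]

theorem constantCoeff_neg_two_h (a : A) :
    MvPowerSeries.constantCoeff (-(2 * parH A * constSeries K a)) = 0 := by
  simp [constantCoeff_parH]

variable [CharZero K]

theorem map_sigma (φ : A →ₐ[K] B) (a : A) :
    MvPowerSeries.mapAlgHom φ (sigma K a) = sigma K (φ a) := by
  rw [← two_h_mul_tau, ← two_h_mul_tau, map_mul, map_mul, map_tau, mapAlgHom_parH, map_ofNat]

theorem constantCoeff_sigma (a : A) : MvPowerSeries.constantCoeff (sigma K a) = 0 := by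
  rw [← two_h_mul_tau]
  simp [constantCoeff_parH]

theorem expSeries_neg_sigma (a : A) :
    expSeries K (-sigma K a) = 1 - 2 * parH A * constSeries K a := by
  rw [sigma, neg_neg, expSeries_log (constantCoeff_neg_two_h a), sub_eq_add_neg]

/-- A series `x` without constant term is determined by `exp(-x)`; with `1 + a = 1 - 2hb` this
identifies `x` with `σ(b)`. -/
theorem log_eq_neg {a : FPS A} {x : FPS A} (hx : MvPowerSeries.constantCoeff x = 0)
    (h : expSeries K (-x) = 1 + a) : substSeries K (PowerSeries.log K) a = -x := by
  have := log_expSeries_sub_one (K := K) (x := -x) (by rw [map_neg, hx, neg_zero])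
  rwa [h, add_sub_cancel_left] at this

theorem commute_sigma {a : A} {b : FPS A} (h : Commute (constSeries K a) b) :
    Commute (sigma K a) b := by
  refine (commute_substSeries (constantCoeff_neg_two_h a) ?_ _).neg_left
  exact ((((Commute.ofNat_left 2 b).mul_left (commute_parH b))).mul_left h).neg_left

theorem commute_tau {a : A} {b : FPS A} (h : Commute (constSeries K a) b) :
    Commute (tau K a) b := by
  have h1 := commute_sigma h
  rw [← two_h_mul_tau] at h1
  have h2 : Commute (2 * parH A) b := (Commute.ofNat_left 2 b).mul_left (commute_parH b)
  refine two_parH_mul_cancel (K := K) ?_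
  have h3 := h1.eq
  rwa [mul_assoc, ← mul_assoc b, ← h2.eq, mul_assoc _ b] at h3

/-- If `[a, b] = c` commutes with `a`, then `[σ(a), b] = 2h c exp(σ(a))`, because the derivative of
`-ln(1 - 2ha)` in `a` is `2h / (1 - 2ha)`. -/
theorem sigma_mul_of_commutator {a : A} {b c : FPS A}
    (h : constSeries K a * b = b * constSeries K a + c) (hc : Commute (constSeries K a) c) :
    sigma K a * b = b * sigma K a + 2 * parH A * (c * expSeries K (sigma K a)) := by
  set x : FPS A := -(2 * parH A * constSeries K a) with hx
  have hx0 : MvPowerSeries.constantCoeff x = 0 := constantCoeff_neg_two_h a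
  have h2 : ∀ y, Commute (2 * parH A) y := fun y =>
    (Commute.ofNat_left 2 y).mul_left (commute_parH y)
  have key := substSeries_mul_of_commutator (a := x) (b := b) (c := -(2 * parH A * c)) hx0
    (by rw [hx, neg_mul, mul_neg, mul_assoc, h, mul_add, ← mul_assoc, (h2 b).eq]
        rw [neg_add, mul_assoc b])
    (((h2 _).mul_left ((h2 _).symm.mul_right hc)).neg_left.neg_right) (PowerSeries.log K)
  have hexp : substSeries K (PowerSeries.derivative K (PowerSeries.log K)) x =
      expSeries K (sigma K a) := by
    have h1 := congrArg (fun f => substSeries K f x) (derivative_log_mul_one_add_X K)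
    simp only [substSeries_mul hx0] at h1
    have h3 : substSeries K (1 + PowerSeries.X) x = expSeries K (-sigma K a) := by
      rw [expSeries_neg_sigma, sub_eq_add_neg, ← hx]
      have := substSeries_coe hx0 (1 + Polynomial.X : Polynomial K)
      rwa [Polynomial.coe_add, Polynomial.coe_one, Polynomial.coe_X, map_add, map_one,
        Polynomial.aeval_X] at this
    have h4 : substSeries K 1 x = 1 := by simpa using substSeries_coe hx0 (1 : Polynomial K)
    rw [h3, h4] at h1
    rw [← mul_one (substSeries _ _ _),
      ← expSeries_neg_mul (K := K) (constantCoeff_sigma (K := K) a), ← mul_assoc, h1, one_mul]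
  rw [hexp] at key
  have hs : sigma K a = -substSeries K (PowerSeries.log K) x := rfl
  rw [← neg_inj, ← neg_mul, neg_add, ← mul_neg, ← mul_assoc, ← neg_mul]
  rwa [← neg_eq_iff_eq_neg.2 hs] at key

/-- The commutator of `τ(a)` with `b`, obtained from that of `σ(a) = 2h τ(a)` by cancelling `2h`. -/
theorem tau_mul_of_commutator {a : A} {b c : FPS A}
    (h : constSeries K a * b = b * constSeries K a + c) (hc : Commute (constSeries K a) c) :
    tau K a * b = b * tau K a + c * expSeries K (sigma K a) := by
  refine two_parH_mul_cancel (K := K) ?_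
  have h2 : Commute (2 * parH A) b := (Commute.ofNat_left 2 b).mul_left (commute_parH b)
  have := sigma_mul_of_commutator h hc
  rw [← mul_assoc, two_h_mul_tau K a, this, mul_add, ← mul_assoc _ b, h2.eq, mul_assoc b,
    two_h_mul_tau K a]

theorem expSeries_sigma_sub_one (a : A) :
    expSeries K (sigma K a) - 1 = 2 * parH A * (constSeries K a * expSeries K (sigma K a)) := by
  have h := expSeries_neg_mul (K := K) (constantCoeff_sigma (K := K) a)
  rw [expSeries_neg_sigma, sub_mul, one_mul] at h
  linear_combination (norm := (rw [← mul_assoc (2 * _)]; abel)) h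

theorem sigma_zero : sigma K (0 : A) = 0 := by
  have h := log_eq_neg (K := K) (a := -(2 * parH A * constSeries K (0 : A))) (x := 0) (by simp)
    (by rw [neg_zero, expSeries_zero]; simp)
  rw [sigma, h]
  simp

end Sigma

/-! ### Parameter-linear maps -/

section ParLinear
variable {K : Type*} [Field K]
variable {A : Type*} [Ring A] [Algebra K A]
variable {B : Type*} [Ring B] [Algebra K B]
variable {C : Type*} [Ring C] [Algebra K C]

/-- Linearity over the polynomial ring `K[h, g]`. Such a map does not decrease the `(h, g)`-adic
order, so it is continuous and determined by its values on constant series. -/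
structure IsParLinear (Φ : FPS A →ₗ[K] FPS B) : Prop where
  map_parH : ∀ x, Φ (parH A * x) = parH B * Φ x
  map_parG : ∀ x, Φ (parG A * x) = parG B * Φ x

namespace IsParLinear

theorem id : IsParLinear (LinearMap.id : FPS A →ₗ[K] FPS A) := ⟨fun _ => rfl, fun _ => rfl⟩

theorem comp {Φ : FPS B →ₗ[K] FPS C} {Ψ : FPS A →ₗ[K] FPS B} (h : IsParLinear Φ)
    (h' : IsParLinear Ψ) : IsParLinear (Φ ∘ₗ Ψ) :=
  ⟨fun x => by simp [h'.map_parH, h.map_parH], fun x => by simp [h'.map_parG, h.map_parG]⟩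

theorem sub {Φ Ψ : FPS A →ₗ[K] FPS B} (h : IsParLinear Φ) (h' : IsParLinear Ψ) :
    IsParLinear (Φ - Ψ) :=
  ⟨fun x => by simp [h'.map_parH, h.map_parH, mul_sub],
    fun x => by simp [h'.map_parG, h.map_parG, mul_sub]⟩

theorem mulLeft (a : FPS A) : IsParLinear (LinearMap.mulLeft K a) :=
  ⟨fun x => by simp [← mul_assoc, (commute_parH a).eq],
    fun x => by simp [← mul_assoc, (commute_parG a).eq]⟩

theorem mulRight (a : FPS A) : IsParLinear (LinearMap.mulRight K a) :=
  ⟨fun x => by simp [mul_assoc], fun x => by simp [mul_assoc]⟩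

/-- Every series is a constant plus an element of the ideal `(h, g)`. -/
theorem exists_eq (x : FPS A) : ∃ a y z, x = constSeries K a + parH A * y + parG A * z := by
  obtain ⟨y, hy⟩ : ∃ y : FPS A, ∀ n, MvPowerSeries.coeff n y =
    MvPowerSeries.coeff (n + Finsupp.single 0 1) x := ⟨fun n => _, fun _ => rfl⟩
  -- the monomials divisible by `h` are all assigned to `y`
  obtain ⟨z, hz⟩ : ∃ z : FPS A, ∀ n, MvPowerSeries.coeff n z =
    if n 0 = 0 then MvPowerSeries.coeff (n + Finsupp.single 1 1) x else 0 :=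
    ⟨fun n => _, fun _ => rfl⟩
  refine ⟨MvPowerSeries.constantCoeff x, y, z, ?_⟩
  ext n
  rw [map_add, map_add, parH, parG, MvPowerSeries.X_def, MvPowerSeries.X_def,
    MvPowerSeries.coeff_monomial_mul, MvPowerSeries.coeff_monomial_mul, hy, hz]
  change _ = MvPowerSeries.coeff n (MvPowerSeries.C _) + _ + _
  have hsub : (n - Finsupp.single 1 1 : Fin 2 →₀ ℕ) 0 = n 0 := by simp
  rw [MvPowerSeries.coeff_C, hsub]
  by_cases h0 : Finsupp.single 0 1 ≤ n
  · have hn : n 0 ≠ 0 := Nat.one_le_iff_ne_zero.1 (by simpa using h0 0)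
    have hn' : n ≠ 0 := fun h => hn (by rw [h]; rfl)
    rw [if_pos h0, if_neg hn, if_neg hn', tsub_add_cancel_of_le h0]
    simp
  · have hn : n 0 = 0 := by
      by_contra h
      exact h0 (Finsupp.single_le_iff.2 (Nat.one_le_iff_ne_zero.2 h))
    rw [if_neg h0, if_pos hn]
    by_cases h1 : Finsupp.single 1 1 ≤ n
    · have hm : n 1 ≠ 0 := Nat.one_le_iff_ne_zero.1 (by simpa using h1 1)
      have hn' : n ≠ 0 := fun h => hm (by rw [h]; rfl)
      rw [if_pos h1, if_neg hn', tsub_add_cancel_of_le h1]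
      simp
    · have hm : n 1 = 0 := by
        by_contra h
        exact h1 (Finsupp.single_le_iff.2 (Nat.one_le_iff_ne_zero.2 h))
      have hn' : n = 0 := by
        ext i
        fin_cases i
        · exact hn
        · exact hm
      rw [if_neg h1, if_pos hn', hn']
      simp

/-- A parameter-linear map that kills the constants has values in every power of `(h, g)`. -/
theorem eq_zero {Φ : FPS A →ₗ[K] FPS B} (h : IsParLinear Φ) (h0 : ∀ a, Φ (constSeries K a) = 0)
    (x : FPS A) : Φ x = 0 := by
  refine AgreeBelow.eq fun M => ?_
  induction M generalizing x with
  | zero => exact fun n hn => absurd hn (Nat.not_lt_zero _)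
  | succ M ih =>
    obtain ⟨a, y, z, rfl⟩ := exists_eq (K := K) x
    rw [map_add, map_add, h0, zero_add, h.map_parH, h.map_parG]
    intro n hn
    rw [map_add, parH, parG, MvPowerSeries.X_def, MvPowerSeries.X_def,
      MvPowerSeries.coeff_monomial_mul, MvPowerSeries.coeff_monomial_mul]
    have aux : ∀ (i : Fin 2) (w : FPS A), Finsupp.single i 1 ≤ n →
        MvPowerSeries.coeff (n - Finsupp.single i 1) (Φ w) = 0 := fun i w hi => by
      rw [ih w (n - Finsupp.single i 1), map_zero]
      have := congrArg Finsupp.degree (tsub_add_cancel_of_le hi)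
      rw [map_add, Finsupp.degree_single] at this
      omega
    split_ifs with h1 h2 h2 <;> simp [*]

/-- Parameter-linear maps that agree on constant series are equal. -/
theorem ext {Φ Ψ : FPS A →ₗ[K] FPS B} (h : IsParLinear Φ) (h' : IsParLinear Ψ)
    (h0 : ∀ a, Φ (constSeries K a) = Ψ (constSeries K a)) (x : FPS A) : Φ x = Ψ x :=
  sub_eq_zero.1 ((h.sub h').eq_zero (fun a => by simp [h0]) x)

theorem mapSeries (φ : A →ₗ[K] B) : IsParLinear (mapSeries K φ) := by
  have aux : ∀ (i : Fin 2) (x : FPS A), TwistedSl12.mapSeries K φ (MvPowerSeries.X i * x) =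
      MvPowerSeries.X i * TwistedSl12.mapSeries K φ x := fun i x => by
    ext n
    change φ (MvPowerSeries.coeff n _) = _
    rw [MvPowerSeries.X_def, MvPowerSeries.X_def, MvPowerSeries.coeff_monomial_mul,
      MvPowerSeries.coeff_monomial_mul, apply_ite φ, map_zero, one_mul, one_mul]
    rfl
  exact ⟨aux 0, aux 1⟩

theorem extendSeries (φ : A →ₗ[K] FPS B) : IsParLinear (extendSeries K φ) := by
  have aux : ∀ (i : Fin 2) (x : FPS A), TwistedSl12.extendSeries K φ (MvPowerSeries.X i * x) =
      MvPowerSeries.X i * TwistedSl12.extendSeries K φ x := fun i x => by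
    ext n
    change ∑ p ∈ Finset.HasAntidiagonal.antidiagonal n,
      MvPowerSeries.coeff p.2 (φ (MvPowerSeries.coeff p.1 (MvPowerSeries.X i * x))) = _
    rw [MvPowerSeries.X_def, MvPowerSeries.X_def, MvPowerSeries.coeff_monomial_mul, one_mul]
    simp only [MvPowerSeries.coeff_monomial_mul, one_mul]
    split_ifs with hn
    · refine (Finset.sum_of_injOn (fun q => (q.1 + Finsupp.single i 1, q.2)) ?_ ?_ ?_ ?_).symm
      · rintro ⟨q, r⟩ _ ⟨q', r'⟩ _ h
        simpa using h
      · rintro ⟨q, r⟩ hq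
        simp only [Finset.mem_coe, Finset.HasAntidiagonal.mem_antidiagonal] at hq ⊢
        rw [add_right_comm, hq, tsub_add_cancel_of_le hn]
      · rintro ⟨q, r⟩ hq hq'
        rw [if_neg, map_zero, map_zero]
        intro hi
        refine hq' ⟨(q - Finsupp.single i 1, r), ?_, ?_⟩
        · simp only [Finset.mem_coe, Finset.HasAntidiagonal.mem_antidiagonal] at hq ⊢
          rw [← hq, tsub_add_eq_add_tsub hi]
        · simp only [tsub_add_cancel_of_le hi]
      · rintro ⟨q, r⟩ _
        simp
    · refine Finset.sum_eq_zero fun p hp => ?_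
      rw [if_neg, map_zero, map_zero]
      exact fun hi => hn (hi.trans (Finset.HasAntidiagonal.mem_antidiagonal.1 hp ▸ le_self_add))
  exact ⟨aux 0, aux 1⟩

theorem _root_.TwistedSl12.mapSeries_algebraMap_mul (c : K) (x : FPS A) :
    TwistedSl12.mapSeries K (Algebra.linearMap K A) (constSeries K c) * x = c • x := by
  rw [Algebra.smul_def]
  congr 1

/-- A parameter-linear map commutes with multiplication by scalar series. -/
theorem map_scalar_mul {Φ : FPS A →ₗ[K] FPS B} (h : IsParLinear Φ) (c : FPS K) (x : FPS A) :
    Φ (scalar K c * x) = scalar K c * Φ x := by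
  refine ext (h.comp ((mulRight x).comp (mapSeries (Algebra.linearMap K A))))
    ((mulRight (Φ x)).comp (mapSeries (Algebra.linearMap K B))) (fun a => ?_) c
  simp only [LinearMap.comp_apply, LinearMap.mulRight_apply]
  rw [mapSeries_algebraMap_mul, mapSeries_algebraMap_mul, map_smul]

end IsParLinear

theorem extendSeries_constSeries (φ : A →ₗ[K] FPS B) (a : A) :
    extendSeries K φ (constSeries K a) = φ a := by
  ext n
  change ∑ p ∈ Finset.HasAntidiagonal.antidiagonal n,
    MvPowerSeries.coeff p.2 (φ (MvPowerSeries.coeff p.1 (MvPowerSeries.C a))) = _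
  rw [Finset.sum_eq_single (0, n)]
  · simp
  · rintro ⟨q, r⟩ hq hne
    rw [MvPowerSeries.coeff_C, if_neg, map_zero, map_zero]
    rintro rfl
    rw [Finset.HasAntidiagonal.mem_antidiagonal, zero_add] at hq
    exact hne (by rw [← hq])
  · simp

end ParLinear

end
end TwistedSl12

namespace TwistedSl12

open scoped TensorProduct

noncomputable section

/-! ### Coefficientwise morphisms -/

section MapHom
variable {K : Type*} [Field K]
variable {A : Type*} [Ring A] [Algebra K A]
variable {B : Type*} [Ring B] [Algebra K B]
variable {C : Type*} [Ring C] [Algebra K C]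

/-- The map on series induced by an algebra morphism. -/
abbrev mapHom (f : A →ₐ[K] B) : FPS A →ₐ[K] FPS B := MvPowerSeries.mapAlgHom f

theorem mapSeries_toLinearMap (f : A →ₐ[K] B) (x : FPS A) :
    mapSeries K f.toLinearMap x = mapHom f x := rfl

theorem mapHom_mapHom (f : B →ₐ[K] C) (g : A →ₐ[K] B) (x : FPS A) :
    mapHom f (mapHom g x) = mapHom (f.comp g) x := rfl

theorem mapSeries_constSeries (φ : A →ₗ[K] B) (a : A) :
    mapSeries K φ (constSeries K a) = constSeries K (φ a) := by
  classical
  ext n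
  change φ (MvPowerSeries.coeff n (MvPowerSeries.C a)) = MvPowerSeries.coeff n (MvPowerSeries.C _)
  rw [MvPowerSeries.coeff_C, MvPowerSeries.coeff_C, apply_ite φ, map_zero]

theorem mapHom_constSeries (f : A →ₐ[K] B) (a : A) :
    mapHom f (constSeries K a) = constSeries K (f a) :=
  mapSeries_constSeries f.toLinearMap a

theorem constSeries_mul (a b : A) : constSeries K (a * b) = constSeries K a * constSeries K b :=
  map_mul MvPowerSeries.C a b

theorem mapHom_inverse (f : A →ₐ[K] B) {u : FPS A} (hu : IsUnit u) :
    mapHom f (Ring.inverse u) = Ring.inverse (mapHom f u) := by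
  obtain ⟨u, rfl⟩ := hu
  rw [Ring.inverse_unit]
  exact (Ring.inverse_unit (Units.map (mapHom f : FPS A →* FPS B) u)).symm

theorem isParLinear_conjBy (u : FPS A) : IsParLinear (K := K) (conjBy u) :=
  (IsParLinear.mulLeft u).comp (IsParLinear.mulRight _)

theorem conjBy_apply (u x : FPS A) : conjBy (K := K) u x = u * x * Ring.inverse u :=
  (mul_assoc _ _ _).symm

end MapHom

/-! ### Super tensor products -/

section SuperTensor
variable {K : Type*} [Field K] [CharZero K]
variable {A : Type*} [Ring A] [Algebra K A] [Superalgebra K A]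
variable {B : Type*} [Ring B] [Algebra K B] [Superalgebra K B]
variable {C : Type*} [Ring C] [Algebra K C] [Superalgebra K C]
variable {Q : Type*} [Ring Q] [Algebra K Q]

variable (K) in
theorem exists_even_add_odd (a : A) :
    ∃ a₀ ∈ homogeneous K A 0, ∃ a₁ ∈ homogeneous K A 1, a = a₀ + a₁ := by
  refine ⟨_, (evenPart K a).2, _, (oddPart K a).2, ?_⟩
  simp only [evenPart, oddPart, LinearMap.codRestrict_apply, LinearMap.smul_apply,
    LinearMap.add_apply, LinearMap.sub_apply, LinearMap.id_apply, ← smul_add]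
  rw [add_add_sub_cancel, smul_add, half_add_half]

theorem zmod_two_cases {P : ZMod 2 → Prop} (h0 : P 0) (h1 : P 1) (i : ZMod 2) : P i := by
  rcases (by decide : ∀ k : ZMod 2, k = 0 ∨ k = 1) i with rfl | rfl
  exacts [h0, h1]

/-- Induction over the pure tensors of homogeneous elements. -/
theorem superTensor_induction {P : SuperTensor K A B → Prop} (h0 : P 0)
    (hadd : ∀ x y, P x → P y → P (x + y))
    (hmul : ∀ ⦃i j a b⦄, a ∈ homogeneous K A i → b ∈ homogeneous K B j →
      P (tensorInl K A B a * tensorInr K A B b)) (x : SuperTensor K A B) : P x := by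
  have key : ∀ t : A ⊗[K] B, P (GradedTensorProduct.of K _ _ t) := fun t => by
    induction t using TensorProduct.induction_on with
    | zero => simpa using h0
    | add x y hx hy => rw [map_add]; exact hadd _ _ hx hy
    | tmul a b =>
      change P (a ᵍ⊗ₜ[K] b)
      rw [← inl_mul_inr]
      obtain ⟨a₀, ha₀, a₁, ha₁, rfl⟩ := exists_even_add_odd K a
      obtain ⟨b₀, hb₀, b₁, hb₁, rfl⟩ := exists_even_add_odd K b
      rw [map_add, map_add, mul_add, add_mul, add_mul]
      exact hadd _ _ (hadd _ _ (hmul ha₀ hb₀) (hmul ha₁ hb₀))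
        (hadd _ _ (hmul ha₀ hb₁) (hmul ha₁ hb₁))
  exact key x

/-- Linear maps that agree on pure tensors of homogeneous elements are equal. -/
theorem superTensor_linear_ext {M : Type*} [AddCommGroup M] [Module K M]
    {f g : SuperTensor K A B →ₗ[K] M}
    (h : ∀ ⦃i j a b⦄, a ∈ homogeneous K A i → b ∈ homogeneous K B j →
      f (tensorInl K A B a * tensorInr K A B b) = g (tensorInl K A B a * tensorInr K A B b)) :
    f = g :=
  LinearMap.ext (superTensor_induction (by simp) (fun x y hx hy => by rw [map_add, map_add, hx, hy])
    h)

theorem superTensor_algHom_ext {f g : SuperTensor K A B →ₐ[K] Q}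
    (hl : ∀ a, f (tensorInl K A B a) = g (tensorInl K A B a))
    (hr : ∀ b, f (tensorInr K A B b) = g (tensorInr K A B b)) : f = g :=
  GradedTensorProduct.algHom_ext _ _ (AlgHom.ext hl) (AlgHom.ext hr)

/-- The values of two algebra morphisms supercommute. -/
def SuperCommute (f : A →ₐ[K] Q) (g : B →ₐ[K] Q) : Prop :=
  ∀ ⦃i j a b⦄, a ∈ homogeneous K A i → b ∈ homogeneous K B j →
    f a * g b = ((-1 : ℤˣ) ^ (j * i)) • (g b * f a)

/-- `a ⊗ b ↦ f(a) g(b)` for supercommuting morphisms `f` and `g`. -/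
def superLift (f : A →ₐ[K] Q) (g : B →ₐ[K] Q) (h : SuperCommute f g) : SuperTensor K A B →ₐ[K] Q :=
  GradedTensorProduct.lift _ _ f g fun _ _ a b => h a.2 b.2

theorem superLift_inl (f : A →ₐ[K] Q) (g : B →ₐ[K] Q) (h : SuperCommute f g) (a : A) :
    superLift f g h (tensorInl K A B a) = f a := by
  change f a * g 1 = f a
  rw [map_one, mul_one]

theorem superLift_inr (f : A →ₐ[K] Q) (g : B →ₐ[K] Q) (h : SuperCommute f g) (b : B) :
    superLift f g h (tensorInr K A B b) = g b := by
  change f 1 * g b = g b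
  rw [map_one, one_mul]

namespace SuperCommute

theorem inl_inr : SuperCommute (tensorInl K A B) (tensorInr K A B) :=
  fun _ _ _ _ ha hb => inl_mul_inr' K ha hb

variable {f : A →ₐ[K] Q} {g : B →ₐ[K] Q} {e : C →ₐ[K] Q}

theorem symm (h : SuperCommute f g) : SuperCommute g f := fun i j a b ha hb => by
  rw [h hb ha, smul_smul, mul_comm j i, Int.units_mul_self, one_smul]

theorem comp_left (h : SuperCommute f g) {f' : C →ₐ[K] A}
    (hf' : ∀ c, f' (parity K c) = parity K (f' c)) : SuperCommute (f.comp f') g :=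
  fun _ _ _ _ ha hb => h (map_mem hf' ha) hb

theorem comp_right (h : SuperCommute f g) {g' : C →ₐ[K] B}
    (hg' : ∀ c, g' (parity K c) = parity K (g' c)) : SuperCommute f (g.comp g') :=
  fun _ _ _ _ ha hb => h ha (map_mem hg' hb)

theorem map {Q' : Type*} [Ring Q'] [Algebra K Q'] (h : SuperCommute f g) (φ : Q →ₐ[K] Q') :
    SuperCommute (φ.comp f) (φ.comp g) := fun _ _ _ _ ha hb => by
  simp only [AlgHom.comp_apply]
  rw [← map_mul, h ha hb, Units.smul_def, map_zsmul, map_mul, Units.smul_def]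

theorem even_left (h : SuperCommute f g) {a : A} (ha : a ∈ homogeneous K A 0) (b : B) :
    Commute (f a) (g b) := by
  obtain ⟨b₀, hb₀, b₁, hb₁, rfl⟩ := exists_even_add_odd K b
  rw [map_add]
  exact Commute.add_right (show _ = _ by simpa using h ha hb₀)
    (show _ = _ by simpa using h ha hb₁)

theorem even_right (h : SuperCommute f g) (a : A) {b : B} (hb : b ∈ homogeneous K B 0) :
    Commute (f a) (g b) :=
  (h.symm.even_left hb a).symm

/-- The sign rule for an odd right argument, with the sign absorbed in the parity involution so that
the left argument need not be homogeneous. -/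
theorem odd_right (h : SuperCommute f g) (a : A) {b : B} (hb : b ∈ homogeneous K B 1) :
    f a * g b = g b * f (parity K a) := by
  obtain ⟨a₀, ha₀, a₁, ha₁, rfl⟩ := exists_even_add_odd K a
  have h0 := h ha₀ hb
  have h1 := h ha₁ hb
  simp only [mul_zero, mul_one, uzpow_zero, uzpow_one, one_smul, Units.neg_smul] at h0 h1
  rw [map_add, map_add, add_mul, h0, h1, (mem_even K).1 ha₀, (mem_odd K).1 ha₁, map_add, map_neg,
    mul_add, mul_neg]

theorem of_even_odd (h0 : ∀ a, ∀ b ∈ homogeneous K B 0, f a * g b = g b * f a)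
    (h1 : ∀ a, ∀ b ∈ homogeneous K B 1, f a * g b = g b * f (parity K a)) : SuperCommute f g := by
  intro i j a b ha hb
  induction j using zmod_two_cases
  · simpa using h0 a b hb
  · rw [h1 a b hb, (mem_homogeneous K).1 ha, one_mul, Units.smul_def, Units.smul_def, map_zsmul,
      mul_smul_comm]

theorem lift_left (hf : SuperCommute f e) (hg : SuperCommute g e) (h : SuperCommute f g) :
    SuperCommute (superLift f g h) e := by
  refine of_even_odd (fun x c hc => ?_) (fun x c hc => ?_)
  · induction x using superTensor_induction with
    | h0 => simp
    | hadd x y hx hy => rw [map_add, add_mul, mul_add, hx, hy]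
    | hmul ha hb =>
      rw [map_mul, superLift_inl, superLift_inr, mul_assoc, (hg.even_right _ hc).eq, ← mul_assoc,
        (hf.even_right _ hc).eq, mul_assoc]
  · induction x using superTensor_induction with
    | h0 => simp
    | hadd x y hx hy => rw [map_add, add_mul, map_add, map_add, mul_add, hx, hy]
    | hmul ha hb =>
      rw [map_mul, superLift_inl, superLift_inr, map_mul, map_mul, parity_inl, parity_inr,
        superLift_inl, superLift_inr, mul_assoc, hg.odd_right _ hc, ← mul_assoc,
        hf.odd_right _ hc, mul_assoc]

end SuperCommute

theorem superFlip_inl (a : A) : superFlip K (tensorInl K A B a) = tensorInr K B A a := by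
  obtain ⟨a₀, ha₀, a₁, ha₁, rfl⟩ := exists_even_add_odd K a
  have aux : ∀ {i} {a : A}, a ∈ homogeneous K A i →
      superFlip K (tensorInl K A B a) = tensorInr K B A a := fun {i a} ha => by
    have := GradedTensorProduct.comm_coe_tmul_coe (R := K) (homogeneous K A) (homogeneous K B)
      ⟨a, ha⟩ ⟨1, SetLike.GradedOne.one_mem⟩
    rw [zero_mul, uzpow_zero, one_smul] at this
    exact this
  rw [map_add, map_add, map_add, aux ha₀, aux ha₁]

theorem superFlip_inr (b : B) : superFlip K (tensorInr K A B b) = tensorInl K B A b := by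
  obtain ⟨b₀, hb₀, b₁, hb₁, rfl⟩ := exists_even_add_odd K b
  have aux : ∀ {i} {b : B}, b ∈ homogeneous K B i →
      superFlip K (tensorInr K A B b) = tensorInl K B A b := fun {i b} hb => by
    have := GradedTensorProduct.comm_coe_tmul_coe (R := K) (homogeneous K A) (homogeneous K B)
      ⟨1, SetLike.GradedOne.one_mem⟩ ⟨b, hb⟩
    rw [mul_zero, uzpow_zero, one_smul] at this
    exact this
  rw [map_add, map_add, map_add, aux hb₀, aux hb₁]

theorem superFlip_superFlip (x : SuperTensor K A B) : superFlip K (superFlip K x) = x := by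
  have h : ((superFlip K : SuperTensor K B A ≃ₐ[K] SuperTensor K A B) :
      SuperTensor K B A →ₐ[K] SuperTensor K A B).comp (superFlip K : SuperTensor K A B ≃ₐ[K] _) =
      AlgHom.id K _ :=
    superTensor_algHom_ext (fun a => by simp [superFlip_inl, superFlip_inr])
      (fun b => by simp [superFlip_inl, superFlip_inr])
  exact DFunLike.congr_fun h x

theorem superFlip_parity (x : SuperTensor K A B) :
    superFlip K (parity K x) = parity K (superFlip K x) := by
  have h : ((superFlip K : SuperTensor K A B ≃ₐ[K] SuperTensor K B A) :
      SuperTensor K A B →ₐ[K] SuperTensor K B A).comp (parity K) =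
      (parity K).comp (superFlip K : SuperTensor K A B ≃ₐ[K] _).toAlgHom :=
    superTensor_algHom_ext (fun a => by simp [superFlip_inl, parity_inl, parity_inr])
      (fun b => by simp [superFlip_inr, parity_inl, parity_inr])
  exact DFunLike.congr_fun h x

/-- `a ⊗ b ↦ p(a) q(b)` for linear maps `p` and `q` to an algebra. -/
def tensorLift (p : A →ₗ[K] Q) (q : B →ₗ[K] Q) : SuperTensor K A B →ₗ[K] Q :=
  LinearMap.mul' K Q ∘ₗ TensorProduct.map p q ∘ₗ
    (GradedTensorProduct.of K (homogeneous K A) (homogeneous K B)).symm.toLinearMap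

theorem tensorLift_inl_mul_inr (p : A →ₗ[K] Q) (q : B →ₗ[K] Q) (a : A) (b : B) :
    tensorLift p q (tensorInl K A B a * tensorInr K A B b) = p a * q b := by
  rw [inl_mul_inr]
  rfl

theorem tensorLift_toLinearMap (f : A →ₐ[K] Q) (g : B →ₐ[K] Q) (h : SuperCommute f g) :
    tensorLift f.toLinearMap g.toLinearMap = (superLift f g h).toLinearMap := rfl

theorem mulTensor_const (p : FPS A →ₗ[K] FPS Q) (q : FPS B →ₗ[K] FPS Q) (a : A) (b : B) :
    mulTensor K p q (constSeries K (tensorInl K A B a * tensorInr K A B b)) =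
      p (constSeries K a) * q (constSeries K b) := by
  rw [mulTensor, extendSeries_constSeries, inl_mul_inr]
  rfl

theorem isParLinear_mulTensor (p : FPS A →ₗ[K] FPS Q) (q : FPS B →ₗ[K] FPS Q) :
    IsParLinear (mulTensor K p q) :=
  IsParLinear.extendSeries _

/-- Parameter-linear maps that agree on constant pure tensors of homogeneous elements are equal. -/
theorem IsParLinear.ext_tensor {Φ Ψ : FPS (SuperTensor K A B) →ₗ[K] FPS Q} (h : IsParLinear Φ)
    (h' : IsParLinear Ψ)
    (hmul : ∀ ⦃i j a b⦄, a ∈ homogeneous K A i → b ∈ homogeneous K B j →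
      Φ (constSeries K (tensorInl K A B a * tensorInr K A B b)) =
        Ψ (constSeries K (tensorInl K A B a * tensorInr K A B b)))
    (x : FPS (SuperTensor K A B)) : Φ x = Ψ x :=
  h.ext h' (fun z => DFunLike.congr_fun
    (superTensor_linear_ext (f := Φ ∘ₗ constSeries K) (g := Ψ ∘ₗ constSeries K) hmul) z) x

theorem mulTensor_mapSeries (p : A →ₗ[K] Q) (q : B →ₗ[K] Q) (x : FPS (SuperTensor K A B)) :
    mulTensor K (mapSeries K p) (mapSeries K q) x = mapSeries K (tensorLift p q) x := by
  refine (isParLinear_mulTensor _ _).ext_tensor (IsParLinear.mapSeries _) (fun i j a b _ _ => ?_) x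
  rw [mulTensor_const, mapSeries_constSeries, mapSeries_constSeries, mapSeries_constSeries,
    tensorLift_inl_mul_inr, constSeries_mul]

/-- An even series in one factor commutes with the constants of a supercommuting factor. -/
theorem SuperCommute.commute_mapHom {f : A →ₐ[K] Q} {g : B →ₐ[K] Q} (h : SuperCommute f g)
    {x : FPS A} (hx : mapHom (parity K) x = x) (b : B) :
    Commute (mapHom f x) (constSeries K (g b)) := by
  ext n
  change MvPowerSeries.coeff n (_ * MvPowerSeries.C _) =
    MvPowerSeries.coeff n (MvPowerSeries.C _ * _)
  rw [MvPowerSeries.coeff_mul_C, MvPowerSeries.coeff_C_mul]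
  have h0 : MvPowerSeries.coeff n x ∈ homogeneous K A 0 :=
    (mem_even K).2 (congrArg (MvPowerSeries.coeff n) hx)
  exact h.even_left h0 b

end SuperTensor

end
end TwistedSl12

namespace TwistedSl12

open scoped TensorProduct

noncomputable section

/-! ### Legs and their permutations -/

section Legs
variable (K : Type*) [Field K] [CharZero K]
variable (A : Type*) [Ring A] [Algebra K A] [Superalgebra K A]

theorem leg₁₂_inl (a : A) : leg₁₂ K A (tensorInl K A A a) = leg₁ K A a := rfl

theorem leg₁₂_inr (a : A) : leg₁₂ K A (tensorInr K A A a) = leg₂ K A a := rfl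

theorem superCommute_leg₁_leg₂ : SuperCommute (leg₁ K A) (leg₂ K A) :=
  SuperCommute.inl_inr.map (tensorInl K (SuperTensor K A A) A)

theorem superCommute_leg₁₂_leg₃ : SuperCommute (leg₁₂ K A) (leg₃ K A) := SuperCommute.inl_inr

theorem superCommute_leg₁_leg₃ : SuperCommute (leg₁ K A) (leg₃ K A) :=
  (superCommute_leg₁₂_leg₃ K A).comp_left fun a => (parity_inl K a).symm

theorem superCommute_leg₂_leg₃ : SuperCommute (leg₂ K A) (leg₃ K A) :=
  (superCommute_leg₁₂_leg₃ K A).comp_left fun a => (parity_inr K a).symm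

theorem leg₁₃_inl (a : A) : leg₁₃ K A (tensorInl K A A a) = leg₁ K A a :=
  superLift_inl _ _ (superCommute_leg₁_leg₃ K A) a

theorem leg₁₃_inr (a : A) : leg₁₃ K A (tensorInr K A A a) = leg₃ K A a :=
  superLift_inr _ _ (superCommute_leg₁_leg₃ K A) a

theorem leg₂₃_inl (a : A) : leg₂₃ K A (tensorInl K A A a) = leg₂ K A a :=
  superLift_inl _ _ (superCommute_leg₂_leg₃ K A) a

theorem leg₂₃_inr (a : A) : leg₂₃ K A (tensorInr K A A a) = leg₃ K A a :=
  superLift_inr _ _ (superCommute_leg₂_leg₃ K A) a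

theorem superCommute_leg₁_leg₂₃ : SuperCommute (leg₁ K A) (leg₂₃ K A) :=
  ((superCommute_leg₁_leg₂ K A).symm.lift_left (superCommute_leg₁_leg₃ K A).symm
    (superCommute_leg₂_leg₃ K A)).symm

theorem superCommute_leg₁₃_leg₂ : SuperCommute (leg₁₃ K A) (leg₂ K A) :=
  (superCommute_leg₁_leg₂ K A).lift_left (superCommute_leg₂_leg₃ K A).symm
    (superCommute_leg₁_leg₃ K A)

/-- The super flip of the factors of `A ⊗ A`, as a morphism. -/
def flipHom : SuperTensor K A A →ₐ[K] SuperTensor K A A := (superFlip K).toAlgHom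

theorem flipHom_inl (a : A) : flipHom K A (tensorInl K A A a) = tensorInr K A A a :=
  superFlip_inl a

theorem flipHom_inr (a : A) : flipHom K A (tensorInr K A A a) = tensorInl K A A a :=
  superFlip_inr a

/-- The super flip of the first two factors of `A ⊗ A ⊗ A`. -/
def swap₁₂ : Tensor₃ K A →ₐ[K] Tensor₃ K A :=
  superLift ((leg₁₂ K A).comp (flipHom K A)) (leg₃ K A)
    ((superCommute_leg₁₂_leg₃ K A).comp_left superFlip_parity)

/-- The super flip of the last two factors of `A ⊗ A ⊗ A`. -/
def swap₂₃ : Tensor₃ K A →ₐ[K] Tensor₃ K A :=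
  superLift (leg₁₃ K A) (leg₂ K A) (superCommute_leg₁₃_leg₂ K A)

theorem swap₁₂_leg₁₂ (x : SuperTensor K A A) :
    swap₁₂ K A (leg₁₂ K A x) = leg₁₂ K A (flipHom K A x) :=
  superLift_inl _ _ _ x

theorem swap₁₂_leg₁ (a : A) : swap₁₂ K A (leg₁ K A a) = leg₂ K A a :=
  (swap₁₂_leg₁₂ K A _).trans (congrArg _ (flipHom_inl K A a))

theorem swap₁₂_leg₂ (a : A) : swap₁₂ K A (leg₂ K A a) = leg₁ K A a :=
  (swap₁₂_leg₁₂ K A _).trans (congrArg _ (flipHom_inr K A a))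

theorem swap₁₂_leg₃ (a : A) : swap₁₂ K A (leg₃ K A a) = leg₃ K A a :=
  superLift_inr _ _ _ a

theorem swap₂₃_leg₁₂ (x : SuperTensor K A A) : swap₂₃ K A (leg₁₂ K A x) = leg₁₃ K A x :=
  superLift_inl _ _ _ x

theorem swap₂₃_leg₁ (a : A) : swap₂₃ K A (leg₁ K A a) = leg₁ K A a :=
  (swap₂₃_leg₁₂ K A _).trans (leg₁₃_inl K A a)

theorem swap₂₃_leg₂ (a : A) : swap₂₃ K A (leg₂ K A a) = leg₃ K A a :=
  (swap₂₃_leg₁₂ K A _).trans (leg₁₃_inr K A a)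

theorem swap₂₃_leg₃ (a : A) : swap₂₃ K A (leg₃ K A a) = leg₂ K A a :=
  superLift_inr _ _ _ a

theorem swap₁₂_leg₁₃ (x : SuperTensor K A A) : swap₁₂ K A (leg₁₃ K A x) = leg₂₃ K A x :=
  DFunLike.congr_fun (superTensor_algHom_ext (f := (swap₁₂ K A).comp (leg₁₃ K A))
    (fun a => by simp [leg₁₃_inl, leg₂₃_inl, swap₁₂_leg₁])
    (fun a => by simp [leg₁₃_inr, leg₂₃_inr, swap₁₂_leg₃])) x

theorem swap₁₂_leg₂₃ (x : SuperTensor K A A) : swap₁₂ K A (leg₂₃ K A x) = leg₁₃ K A x :=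
  DFunLike.congr_fun (superTensor_algHom_ext (f := (swap₁₂ K A).comp (leg₂₃ K A))
    (fun a => by simp [leg₁₃_inl, leg₂₃_inl, swap₁₂_leg₂])
    (fun a => by simp [leg₁₃_inr, leg₂₃_inr, swap₁₂_leg₃])) x

theorem swap₂₃_leg₁₃ (x : SuperTensor K A A) : swap₂₃ K A (leg₁₃ K A x) = leg₁₂ K A x :=
  DFunLike.congr_fun (superTensor_algHom_ext (f := (swap₂₃ K A).comp (leg₁₃ K A))
    (fun a => by simp [leg₁₃_inl, leg₁₂_inl, swap₂₃_leg₁])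
    (fun a => by simp [leg₁₃_inr, leg₁₂_inr, swap₂₃_leg₃])) x

theorem swap₂₃_leg₂₃ (x : SuperTensor K A A) :
    swap₂₃ K A (leg₂₃ K A x) = leg₂₃ K A (flipHom K A x) :=
  DFunLike.congr_fun (superTensor_algHom_ext (f := (swap₂₃ K A).comp (leg₂₃ K A))
    (g := (leg₂₃ K A).comp (flipHom K A))
    (fun a => by simp [leg₂₃_inl, leg₂₃_inr, swap₂₃_leg₂, flipHom_inl])
    (fun a => by simp [leg₂₃_inl, leg₂₃_inr, swap₂₃_leg₃, flipHom_inr])) x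

end Legs

/-! ### Twisting a cocommutative Hopf superalgebra -/

section Twisting
variable {K : Type*} [Field K] [CharZero K]
variable {A : Type*} [Ring A] [Algebra K A] [Superalgebra K A]

/-- A Hopf superalgebra with coproduct `Δ₀`, counit `ε₀` and antipode `S₀`, cocommutative with
respect to the super flip. -/
structure IsCocommutativeHopf (Δ₀ : A →ₐ[K] SuperTensor K A A) (ε₀ : A →ₐ[K] K)
    (S₀ : A →ₗ[K] A) : Prop where
  comul_parity : ∀ a, Δ₀ (parity K a) = parity K (Δ₀ a)
  counit_parity : ∀ a, ε₀ (parity K a) = ε₀ a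
  coassoc : ∀ a,
    tensorLift ((leg₁₂ K A).comp Δ₀).toLinearMap (leg₃ K A).toLinearMap (Δ₀ a) =
      tensorLift (leg₁ K A).toLinearMap ((leg₂₃ K A).comp Δ₀).toLinearMap (Δ₀ a)
  counit_left : ∀ a, tensorLift (Algebra.linearMap K A ∘ₗ ε₀.toLinearMap) LinearMap.id (Δ₀ a) = a
  counit_right : ∀ a, tensorLift LinearMap.id (Algebra.linearMap K A ∘ₗ ε₀.toLinearMap) (Δ₀ a) = a
  cocomm : ∀ a, superFlip K (Δ₀ a) = Δ₀ a
  antipode_parity : ∀ a, S₀ (parity K a) = parity K (S₀ a)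
  antipode_one : S₀ 1 = 1
  antipode_mul : ∀ ⦃i j a b⦄, a ∈ homogeneous K A i → b ∈ homogeneous K A j →
    S₀ (a * b) = ((-1 : ℤˣ) ^ (j * i)) • (S₀ b * S₀ a)
  antipode_left : ∀ a, tensorLift S₀ LinearMap.id (Δ₀ a) = algebraMap K A (ε₀ a)
  antipode_right : ∀ a, tensorLift LinearMap.id S₀ (Δ₀ a) = algebraMap K A (ε₀ a)

namespace IsCocommutativeHopf
variable {Δ₀ : A →ₐ[K] SuperTensor K A A} {ε₀ : A →ₐ[K] K} {S₀ : A →ₗ[K] A}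

/-- `Δ₀ ⊗ id` as a morphism. -/
def comulLeftHom (H : IsCocommutativeHopf Δ₀ ε₀ S₀) : SuperTensor K A A →ₐ[K] Tensor₃ K A :=
  superLift ((leg₁₂ K A).comp Δ₀) (leg₃ K A)
    ((superCommute_leg₁₂_leg₃ K A).comp_left H.comul_parity)

/-- `id ⊗ Δ₀` as a morphism. -/
def comulRightHom (H : IsCocommutativeHopf Δ₀ ε₀ S₀) : SuperTensor K A A →ₐ[K] Tensor₃ K A :=
  superLift (leg₁ K A) ((leg₂₃ K A).comp Δ₀)
    ((superCommute_leg₁_leg₂₃ K A).comp_right H.comul_parity)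

theorem counit_odd (H : IsCocommutativeHopf Δ₀ ε₀ S₀) {a : A} (ha : a ∈ homogeneous K A 1) :
    ε₀ a = 0 := by
  have h := H.counit_parity a
  rw [(mem_odd K).1 ha, map_neg] at h
  exact self_eq_neg.1 h.symm

theorem superCommute_counit (H : IsCocommutativeHopf Δ₀ ε₀ S₀) :
    SuperCommute ((Algebra.ofId K A).comp ε₀) (AlgHom.id K A) := by
  intro i j a b ha hb
  induction i using zmod_two_cases
  · simpa using Algebra.commutes _ _
  · simp [H.counit_odd ha]

/-- `ε₀ ⊗ id` as a morphism. -/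
def counitLeftHom (H : IsCocommutativeHopf Δ₀ ε₀ S₀) : SuperTensor K A A →ₐ[K] A :=
  superLift ((Algebra.ofId K A).comp ε₀) (AlgHom.id K A) H.superCommute_counit

/-- `id ⊗ ε₀` as a morphism. -/
def counitRightHom (H : IsCocommutativeHopf Δ₀ ε₀ S₀) : SuperTensor K A A →ₐ[K] A :=
  superLift (AlgHom.id K A) ((Algebra.ofId K A).comp ε₀) H.superCommute_counit.symm

variable (H : IsCocommutativeHopf Δ₀ ε₀ S₀)
include H

theorem comulLeft_mapSeries (x : FPS (SuperTensor K A A)) :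
    comulLeft (mapSeries K Δ₀.toLinearMap) x = mapHom H.comulLeftHom x :=
  mulTensor_mapSeries ((leg₁₂ K A).comp Δ₀).toLinearMap (leg₃ K A).toLinearMap x

theorem comulRight_mapSeries (x : FPS (SuperTensor K A A)) :
    comulRight (mapSeries K Δ₀.toLinearMap) x = mapHom H.comulRightHom x :=
  mulTensor_mapSeries (leg₁ K A).toLinearMap ((leg₂₃ K A).comp Δ₀).toLinearMap x

theorem counitLeft_mapSeries (x : FPS (SuperTensor K A A)) :
    counitLeft (mapSeries K ε₀.toLinearMap) x = mapHom H.counitLeftHom x :=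
  mulTensor_mapSeries ((Algebra.ofId K A).comp ε₀).toLinearMap LinearMap.id x

theorem counitRight_mapSeries (x : FPS (SuperTensor K A A)) :
    counitRight (mapSeries K ε₀.toLinearMap) x = mapHom H.counitRightHom x :=
  mulTensor_mapSeries LinearMap.id ((Algebra.ofId K A).comp ε₀).toLinearMap x

theorem comulLeftHom_comul (a : A) : H.comulLeftHom (Δ₀ a) = H.comulRightHom (Δ₀ a) :=
  H.coassoc a

/-- Cocommutativity: `Δ₀ ⊗ id` is invariant under the flip of the first two factors. -/
theorem swap₁₂_comulLeftHom (x : SuperTensor K A A) :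
    swap₁₂ K A (H.comulLeftHom x) = H.comulLeftHom x :=
  DFunLike.congr_fun (superTensor_algHom_ext (f := (swap₁₂ K A).comp H.comulLeftHom)
    (fun a => by
      rw [AlgHom.comp_apply, comulLeftHom, superLift_inl, AlgHom.comp_apply, swap₁₂_leg₁₂]
      exact congrArg _ (H.cocomm a))
    (fun a => by rw [AlgHom.comp_apply, comulLeftHom, superLift_inr, swap₁₂_leg₃])) x

theorem swap₂₃_comulRightHom (x : SuperTensor K A A) :
    swap₂₃ K A (H.comulRightHom x) = H.comulRightHom x :=
  DFunLike.congr_fun (superTensor_algHom_ext (f := (swap₂₃ K A).comp H.comulRightHom)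
    (fun a => by rw [AlgHom.comp_apply, comulRightHom, superLift_inl, swap₂₃_leg₁])
    (fun a => by
      rw [AlgHom.comp_apply, comulRightHom, superLift_inr, AlgHom.comp_apply, swap₂₃_leg₂₃]
      exact congrArg _ (H.cocomm a))) x

/-- The flip of `A ⊗ A`, seen through `Δ₀ ⊗ id`, is a cyclic permutation of `A ⊗ A ⊗ A`. -/
theorem comulLeftHom_flip (x : SuperTensor K A A) :
    H.comulLeftHom (flipHom K A x) = swap₂₃ K A (swap₁₂ K A (H.comulRightHom x)) :=
  DFunLike.congr_fun (superTensor_algHom_ext (f := H.comulLeftHom.comp (flipHom K A))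
    (g := (swap₂₃ K A).comp ((swap₁₂ K A).comp H.comulRightHom))
    (fun a => by
      simp only [AlgHom.comp_apply]
      rw [flipHom_inl, comulLeftHom, superLift_inr, comulRightHom, superLift_inl, swap₁₂_leg₁,
        swap₂₃_leg₂])
    (fun a => by
      simp only [AlgHom.comp_apply]
      rw [flipHom_inr, comulLeftHom, superLift_inl, comulRightHom, superLift_inr,
        AlgHom.comp_apply, AlgHom.comp_apply, swap₁₂_leg₂₃, swap₂₃_leg₁₃])) x

theorem comulRightHom_flip (x : SuperTensor K A A) :
    H.comulRightHom (flipHom K A x) = swap₁₂ K A (swap₂₃ K A (H.comulLeftHom x)) :=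
  DFunLike.congr_fun (superTensor_algHom_ext (f := H.comulRightHom.comp (flipHom K A))
    (g := (swap₁₂ K A).comp ((swap₂₃ K A).comp H.comulLeftHom))
    (fun a => by
      simp only [AlgHom.comp_apply]
      rw [flipHom_inl, comulRightHom, superLift_inr, comulLeftHom, superLift_inl,
        AlgHom.comp_apply, AlgHom.comp_apply, swap₂₃_leg₁₂, swap₁₂_leg₁₃])
    (fun a => by
      simp only [AlgHom.comp_apply]
      rw [flipHom_inr, comulRightHom, superLift_inl, comulLeftHom, superLift_inr, swap₂₃_leg₃,
        swap₁₂_leg₂])) x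

variable {F : FPS (SuperTensor K A A)}
  (hF : IsTwist Δ₀.toLinearMap ε₀.toLinearMap F)

omit H in
theorem twistedComul_apply (x : FPS A) :
    twistedComul Δ₀.toLinearMap F x = F * mapHom Δ₀ x * Ring.inverse F :=
  conjBy_apply F _

omit H in
theorem isParLinear_twistedComul : IsParLinear (twistedComul Δ₀.toLinearMap F) :=
  (isParLinear_conjBy F).comp (IsParLinear.mapSeries _)

include hF

omit H in
theorem mapHom_parity_inverse : mapHom (parity K) (Ring.inverse F) = Ring.inverse F := by
  have h : mapHom (parity K) F = F := hF.parity_eq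
  rw [mapHom_inverse _ hF.isUnit, h]

/-- `Δ ⊗ id` is `Δ₀ ⊗ id` followed by conjugation with `F₁₂`; the third leg commutes with `F₁₂`, as
`F` is even. -/
theorem comulLeft_twistedComul (z : FPS (SuperTensor K A A)) :
    comulLeft (twistedComul Δ₀.toLinearMap F) z =
      mapHom (leg₁₂ K A) F * mapHom H.comulLeftHom z * mapHom (leg₁₂ K A) (Ring.inverse F) := by
  refine (isParLinear_mulTensor _ _).ext_tensor
    (Ψ := LinearMap.mulRight K (mapHom (leg₁₂ K A) (Ring.inverse F)) ∘ₗ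
      LinearMap.mulLeft K (mapHom (leg₁₂ K A) F) ∘ₗ mapSeries K H.comulLeftHom.toLinearMap)
    ((IsParLinear.mulRight _).comp ((IsParLinear.mulLeft _).comp (IsParLinear.mapSeries _)))
    (fun i j a b _ _ => ?_) z
  rw [mulTensor_const]
  simp only [LinearMap.comp_apply, LinearMap.mulLeft_apply, LinearMap.mulRight_apply]
  rw [twistedComul_apply, mapSeries_constSeries, mapSeries_constSeries]
  have hc := (superCommute_leg₁₂_leg₃ K A).commute_mapHom (mapHom_parity_inverse hF) b
  change mapHom (leg₁₂ K A) (F * mapHom Δ₀ (constSeries K a) * Ring.inverse F) *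
    constSeries K (leg₃ K A b) = _
  have h1 : mapHom (leg₁₂ K A) (mapHom Δ₀ (constSeries K a)) =
      constSeries K (((leg₁₂ K A).comp Δ₀) a) := by
    rw [mapHom_constSeries, mapHom_constSeries]
    rfl
  have h2 : H.comulLeftHom.toLinearMap (tensorInl K A A a * tensorInr K A A b) =
      ((leg₁₂ K A).comp Δ₀) a * leg₃ K A b := tensorLift_inl_mul_inr _ _ a b
  rw [map_mul, map_mul, h1, h2, constSeries_mul, mul_assoc, hc.eq, ← mul_assoc,
    mul_assoc _ _ (constSeries K _)]

theorem comulRight_twistedComul (z : FPS (SuperTensor K A A)) :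
    comulRight (twistedComul Δ₀.toLinearMap F) z =
      mapHom (leg₂₃ K A) F * mapHom H.comulRightHom z * mapHom (leg₂₃ K A) (Ring.inverse F) := by
  refine (isParLinear_mulTensor _ _).ext_tensor
    (Ψ := LinearMap.mulRight K (mapHom (leg₂₃ K A) (Ring.inverse F)) ∘ₗ
      LinearMap.mulLeft K (mapHom (leg₂₃ K A) F) ∘ₗ mapSeries K H.comulRightHom.toLinearMap)
    ((IsParLinear.mulRight _).comp ((IsParLinear.mulLeft _).comp (IsParLinear.mapSeries _)))
    (fun i j a b _ _ => ?_) z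
  rw [mulTensor_const]
  simp only [LinearMap.comp_apply, LinearMap.mulLeft_apply, LinearMap.mulRight_apply]
  rw [twistedComul_apply, mapSeries_constSeries, mapSeries_constSeries]
  have hc := (superCommute_leg₁_leg₂₃ K A).symm.commute_mapHom hF.parity_eq a
  change constSeries K (leg₁ K A a) *
    mapHom (leg₂₃ K A) (F * mapHom Δ₀ (constSeries K b) * Ring.inverse F) = _
  have h1 : mapHom (leg₂₃ K A) (mapHom Δ₀ (constSeries K b)) =
      constSeries K (((leg₂₃ K A).comp Δ₀) b) := by
    rw [mapHom_constSeries, mapHom_constSeries]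
    rfl
  have h2 : H.comulRightHom.toLinearMap (tensorInl K A A a * tensorInr K A A b) =
      leg₁ K A a * ((leg₂₃ K A).comp Δ₀) b := tensorLift_inl_mul_inr _ _ a b
  rw [map_mul, map_mul, h1, h2, constSeries_mul, ← mul_assoc, ← mul_assoc, ← hc.eq, ← mul_assoc]

end IsCocommutativeHopf
end Twisting

end
end TwistedSl12

namespace TwistedSl12

open scoped TensorProduct

noncomputable section

/-! ### The twisted coproduct and R-matrix -/

section Twisting
variable {K : Type*} [Field K] [CharZero K]
variable {A : Type*} [Ring A] [Algebra K A] [Superalgebra K A]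

namespace IsCocommutativeHopf
variable {Δ₀ : A →ₐ[K] SuperTensor K A A} {ε₀ : A →ₐ[K] K} {S₀ : A →ₗ[K] A}
variable (H : IsCocommutativeHopf Δ₀ ε₀ S₀) {F : FPS (SuperTensor K A A)}
  (hF : IsTwist Δ₀.toLinearMap ε₀.toLinearMap F)

theorem mapHom_congr {B C : Type*} [Ring B] [Algebra K B] [Ring C] [Algebra K C]
    {f g : B →ₐ[K] C} (h : ∀ b, f b = g b) (x : FPS B) : mapHom f x = mapHom g x := by
  rw [AlgHom.ext h]

/-- `Φ = F₁₂ (Δ₀ ⊗ id)(F)`, the twist of the threefold coproduct. -/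
def twistLeft (H : IsCocommutativeHopf Δ₀ ε₀ S₀) (F : FPS (SuperTensor K A A)) :
    FPS (Tensor₃ K A) :=
  mapHom (leg₁₂ K A) F * mapHom H.comulLeftHom F

include hF

/-- The cocycle identity: also `Φ = F₂₃ (id ⊗ Δ₀)(F)`. -/
theorem twistLeft_eq : H.twistLeft F = mapHom (leg₂₃ K A) F * mapHom H.comulRightHom F := by
  have h := hF.cocycle
  rwa [H.comulLeft_mapSeries, H.comulRight_mapSeries] at h

theorem mapHom_mul_inverse {B : Type*} [Ring B] [Algebra K B] (f : SuperTensor K A A →ₐ[K] B) :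
    mapHom f F * mapHom f (Ring.inverse F) = 1 := by
  rw [← map_mul, Ring.mul_inverse_cancel _ hF.isUnit, map_one]

theorem mapHom_inverse_mul {B : Type*} [Ring B] [Algebra K B] (f : SuperTensor K A A →ₐ[K] B) :
    mapHom f (Ring.inverse F) * mapHom f F = 1 := by
  rw [← map_mul, Ring.inverse_mul_cancel _ hF.isUnit, map_one]

theorem twistLeft_mul_inverse :
    H.twistLeft F *
      (mapHom H.comulLeftHom (Ring.inverse F) * mapHom (leg₁₂ K A) (Ring.inverse F)) = 1 := by
  rw [twistLeft, mul_assoc, ← mul_assoc (mapHom H.comulLeftHom F), mapHom_mul_inverse hF, one_mul,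
    mapHom_mul_inverse hF]

theorem inverse_mul_twistLeft :
    mapHom H.comulRightHom (Ring.inverse F) * mapHom (leg₂₃ K A) (Ring.inverse F) *
      H.twistLeft F = 1 := by
  rw [H.twistLeft_eq hF, mul_assoc, ← mul_assoc _ (mapHom (leg₂₃ K A) F), mapHom_inverse_mul hF,
    one_mul, mapHom_inverse_mul hF]

theorem inverse_twistLeft_eq :
    mapHom H.comulRightHom (Ring.inverse F) * mapHom (leg₂₃ K A) (Ring.inverse F) =
      mapHom H.comulLeftHom (Ring.inverse F) * mapHom (leg₁₂ K A) (Ring.inverse F) :=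
  left_inv_eq_right_inv (H.inverse_mul_twistLeft hF) (H.twistLeft_mul_inverse hF)

theorem comulLeft_twistedComul_mul (z : FPS (SuperTensor K A A)) :
    comulLeft (twistedComul Δ₀.toLinearMap F) (z * Ring.inverse F) =
      mapHom (leg₁₂ K A) F * mapHom H.comulLeftHom z *
      (mapHom H.comulLeftHom (Ring.inverse F) * mapHom (leg₁₂ K A) (Ring.inverse F)) := by
  rw [H.comulLeft_twistedComul hF, map_mul]
  simp only [mul_assoc]

theorem comulRight_twistedComul_mul (z : FPS (SuperTensor K A A)) :
    comulRight (twistedComul Δ₀.toLinearMap F) (z * Ring.inverse F) =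
      mapHom (leg₂₃ K A) F * mapHom H.comulRightHom z *
      (mapHom H.comulLeftHom (Ring.inverse F) * mapHom (leg₁₂ K A) (Ring.inverse F)) := by
  rw [H.comulRight_twistedComul hF, map_mul, ← H.inverse_twistLeft_eq hF]
  simp only [mul_assoc]

include H in
/-- Both sides are `Φ Δ₀⁽²⁾(x) Φ⁻¹`. -/
theorem twistedComul_coassoc (x : FPS A) :
    comulLeft (twistedComul Δ₀.toLinearMap F) (twistedComul Δ₀.toLinearMap F x) =
      comulRight (twistedComul Δ₀.toLinearMap F) (twistedComul Δ₀.toLinearMap F x) := by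
  have h : mapHom H.comulLeftHom (mapHom Δ₀ x) = mapHom H.comulRightHom (mapHom Δ₀ x) :=
    mapHom_congr (f := H.comulLeftHom.comp Δ₀) (g := H.comulRightHom.comp Δ₀)
      H.comulLeftHom_comul x
  rw [twistedComul_apply, H.comulLeft_twistedComul_mul hF, H.comulRight_twistedComul_mul hF,
    map_mul, map_mul, h, ← mul_assoc (mapHom (leg₁₂ K A) F), ← mul_assoc (mapHom (leg₂₃ K A) F),
    ← H.twistLeft_eq hF]
  rfl

omit hF in
theorem twistedR_eq : twistedR F = mapHom (flipHom K A) F * Ring.inverse F := rfl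

/-- `Φ₂₁₃ = R₁₂ Φ`, from `F₂₁ = R F` and the cocommutativity of `Δ₀`. -/
theorem swap₁₂_twistLeft :
    mapHom (swap₁₂ K A) (H.twistLeft F) = mapHom (leg₁₂ K A) (twistedR F) * H.twistLeft F := by
  rw [twistLeft, map_mul, mapHom_mapHom, mapHom_mapHom, twistedR_eq, map_mul, mul_assoc,
    ← mul_assoc _ (mapHom (leg₁₂ K A) F), mapHom_inverse_mul hF, one_mul, mapHom_mapHom]
  exact congrArg₂ _ (mapHom_congr (swap₁₂_leg₁₂ K A) F) (mapHom_congr H.swap₁₂_comulLeftHom F)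

/-- `Φ₁₃₂ = R₂₃ Φ`, by the second expression of `Φ`. -/
theorem swap₂₃_twistLeft :
    mapHom (swap₂₃ K A) (H.twistLeft F) = mapHom (leg₂₃ K A) (twistedR F) * H.twistLeft F := by
  rw [H.twistLeft_eq hF, map_mul, mapHom_mapHom, mapHom_mapHom, twistedR_eq, map_mul, mul_assoc,
    ← mul_assoc _ (mapHom (leg₂₃ K A) F), mapHom_inverse_mul hF, one_mul, mapHom_mapHom]
  exact congrArg₂ _ (mapHom_congr (swap₂₃_leg₂₃ K A) F) (mapHom_congr H.swap₂₃_comulRightHom F)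

include H in
/-- `(Δ ⊗ id)(R) = R₁₃ R₂₃`: the left side is the cyclic permutation of `Φ` divided by `Φ`, and a
cyclic permutation is a product of two flips. -/
theorem comulLeft_twistedR :
    comulLeft (twistedComul Δ₀.toLinearMap F) (twistedR F) =
      mapHom (leg₁₃ K A) (twistedR F) * mapHom (leg₂₃ K A) (twistedR F) := by
  rw [twistedR_eq, H.comulLeft_twistedComul_mul hF, ← twistedR_eq]
  have h : mapHom (leg₁₂ K A) F * mapHom H.comulLeftHom (mapHom (flipHom K A) F) =
      mapHom (swap₂₃ K A) (mapHom (swap₁₂ K A) (H.twistLeft F)) := by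
    rw [H.twistLeft_eq hF, map_mul, map_mul]
    simp only [mapHom_mapHom]
    refine congrArg₂ _ (mapHom_congr (fun z => ?_) F) (mapHom_congr H.comulLeftHom_flip F)
    rw [AlgHom.comp_apply, AlgHom.comp_apply, swap₁₂_leg₂₃, swap₂₃_leg₁₃]
  rw [h, H.swap₁₂_twistLeft hF, map_mul, H.swap₂₃_twistLeft hF, mul_assoc, mul_assoc,
    H.twistLeft_mul_inverse hF, mul_one, mapHom_mapHom]
  exact congrArg (· * _) (mapHom_congr (swap₂₃_leg₁₂ K A) _)

include H in
theorem comulRight_twistedR :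
    comulRight (twistedComul Δ₀.toLinearMap F) (twistedR F) =
      mapHom (leg₁₃ K A) (twistedR F) * mapHom (leg₁₂ K A) (twistedR F) := by
  rw [twistedR_eq, H.comulRight_twistedComul_mul hF, ← twistedR_eq]
  have h : mapHom (leg₂₃ K A) F * mapHom H.comulRightHom (mapHom (flipHom K A) F) =
      mapHom (swap₁₂ K A) (mapHom (swap₂₃ K A) (H.twistLeft F)) := by
    rw [twistLeft, map_mul, map_mul]
    simp only [mapHom_mapHom]
    refine congrArg₂ _ (mapHom_congr (fun z => ?_) F) (mapHom_congr H.comulRightHom_flip F)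
    rw [AlgHom.comp_apply, AlgHom.comp_apply, swap₂₃_leg₁₂, swap₁₂_leg₁₃]
  rw [h, H.swap₂₃_twistLeft hF, map_mul, H.swap₁₂_twistLeft hF, mul_assoc, mul_assoc,
    H.twistLeft_mul_inverse hF, mul_one, mapHom_mapHom]
  exact congrArg (· * _) (mapHom_congr (swap₁₂_leg₂₃ K A) _)

omit hF in
theorem mapHom_flip_flip (x : FPS (SuperTensor K A A)) :
    mapHom (flipHom K A) (mapHom (flipHom K A) x) = x := by
  rw [mapHom_mapHom, mapHom_congr (g := AlgHom.id K _) fun z => superFlip_superFlip z]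
  rfl

theorem flip_twistedR_mul : mapHom (flipHom K A) (twistedR F) * twistedR F = 1 := by
  rw [twistedR_eq, map_mul, mapHom_flip_flip, mul_assoc, ← mul_assoc _ (mapHom _ F),
    mapHom_inverse_mul hF, one_mul, Ring.mul_inverse_cancel _ hF.isUnit]

theorem twistedR_mul_flip : twistedR F * mapHom (flipHom K A) (twistedR F) = 1 := by
  have := congrArg (mapHom (flipHom K A)) (flip_twistedR_mul hF)
  rwa [map_mul, mapHom_flip_flip, map_one] at this

theorem parity_twistedR : mapHom (parity K) (twistedR F) = twistedR F := by
  have h : mapHom (parity K) (mapHom (flipHom K A) F) =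
      mapHom (flipHom K A) (mapHom (parity K) F) :=
    mapHom_congr (f := (parity K).comp (flipHom K A)) (g := (flipHom K A).comp (parity K))
      (fun z => (superFlip_parity z).symm) F
  have h' : mapHom (parity K) F = F := hF.parity_eq
  rw [twistedR_eq, map_mul, mapHom_parity_inverse hF, h, h']

include H in
theorem twistedR_mul_twistedComul (x : FPS A) :
    twistedR F * twistedComul Δ₀.toLinearMap F x =
      mapHom (flipHom K A) (twistedComul Δ₀.toLinearMap F x) * twistedR F := by
  have h : mapHom (flipHom K A) (mapHom Δ₀ x) = mapHom Δ₀ x :=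
    mapHom_congr (f := (flipHom K A).comp Δ₀) H.cocomm x
  rw [twistedComul_apply, twistedR_eq, map_mul, map_mul, h, mul_assoc, ← mul_assoc (Ring.inverse F),
    ← mul_assoc (Ring.inverse F), Ring.inverse_mul_cancel _ hF.isUnit, one_mul, mul_assoc,
    mul_assoc, ← mul_assoc _ (mapHom _ F), mapHom_inverse_mul hF, one_mul]

include H in
theorem counitLeft_twistedComul (x : FPS A) :
    counitLeft (mapSeries K ε₀.toLinearMap) (twistedComul Δ₀.toLinearMap F x) = x := by
  have h1 : mapHom H.counitLeftHom F = 1 := by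
    rw [← H.counitLeft_mapSeries]; exact hF.counit_left
  have h2 := mapHom_mul_inverse hF H.counitLeftHom
  rw [h1, one_mul] at h2
  rw [H.counitLeft_mapSeries, twistedComul_apply, map_mul, map_mul, h1, h2, one_mul, mul_one,
    mapHom_mapHom, mapHom_congr (g := AlgHom.id K A) H.counit_left]
  rfl

include H in
theorem counitRight_twistedComul (x : FPS A) :
    counitRight (mapSeries K ε₀.toLinearMap) (twistedComul Δ₀.toLinearMap F x) = x := by
  have h1 : mapHom H.counitRightHom F = 1 := by
    rw [← H.counitRight_mapSeries]; exact hF.counit_right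
  have h2 := mapHom_mul_inverse hF H.counitRightHom
  rw [h1, one_mul] at h2
  rw [H.counitRight_mapSeries, twistedComul_apply, map_mul, map_mul, h1, h2, one_mul, mul_one,
    mapHom_mapHom, mapHom_congr (g := AlgHom.id K A) H.counit_right]
  rfl

end IsCocommutativeHopf
end Twisting

end
end TwistedSl12

namespace TwistedSl12

open scoped TensorProduct

noncomputable section

/-! ### The twisted antipode -/

section Convolution
variable {K : Type*} [Field K] [CharZero K]
variable {A : Type*} [Ring A] [Algebra K A] [Superalgebra K A]
variable {Q : Type*} [Ring Q] [Algebra K Q]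
variable (p q r : FPS A →ₗ[K] FPS Q)

theorem mulTensor_leg₁₂_mul (z : FPS (SuperTensor K A A)) (b : A) :
    mulTensor K (mulTensor K p q) r (mapHom (leg₁₂ K A) z * constSeries K (leg₃ K A b)) =
      mulTensor K p q z * r (constSeries K b) := by
  refine IsParLinear.ext
    (Φ := mulTensor K (mulTensor K p q) r ∘ₗ LinearMap.mulRight K (constSeries K (leg₃ K A b)) ∘ₗ
      mapSeries K (leg₁₂ K A).toLinearMap)
    (Ψ := LinearMap.mulRight K (r (constSeries K b)) ∘ₗ mulTensor K p q)
    ((isParLinear_mulTensor _ _).comp ((IsParLinear.mulRight _).comp (IsParLinear.mapSeries _)))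
    ((IsParLinear.mulRight _).comp (isParLinear_mulTensor _ _)) (fun w => ?_) z
  simp only [LinearMap.comp_apply, LinearMap.mulRight_apply, mapSeries_constSeries,
    ← constSeries_mul]
  exact mulTensor_const (mulTensor K p q) r w b

theorem mulTensor_leg₁_mul (z : FPS (SuperTensor K A A)) (a : A) :
    mulTensor K (mulTensor K p q) r (constSeries K (leg₁ K A a) * mapHom (leg₂₃ K A) z) =
      p (constSeries K a) * mulTensor K q r z := by
  refine IsParLinear.ext_tensor
    (Φ := mulTensor K (mulTensor K p q) r ∘ₗ LinearMap.mulLeft K (constSeries K (leg₁ K A a)) ∘ₗ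
      mapSeries K (leg₂₃ K A).toLinearMap)
    (Ψ := LinearMap.mulLeft K (p (constSeries K a)) ∘ₗ mulTensor K q r)
    ((isParLinear_mulTensor _ _).comp ((IsParLinear.mulLeft _).comp (IsParLinear.mapSeries _)))
    ((IsParLinear.mulLeft _).comp (isParLinear_mulTensor _ _)) (fun i j c d _ _ => ?_) z
  simp only [LinearMap.comp_apply, LinearMap.mulLeft_apply, mapSeries_constSeries,
    mulTensor_const, AlgHom.toLinearMap_apply]
  rw [map_mul (leg₂₃ K A), leg₂₃_inl, leg₂₃_inr, ← constSeries_mul, ← mul_assoc,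
    ← mul_assoc (p _), ← mulTensor_const p q a c, ← mulTensor_const (mulTensor K p q) r,
    map_mul (tensorInl K (SuperTensor K A A) A)]
  rfl

variable {Δ : FPS A →ₗ[K] FPS (SuperTensor K A A)}

theorem mulTensor_comulLeft (z : FPS (SuperTensor K A A)) :
    mulTensor K (mulTensor K p q) r (comulLeft Δ z) = mulTensor K (mulTensor K p q ∘ₗ Δ) r z := by
  refine IsParLinear.ext_tensor (Φ := mulTensor K (mulTensor K p q) r ∘ₗ comulLeft Δ)
    ((isParLinear_mulTensor _ _).comp (isParLinear_mulTensor _ _)) (isParLinear_mulTensor _ _)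
    (fun i j a b _ _ => ?_) z
  rw [LinearMap.comp_apply, comulLeft, mulTensor_const, mulTensor_const, mapSeries_constSeries]
  exact mulTensor_leg₁₂_mul p q r _ b

theorem mulTensor_comulRight (z : FPS (SuperTensor K A A)) :
    mulTensor K (mulTensor K p q) r (comulRight Δ z) = mulTensor K p (mulTensor K q r ∘ₗ Δ) z := by
  refine IsParLinear.ext_tensor (Φ := mulTensor K (mulTensor K p q) r ∘ₗ comulRight Δ)
    ((isParLinear_mulTensor _ _).comp (isParLinear_mulTensor _ _)) (isParLinear_mulTensor _ _)
    (fun i j a b _ _ => ?_) z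
  rw [LinearMap.comp_apply, comulRight, mulTensor_const, mulTensor_const, mapSeries_constSeries]
  exact mulTensor_leg₁_mul p q r _ a

theorem commute_scalar (c : FPS K) (x : FPS Q) : Commute (scalar K c) x := by
  have := IsParLinear.map_scalar_mul (IsParLinear.mulLeft (K := K) x) c 1
  rw [mul_one, LinearMap.mulLeft_apply, LinearMap.mulLeft_apply, mul_one] at this
  exact this.symm

/-- A left and a right convolution inverse of the identity agree: both equal `S' * id * S`. -/
theorem antipode_unique {ε : FPS A →ₗ[K] FPS K} {S S' : FPS A →ₗ[K] FPS A}
    (hS : IsParLinear S) (hS' : IsParLinear S')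
    (coassoc : ∀ x, comulLeft Δ (Δ x) = comulRight Δ (Δ x))
    (counit_left : ∀ x, counitLeft ε (Δ x) = x) (counit_right : ∀ x, counitRight ε (Δ x) = x)
    (right : ∀ x, mulTensor K LinearMap.id S (Δ x) = scalar K (ε x))
    (left : ∀ x, mulTensor K S' LinearMap.id (Δ x) = scalar K (ε x)) (x : FPS A) :
    S' x = S x := by
  have h1 := mulTensor_comulLeft (Δ := Δ) S' LinearMap.id S (Δ x)
  have h2 := mulTensor_comulRight (Δ := Δ) S' LinearMap.id S (Δ x)
  rw [coassoc] at h1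
  have h3 := h2.symm.trans h1
  have hl : mulTensor K S' LinearMap.id ∘ₗ Δ = mapSeries K (Algebra.linearMap K A) ∘ₗ ε :=
    LinearMap.ext left
  have hr : mulTensor K LinearMap.id S ∘ₗ Δ = mapSeries K (Algebra.linearMap K A) ∘ₗ ε :=
    LinearMap.ext right
  rw [hl, hr] at h3
  have h4 : ∀ z, mulTensor K S' (mapSeries K (Algebra.linearMap K A) ∘ₗ ε) z =
      S' (counitRight ε z) := fun z => by
    refine IsParLinear.ext_tensor (Ψ := S' ∘ₗ counitRight ε) (isParLinear_mulTensor _ _)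
      (hS'.comp (isParLinear_mulTensor _ _)) (fun i j a b _ _ => ?_) z
    rw [LinearMap.comp_apply, counitRight, mulTensor_const, mulTensor_const]
    have h5 : ∀ y : FPS A, (mapSeries K (Algebra.linearMap K A) ∘ₗ ε) (constSeries K b) * y =
      y * (mapSeries K (Algebra.linearMap K A) ∘ₗ ε) (constSeries K b) := fun y =>
        commute_scalar _ y
    rw [← h5, ← h5]
    exact (hS'.map_scalar_mul _ _).symm
  have h6 : ∀ z, mulTensor K (mapSeries K (Algebra.linearMap K A) ∘ₗ ε) S z =
      S (counitLeft ε z) := fun z => by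
    refine IsParLinear.ext_tensor (Ψ := S ∘ₗ counitLeft ε) (isParLinear_mulTensor _ _)
      (hS.comp (isParLinear_mulTensor _ _)) (fun i j a b _ _ => ?_) z
    rw [LinearMap.comp_apply, counitLeft, mulTensor_const, mulTensor_const]
    exact (hS.map_scalar_mul _ _).symm
  rwa [h4, h6, counit_left, counit_right] at h3

end Convolution

section Twisting
variable {K : Type*} [Field K] [CharZero K]
variable {A : Type*} [Ring A] [Algebra K A] [Superalgebra K A]

namespace IsCocommutativeHopf
variable {Δ₀ : A →ₐ[K] SuperTensor K A A} {ε₀ : A →ₐ[K] K} {S₀ : A →ₗ[K] A}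

/-- `m ∘ (id ⊗ S₀)`. -/
abbrev mulRightAntipode (S₀ : A →ₗ[K] A) : FPS (SuperTensor K A A) →ₗ[K] FPS A :=
  mapSeries K (tensorLift LinearMap.id S₀)

/-- `m ∘ (S₀ ⊗ id)`. -/
abbrev mulLeftAntipode (S₀ : A →ₗ[K] A) : FPS (SuperTensor K A A) →ₗ[K] FPS A :=
  mapSeries K (tensorLift S₀ LinearMap.id)

variable (H : IsCocommutativeHopf Δ₀ ε₀ S₀)
include H

omit H in
theorem tmul_mul_tmul {i j : ZMod 2} {a b c d : A} (hb : b ∈ homogeneous K A j)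
    (hc : c ∈ homogeneous K A i) :
    tensorInl K A A a * tensorInr K A A b * (tensorInl K A A c * tensorInr K A A d) =
      ((-1 : ℤˣ) ^ (j * i)) • (tensorInl K A A (a * c) * tensorInr K A A (b * d)) := by
  rw [map_mul, map_mul, mul_assoc, ← mul_assoc (tensorInr K A A b), inr_mul_inl K hc hb]
  simp only [Units.smul_def, smul_mul_assoc, mul_smul_comm, mul_assoc]

/-- Moving `b` past `w` and reversing the product under `S₀` produce the sign `(-1)^(|b| |w|)`. It
drops out under the hypothesis on `w`, which holds for `w = F` and for `w = Δ₀(x)`. -/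
theorem mulRightAntipode_tmul_mul {j : ZMod 2} {a b : A} (hb : b ∈ homogeneous K A j)
    {w : FPS (SuperTensor K A A)}
    (hw : mulRightAntipode S₀ (mapHom (parity K) w) = mulRightAntipode S₀ w) :
    mulRightAntipode S₀ (constSeries K (tensorInl K A A a * tensorInr K A A b) * w) =
      constSeries K a * mulRightAntipode S₀ w * constSeries K (S₀ b) := by
  have key : ∀ φ : SuperTensor K A A →ₗ[K] SuperTensor K A A,
      (∀ ⦃k l c d⦄, c ∈ homogeneous K A k → d ∈ homogeneous K A l →
        φ (tensorInl K A A c * tensorInr K A A d) =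
          ((-1 : ℤˣ) ^ (j * (k + l))) • (tensorInl K A A c * tensorInr K A A d)) →
      mulRightAntipode S₀ (constSeries K (tensorInl K A A a * tensorInr K A A b) * w) =
        constSeries K a * mulRightAntipode S₀ (mapSeries K φ w) * constSeries K (S₀ b) := by
    intro φ hφ
    refine IsParLinear.ext_tensor (Φ := mulRightAntipode S₀ ∘ₗ LinearMap.mulLeft K _)
      (Ψ := LinearMap.mulRight K _ ∘ₗ LinearMap.mulLeft K _ ∘ₗ mulRightAntipode S₀ ∘ₗ mapSeries K φ)
      ((IsParLinear.mapSeries _).comp (IsParLinear.mulLeft _))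
      ((IsParLinear.mulRight _).comp ((IsParLinear.mulLeft _).comp
        ((IsParLinear.mapSeries _).comp (IsParLinear.mapSeries _)))) (fun k l c d hc hd => ?_) w
    simp only [LinearMap.comp_apply, LinearMap.mulLeft_apply, LinearMap.mulRight_apply]
    rw [← constSeries_mul, mapSeries_constSeries, mapSeries_constSeries, mapSeries_constSeries,
      ← constSeries_mul, ← constSeries_mul]
    congr 1
    rw [tmul_mul_tmul hb hc, hφ hc hd, Units.smul_def, Units.smul_def, map_zsmul, map_zsmul,
      tensorLift_inl_mul_inr, tensorLift_inl_mul_inr,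
      LinearMap.id_apply, LinearMap.id_apply, H.antipode_mul hb hd, ← Units.smul_def,
      ← Units.smul_def, mul_smul_comm, mul_smul_comm, smul_mul_assoc, smul_smul, ← uzpow_add,
      mul_add, mul_comm l j]
    simp only [mul_assoc]
  induction j using zmod_two_cases
  · exact key LinearMap.id fun k l c d _ _ => by simp
  · rw [key (parity K).toLinearMap fun k l c d hc hd => ?_]
    · exact congrArg (fun z => _ * z * _) hw
    · rw [one_mul]
      exact (mem_homogeneous K).1 (SetLike.GradedMul.mul_mem (inl_mem K hc) (inr_mem K hd))

/-- The mirror image of `mulRightAntipode_tmul_mul`. -/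
theorem mulLeftAntipode_mul_tmul {i : ZMod 2} {a b : A} (ha : a ∈ homogeneous K A i)
    {w : FPS (SuperTensor K A A)}
    (hw : mulLeftAntipode S₀ (mapHom (parity K) w) = mulLeftAntipode S₀ w) :
    mulLeftAntipode S₀ (w * constSeries K (tensorInl K A A a * tensorInr K A A b)) =
      constSeries K (S₀ a) * mulLeftAntipode S₀ w * constSeries K b := by
  have key : ∀ φ : SuperTensor K A A →ₗ[K] SuperTensor K A A,
      (∀ ⦃k l c d⦄, c ∈ homogeneous K A k → d ∈ homogeneous K A l →
        φ (tensorInl K A A c * tensorInr K A A d) =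
          ((-1 : ℤˣ) ^ (i * (k + l))) • (tensorInl K A A c * tensorInr K A A d)) →
      mulLeftAntipode S₀ (w * constSeries K (tensorInl K A A a * tensorInr K A A b)) =
        constSeries K (S₀ a) * mulLeftAntipode S₀ (mapSeries K φ w) * constSeries K b := by
    intro φ hφ
    refine IsParLinear.ext_tensor (Φ := mulLeftAntipode S₀ ∘ₗ LinearMap.mulRight K _)
      (Ψ := LinearMap.mulRight K _ ∘ₗ LinearMap.mulLeft K _ ∘ₗ mulLeftAntipode S₀ ∘ₗ mapSeries K φ)
      ((IsParLinear.mapSeries _).comp (IsParLinear.mulRight _))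
      ((IsParLinear.mulRight _).comp ((IsParLinear.mulLeft _).comp
        ((IsParLinear.mapSeries _).comp (IsParLinear.mapSeries _)))) (fun k l c d hc hd => ?_) w
    simp only [LinearMap.comp_apply, LinearMap.mulLeft_apply, LinearMap.mulRight_apply]
    rw [← constSeries_mul, mapSeries_constSeries, mapSeries_constSeries, mapSeries_constSeries,
      ← constSeries_mul, ← constSeries_mul]
    congr 1
    rw [tmul_mul_tmul hd ha, hφ hc hd, Units.smul_def, Units.smul_def, map_zsmul, map_zsmul,
      tensorLift_inl_mul_inr, tensorLift_inl_mul_inr,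
      LinearMap.id_apply, LinearMap.id_apply, H.antipode_mul hc ha, ← Units.smul_def,
      ← Units.smul_def, smul_mul_assoc, mul_smul_comm, smul_mul_assoc, smul_smul, ← uzpow_add,
      mul_add, mul_comm l i, add_comm (i * l)]
    simp only [mul_assoc]
  induction i using zmod_two_cases
  · exact key LinearMap.id fun k l c d _ _ => by simp
  · rw [key (parity K).toLinearMap fun k l c d hc hd => ?_]
    · exact congrArg (fun z => _ * z * _) hw
    · rw [one_mul]
      exact (mem_homogeneous K).1 (SetLike.GradedMul.mul_mem (inl_mem K hc) (inr_mem K hd))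

theorem mulRightAntipode_mul (z : FPS (SuperTensor K A A)) {w : FPS (SuperTensor K A A)}
    (hw : mulRightAntipode S₀ (mapHom (parity K) w) = mulRightAntipode S₀ w) :
    mulRightAntipode S₀ (z * w) =
      mulTensor K (LinearMap.mulRight K (mulRightAntipode S₀ w)) (mapSeries K S₀) z := by
  refine IsParLinear.ext_tensor (Φ := mulRightAntipode S₀ ∘ₗ LinearMap.mulRight K w)
    ((IsParLinear.mapSeries _).comp (IsParLinear.mulRight _)) (isParLinear_mulTensor _ _)
    (fun i j a b _ hb => ?_) z
  rw [LinearMap.comp_apply, LinearMap.mulRight_apply, H.mulRightAntipode_tmul_mul hb hw,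
    mulTensor_const, LinearMap.mulRight_apply, mapSeries_constSeries]

theorem mulLeftAntipode_mul (z : FPS (SuperTensor K A A)) {w : FPS (SuperTensor K A A)}
    (hw : mulLeftAntipode S₀ (mapHom (parity K) w) = mulLeftAntipode S₀ w) :
    mulLeftAntipode S₀ (w * z) =
      mulTensor K (LinearMap.mulRight K (mulLeftAntipode S₀ w) ∘ₗ mapSeries K S₀)
        LinearMap.id z := by
  refine IsParLinear.ext_tensor (Φ := mulLeftAntipode S₀ ∘ₗ LinearMap.mulLeft K w)
    ((IsParLinear.mapSeries _).comp (IsParLinear.mulLeft _)) (isParLinear_mulTensor _ _)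
    (fun i j a b ha _ => ?_) z
  rw [LinearMap.comp_apply, LinearMap.mulLeft_apply, H.mulLeftAntipode_mul_tmul ha hw,
    mulTensor_const, LinearMap.comp_apply, LinearMap.mulRight_apply, mapSeries_constSeries,
    LinearMap.id_apply]

theorem mulRightAntipode_comul (x : FPS A) :
    mulRightAntipode S₀ (mapHom Δ₀ x) = scalar K (mapSeries K ε₀.toLinearMap x) := by
  change mapSeries K (tensorLift LinearMap.id S₀ ∘ₗ Δ₀.toLinearMap) x =
    mapSeries K (Algebra.linearMap K A ∘ₗ ε₀.toLinearMap) x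
  congr 2
  exact LinearMap.ext H.antipode_right

theorem mulLeftAntipode_comul (x : FPS A) :
    mulLeftAntipode S₀ (mapHom Δ₀ x) = scalar K (mapSeries K ε₀.toLinearMap x) := by
  change mapSeries K (tensorLift S₀ LinearMap.id ∘ₗ Δ₀.toLinearMap) x =
    mapSeries K (Algebra.linearMap K A ∘ₗ ε₀.toLinearMap) x
  congr 2
  exact LinearMap.ext H.antipode_left

theorem counit_parity_series (x : FPS A) :
    mapSeries K ε₀.toLinearMap (mapHom (parity K) x) = mapSeries K ε₀.toLinearMap x :=
  mapHom_congr (f := ε₀.comp (parity K)) H.counit_parity x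

theorem comul_parity_series (x : FPS A) :
    mapHom Δ₀ (mapHom (parity K) x) = mapHom (parity K) (mapHom Δ₀ x) :=
  mapHom_congr (f := Δ₀.comp (parity K)) (g := (parity K).comp Δ₀) H.comul_parity x

variable {F : FPS (SuperTensor K A A)}
  (hF : IsTwist Δ₀.toLinearMap ε₀.toLinearMap F) (hF1 : MvPowerSeries.constantCoeff F = 1)

omit H in
theorem twistedAntipode_eq (S₀ : A →ₗ[K] A) (F : FPS (SuperTensor K A A)) :
    twistedAntipode S₀ F = conjBy (mulRightAntipode S₀ F) ∘ₗ mapSeries K S₀ := by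
  rw [twistedAntipode, show (LinearMap.id : FPS A →ₗ[K] FPS A) = mapSeries K LinearMap.id from rfl,
    mulTensor_mapSeries]

omit H in
theorem isParLinear_twistedAntipode : IsParLinear (twistedAntipode S₀ F) :=
  (isParLinear_conjBy _).comp (IsParLinear.mapSeries _)

omit H in
theorem tensorLift_one (p q : A →ₗ[K] A) : tensorLift p q 1 = p 1 * q 1 := by
  rw [← tensorLift_inl_mul_inr, map_one (tensorInl K A A), map_one (tensorInr K A A), one_mul]

include hF1 in
theorem isUnit_mulRightAntipode : IsUnit (mulRightAntipode S₀ F) := by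
  rw [MvPowerSeries.isUnit_iff_constantCoeff]
  have h : MvPowerSeries.constantCoeff (mulRightAntipode S₀ F) =
    tensorLift LinearMap.id S₀ (MvPowerSeries.constantCoeff F) := rfl
  rw [h, hF1, tensorLift_one, H.antipode_one]
  simp

include hF in
/-- With `u = m(id ⊗ S₀)(F)`, the map `u S₀ u⁻¹` is a right convolution inverse of the identity. -/
theorem twisted_antipode_right (hu : IsUnit (mulRightAntipode S₀ F)) (x : FPS A) :
    mulTensor K LinearMap.id (twistedAntipode S₀ F) (twistedComul Δ₀.toLinearMap F x) =
      scalar K (mapSeries K ε₀.toLinearMap x) := by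
  have hFp : mapHom (parity K) F = F := hF.parity_eq
  have h1 : ∀ z, mulTensor K LinearMap.id (twistedAntipode S₀ F) z =
      mulTensor K (LinearMap.mulRight K (mulRightAntipode S₀ F)) (mapSeries K S₀) z *
        Ring.inverse (mulRightAntipode S₀ F) := fun z => by
    refine IsParLinear.ext_tensor
      (Ψ := LinearMap.mulRight K _ ∘ₗ mulTensor K (LinearMap.mulRight K _) (mapSeries K S₀))
      (isParLinear_mulTensor _ _) ((IsParLinear.mulRight _).comp (isParLinear_mulTensor _ _))
      (fun i j a b _ _ => ?_) z
    rw [LinearMap.comp_apply, mulTensor_const, mulTensor_const, twistedAntipode_eq,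
      LinearMap.comp_apply, conjBy_apply, LinearMap.mulRight_apply, LinearMap.mulRight_apply,
      LinearMap.id_apply]
    simp only [mul_assoc]
  rw [h1, ← H.mulRightAntipode_mul _ (by rw [hFp]), twistedComul_apply, mul_assoc,
    Ring.inverse_mul_cancel _ hF.isUnit, mul_one, H.mulRightAntipode_mul, H.mulRightAntipode_comul]
  · have h2 : ∀ z, mulTensor K (LinearMap.mulRight K (scalar K (mapSeries K ε₀.toLinearMap x)))
        (mapSeries K S₀) z =
        scalar K (mapSeries K ε₀.toLinearMap x) * mulRightAntipode S₀ z := fun z => by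
      refine IsParLinear.ext_tensor (Ψ := LinearMap.mulLeft K _ ∘ₗ mulRightAntipode S₀)
        (isParLinear_mulTensor _ _) ((IsParLinear.mulLeft _).comp (IsParLinear.mapSeries _))
        (fun i j a b _ _ => ?_) z
      rw [LinearMap.comp_apply, mulTensor_const, LinearMap.mulRight_apply, mapSeries_constSeries,
        LinearMap.mulLeft_apply, mapSeries_constSeries, tensorLift_inl_mul_inr, constSeries_mul,
        ← (commute_scalar (K := K) _ (constSeries K a)).eq, mul_assoc]
      rfl
    rw [h2, mul_assoc, Ring.mul_inverse_cancel _ hu, mul_one]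
  · rw [← H.comul_parity_series, H.mulRightAntipode_comul, H.counit_parity_series,
      H.mulRightAntipode_comul]

include hF in
/-- With `v = m(S₀ ⊗ id)(F⁻¹)`, the map `v⁻¹ S₀ v` is a left convolution inverse of the identity.
That `v = u⁻¹` is not needed: the two inverses agree by `antipode_unique`. -/
theorem twisted_antipode_left (hv : IsUnit (mulLeftAntipode S₀ (Ring.inverse F))) (x : FPS A) :
    mulTensor K (conjBy (Ring.inverse (mulLeftAntipode S₀ (Ring.inverse F))) ∘ₗ mapSeries K S₀)
      LinearMap.id (twistedComul Δ₀.toLinearMap F x) =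
      scalar K (mapSeries K ε₀.toLinearMap x) := by
  have hFp : mapHom (parity K) (Ring.inverse F) = Ring.inverse F := mapHom_parity_inverse hF
  set v := mulLeftAntipode S₀ (Ring.inverse F) with hv'
  have h1 : ∀ z, mulTensor K (conjBy (Ring.inverse v) ∘ₗ mapSeries K S₀) LinearMap.id z =
      Ring.inverse v *
        mulTensor K (LinearMap.mulRight K v ∘ₗ mapSeries K S₀) LinearMap.id z := fun z => by
    refine IsParLinear.ext_tensor
      (Ψ := LinearMap.mulLeft K _ ∘ₗ mulTensor K (LinearMap.mulRight K v ∘ₗ mapSeries K S₀)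
        LinearMap.id)
      (isParLinear_mulTensor _ _) ((IsParLinear.mulLeft _).comp (isParLinear_mulTensor _ _))
      (fun i j a b _ _ => ?_) z
    rw [LinearMap.comp_apply, mulTensor_const, mulTensor_const, LinearMap.comp_apply, conjBy_apply,
      LinearMap.mulLeft_apply, LinearMap.comp_apply, LinearMap.mulRight_apply,
      Ring.inverse_inverse hv]
    simp only [mul_assoc]
  rw [h1, hv', ← H.mulLeftAntipode_mul _ (by rw [hFp]), twistedComul_apply, ← mul_assoc,
    ← mul_assoc, Ring.inverse_mul_cancel _ hF.isUnit, one_mul, H.mulLeftAntipode_mul,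
    H.mulLeftAntipode_comul, ← hv']
  · have h2 : ∀ z, mulTensor K (LinearMap.mulRight K (scalar K (mapSeries K ε₀.toLinearMap x)) ∘ₗ
        mapSeries K S₀) LinearMap.id z =
        scalar K (mapSeries K ε₀.toLinearMap x) * mulLeftAntipode S₀ z := fun z => by
      refine IsParLinear.ext_tensor (Ψ := LinearMap.mulLeft K _ ∘ₗ mulLeftAntipode S₀)
        (isParLinear_mulTensor _ _) ((IsParLinear.mulLeft _).comp (IsParLinear.mapSeries _))
        (fun i j a b _ _ => ?_) z
      rw [LinearMap.comp_apply, mulTensor_const, LinearMap.comp_apply, LinearMap.mulRight_apply,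
        mapSeries_constSeries, LinearMap.mulLeft_apply, mapSeries_constSeries,
        tensorLift_inl_mul_inr, constSeries_mul,
        ← (commute_scalar (K := K) _ (constSeries K (S₀ a))).eq, mul_assoc]
      rfl
    rw [h2, ← mul_assoc, ← (commute_scalar (K := K) _ (Ring.inverse v)).eq, mul_assoc, ← hv',
      Ring.inverse_mul_cancel _ hv, mul_one]
  · rw [← H.comul_parity_series, H.mulLeftAntipode_comul, H.counit_parity_series,
      H.mulLeftAntipode_comul]

include hF hF1 in
theorem isUnit_mulLeftAntipode : IsUnit (mulLeftAntipode S₀ (Ring.inverse F)) := by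
  rw [MvPowerSeries.isUnit_iff_constantCoeff]
  have h : MvPowerSeries.constantCoeff (mulLeftAntipode S₀ (Ring.inverse F)) =
    tensorLift S₀ LinearMap.id (MvPowerSeries.constantCoeff (Ring.inverse F)) := rfl
  have h1 := congrArg MvPowerSeries.constantCoeff (Ring.inverse_mul_cancel _ hF.isUnit)
  rw [map_mul, hF1, mul_one, map_one] at h1
  rw [h, h1, tensorLift_one, H.antipode_one]
  simp

omit H in
theorem isParLinear_counit : IsParLinear (mapSeries K ε₀.toLinearMap) := IsParLinear.mapSeries _

include hF in
theorem twistedAntipode_parity (x : FPS A) :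
    twistedAntipode S₀ F (mapHom (parity K) x) = mapHom (parity K) (twistedAntipode S₀ F x) := by
  have h1 : ∀ x, mapSeries K S₀ (mapHom (parity K) x) = mapHom (parity K) (mapSeries K S₀ x) :=
    fun x => by
      change mapSeries K (S₀ ∘ₗ (parity K).toLinearMap) x =
        mapSeries K ((parity K).toLinearMap ∘ₗ S₀) x
      congr 2
      exact LinearMap.ext H.antipode_parity
  have h2 : ∀ z, mulRightAntipode S₀ (mapHom (parity K) z) =
      mapHom (parity K) (mulRightAntipode S₀ z) := fun z => by
    refine IsParLinear.ext_tensor (Φ := mulRightAntipode S₀ ∘ₗ mapSeries K (parity K).toLinearMap)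
      (Ψ := mapSeries K (parity K).toLinearMap ∘ₗ mulRightAntipode S₀)
      ((IsParLinear.mapSeries _).comp (IsParLinear.mapSeries _))
      ((IsParLinear.mapSeries _).comp (IsParLinear.mapSeries _)) (fun i j a b _ _ => ?_) z
    simp only [LinearMap.comp_apply, mapSeries_constSeries, AlgHom.toLinearMap_apply]
    rw [map_mul (parity K), parity_inl, parity_inr, tensorLift_inl_mul_inr, tensorLift_inl_mul_inr,
      map_mul (parity K), H.antipode_parity]
    rfl
  have hFp : mapHom (parity K) F = F := hF.parity_eq
  by_cases hu : IsUnit (mulRightAntipode S₀ F)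
  · rw [twistedAntipode_eq, LinearMap.comp_apply, LinearMap.comp_apply, conjBy_apply, conjBy_apply,
      map_mul, map_mul, h1, mapHom_inverse _ hu, ← h2, hFp]
  · rw [twistedAntipode_eq, LinearMap.comp_apply, LinearMap.comp_apply, conjBy_apply, conjBy_apply,
      Ring.inverse_non_unit _ hu, mul_zero, mul_zero, map_zero]

include hF hF1 in
/-- Twisting a cocommutative Hopf superalgebra gives a triangular one. -/
theorem isTriangular_twisted :
    IsTriangularHopfSuperalgebra (twistedComul Δ₀.toLinearMap F) (mapSeries K ε₀.toLinearMap)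
      (twistedAntipode S₀ F) (twistedR F) where
  comul_scalar := isParLinear_twistedComul.map_scalar_mul
  comul_one := by
    rw [twistedComul_apply, map_one, mul_one, Ring.mul_inverse_cancel _ hF.isUnit]
  comul_mul x y := by
    rw [twistedComul_apply, twistedComul_apply, twistedComul_apply, map_mul]
    simp only [mul_assoc]
    rw [← mul_assoc (Ring.inverse F) F, Ring.inverse_mul_cancel _ hF.isUnit, one_mul]
  comul_parity x := by
    have hFp : mapHom (parity K) F = F := hF.parity_eq
    change twistedComul _ F (mapHom (parity K) x) = mapHom (parity K) (twistedComul _ F x)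
    rw [twistedComul_apply, twistedComul_apply, map_mul, map_mul, mapHom_parity_inverse hF, hFp,
      H.comul_parity_series]
  counit_scalar c x := by
    rw [(isParLinear_counit (ε₀ := ε₀)).map_scalar_mul]
    rfl
  counit_one := map_one (mapHom ε₀)
  counit_mul := map_mul (mapHom ε₀)
  counit_parity := H.counit_parity_series
  coassoc := H.twistedComul_coassoc hF
  counit_left := H.counitLeft_twistedComul hF
  counit_right := H.counitRight_twistedComul hF
  antipode_scalar := isParLinear_twistedAntipode.map_scalar_mul
  antipode_parity := H.twistedAntipode_parity hF
  antipode_left x := by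
    have h : conjBy (Ring.inverse (mulLeftAntipode S₀ (Ring.inverse F))) ∘ₗ mapSeries K S₀ =
        twistedAntipode S₀ F :=
      LinearMap.ext (antipode_unique isParLinear_twistedAntipode
        ((isParLinear_conjBy _).comp (IsParLinear.mapSeries _)) (H.twistedComul_coassoc hF)
        (H.counitLeft_twistedComul hF) (H.counitRight_twistedComul hF)
        (H.twisted_antipode_right hF (H.isUnit_mulRightAntipode hF1))
        (H.twisted_antipode_left hF (H.isUnit_mulLeftAntipode hF hF1)))
    rw [← h]
    exact H.twisted_antipode_left hF (H.isUnit_mulLeftAntipode hF hF1) x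
  antipode_right := H.twisted_antipode_right hF (H.isUnit_mulRightAntipode hF1)
  isUnit_R := ⟨⟨_, _, twistedR_mul_flip hF, flip_twistedR_mul hF⟩, rfl⟩
  parity_R := parity_twistedR hF
  R_comul := H.twistedR_mul_twistedComul hF
  comulLeft_R := H.comulLeft_twistedR hF
  comulRight_R := H.comulRight_twistedR hF
  triangular := flip_twistedR_mul hF

end IsCocommutativeHopf
end Twisting

end
end TwistedSl12

namespace TwistedSl12

open scoped TensorProduct

noncomputable section

/-! ### The Hopf superalgebra `U(sl(1/2))` -/

section Generators
variable {K : Type*} [Field K] {G : Type*} {r : FreeAlgebra K G → FreeAlgebra K G → Prop}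

theorem gen_induction {P : Presented r → Prop} (halg : ∀ c : K, P (algebraMap K _ c))
    (hgen : ∀ x, P (gen r x)) (hmul : ∀ a b, P a → P b → P (a * b))
    (hadd : ∀ a b, P a → P b → P (a + b)) (a : Presented r) : P a := by
  obtain ⟨w, rfl⟩ := RingQuot.mkAlgHom_surjective K r a
  induction w using FreeAlgebra.induction with
  | grade0 c => rw [AlgHom.commutes]; exact halg c
  | grade1 x => exact hgen x
  | mul a b ha hb => rw [map_mul]; exact hmul _ _ ha hb
  | add a b ha hb => rw [map_add]; exact hadd _ _ ha hb

/-- Induction over words in the generators, extended on the left. -/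
theorem gen_mul_induction {P : Presented r → Prop} (h1 : P 1)
    (hsmul : ∀ (c : K) a, P a → P (c • a)) (hadd : ∀ a b, P a → P b → P (a + b))
    (hgen : ∀ x a, P a → P (gen r x * a)) (a : Presented r) : P a := by
  have h : ∀ b, P b → P (a * b) := by
    induction a using gen_induction with
    | halg c => intro b hb; rw [← Algebra.smul_def]; exact hsmul c b hb
    | hgen x => exact hgen x
    | hmul a a' ha ha' => intro b hb; rw [mul_assoc]; exact ha _ (ha' _ hb)
    | hadd a a' ha ha' => intro b hb; rw [add_mul]; exact hadd _ _ (ha _ hb) (ha' _ hb)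
  simpa using h 1 h1

/-- Induction over words in the generators, extended on the right. -/
theorem mul_gen_induction {P : Presented r → Prop} (h1 : P 1)
    (hsmul : ∀ (c : K) a, P a → P (c • a)) (hadd : ∀ a b, P a → P b → P (a + b))
    (hgen : ∀ x a, P a → P (a * gen r x)) (a : Presented r) : P a := by
  have h : ∀ b, P b → P (b * a) := by
    induction a using gen_induction with
    | halg c =>
      intro b hb
      rw [← Algebra.commutes, ← Algebra.smul_def]
      exact hsmul c b hb
    | hgen x => exact hgen x
    | hmul a a' ha ha' => intro b hb; rw [← mul_assoc]; exact ha' _ (ha _ hb)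
    | hadd a a' ha ha' => intro b hb; rw [mul_add]; exact hadd _ _ (ha _ hb) (ha' _ hb)
  simpa using h 1 h1

end Generators

section Sl12
variable (K : Type*) [Field K] [CharZero K]

theorem comul₀_gen (x : GenSl12) : comul₀ K (genSl12 K x) =
    tensorInl K _ _ (genSl12 K x) + tensorInr K _ _ (genSl12 K x) :=
  liftGen_gen _ _ x

theorem counit₀_gen (x : GenSl12) : counit₀ K (genSl12 K x) = 0 := liftGen_gen _ _ x

theorem comul₀_parity (a : Usl12 K) : comul₀ K (parity K a) = parity K (comul₀ K a) := by
  refine DFunLike.congr_fun (algHom_ext_gen (f := (comul₀ K).comp (parity K))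
    (g := (parity K).comp (comul₀ K)) fun x => ?_) a
  rw [AlgHom.comp_apply, AlgHom.comp_apply]
  change comul₀ K (parity K (genSl12 K x)) = parity K (comul₀ K (genSl12 K x))
  rw [comul₀_gen, map_add, parity_inl, parity_inr, parity_gen]
  cases x.isOdd <;> simp [comul₀_gen, add_comm]

theorem counit₀_parity (a : Usl12 K) : counit₀ K (parity K a) = counit₀ K a := by
  refine DFunLike.congr_fun (algHom_ext_gen (f := (counit₀ K).comp (parity K)) fun x => ?_) a
  rw [AlgHom.comp_apply]
  change counit₀ K (parity K (genSl12 K x)) = counit₀ K (genSl12 K x)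
  rw [parity_gen]
  cases x.isOdd <;> simp [counit₀_gen]

theorem superCommute_counit₀ :
    SuperCommute ((Algebra.ofId K (Usl12 K)).comp (counit₀ K)) (AlgHom.id K (Usl12 K)) := by
  intro i j a b ha hb
  induction i using zmod_two_cases
  · simpa using Algebra.commutes _ _
  · have h := counit₀_parity K a
    rw [(mem_odd K).1 ha, map_neg] at h
    simp [self_eq_neg.1 h.symm]

theorem antipode₀_parity (a : Usl12 K) :
    antipode₀ K (parity K a) = parity K (antipode₀ K a) := by
  induction a using gen_mul_induction with
  | h1 => rw [map_one, antipode₀_one, map_one]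
  | hsmul c a ha => rw [map_smul, map_smul, ha, map_smul, map_smul]
  | hadd a b ha hb => rw [map_add, map_add, ha, hb, map_add, map_add]
  | hgen x a ha =>
    change antipode₀ K (parity K (genSl12 K x * a)) = parity K (antipode₀ K (genSl12 K x * a))
    rw [map_mul (parity K), antipode₀_gen_mul, map_neg, map_mul (parity K), parity_gen]
    cases hx : x.isOdd <;> simp [antipode₀_gen_mul, hx, ha]

theorem antipode₀_mul_even (a : Usl12 K) {b : Usl12 K} (hb : b ∈ homogeneous K (Usl12 K) 0) :
    antipode₀ K (a * b) = antipode₀ K b * antipode₀ K a := by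
  have hb' : parity K (antipode₀ K b) = antipode₀ K b := by
    rw [← antipode₀_parity, (mem_even K).1 hb]
  induction a using gen_mul_induction with
  | h1 => rw [one_mul, antipode₀_one, mul_one]
  | hsmul c a ha => rw [smul_mul_assoc, map_smul, ha, map_smul, mul_smul_comm]
  | hadd a a' ha ha' => rw [add_mul, map_add, ha, ha', map_add, mul_add]
  | hgen x a ha =>
    change antipode₀ K (genSl12 K x * a * b) = antipode₀ K b * antipode₀ K (genSl12 K x * a)
    rw [mul_assoc, antipode₀_gen_mul, antipode₀_gen_mul, ha]
    cases hx : x.isOdd <;> simp [hb', mul_assoc]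

theorem antipode₀_mul_odd (a : Usl12 K) {b : Usl12 K} (hb : b ∈ homogeneous K (Usl12 K) 1) :
    antipode₀ K (a * b) = antipode₀ K b * antipode₀ K (parity K a) := by
  have hb' : parity K (antipode₀ K b) = -antipode₀ K b := by
    rw [← antipode₀_parity, (mem_odd K).1 hb, map_neg]
  induction a using gen_mul_induction with
  | h1 => rw [one_mul, map_one, antipode₀_one, mul_one]
  | hsmul c a ha => rw [smul_mul_assoc, map_smul, ha, map_smul, map_smul, mul_smul_comm]
  | hadd a a' ha ha' => rw [add_mul, map_add, ha, ha', map_add, map_add, mul_add]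
  | hgen x a ha =>
    change antipode₀ K (genSl12 K x * a * b) =
      antipode₀ K b * antipode₀ K (parity K (genSl12 K x * a))
    rw [mul_assoc, antipode₀_gen_mul, map_mul (parity K), parity_gen, ha]
    cases hx : x.isOdd <;> simp [hb', mul_assoc, antipode₀_gen_mul, hx]

theorem antipode₀_mul ⦃i j : ZMod 2⦄ ⦃a b : Usl12 K⦄ (ha : a ∈ homogeneous K (Usl12 K) i)
    (hb : b ∈ homogeneous K (Usl12 K) j) :
    antipode₀ K (a * b) = ((-1 : ℤˣ) ^ (j * i)) • (antipode₀ K b * antipode₀ K a) := by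
  induction j using zmod_two_cases
  · rw [antipode₀_mul_even K a hb, zero_mul, uzpow_zero, one_smul]
  · rw [antipode₀_mul_odd K a hb, (mem_homogeneous K).1 ha, one_mul, Units.smul_def,
      Units.smul_def, map_zsmul, mul_smul_comm]

theorem antipode₀_gen (x : GenSl12) : antipode₀ K (genSl12 K x) = -genSl12 K x := by
  have h := antipode₀_gen_mul K x 1
  rw [mul_one, antipode₀_one, map_one] at h
  simpa using h

/-- The `n`-th power of the parity involution, for `n` the degree of the generator `x`. -/
abbrev genSign (x : GenSl12) {A : Type*} [Ring A] [Algebra K A] [Superalgebra K A] : A →ₐ[K] A :=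
  if x.isOdd then parity K else AlgHom.id K A

/-- Moving a generator out of the second factor through `m(id ⊗ S₀)`. -/
theorem tensorLift_antipode₀_inr_gen_mul (x : GenSl12)
    (w : SuperTensor K (Usl12 K) (Usl12 K)) :
    tensorLift LinearMap.id (antipode₀ K) (tensorInr K _ _ (genSl12 K x) * w) =
      -(genSign K x (tensorLift LinearMap.id (antipode₀ K) w) * genSl12 K x) := by
  induction w using superTensor_induction with
  | h0 => simp
  | hadd w w' h h' => simp only [mul_add, map_add, h, h', add_mul, neg_add]
  | hmul ha hb =>
    rename_i i j a b
    rw [← mul_assoc, inr_mul_inl K ha (gen_mem K x), Units.smul_def, smul_mul_assoc, mul_assoc,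
      ← map_mul, map_zsmul, tensorLift_inl_mul_inr, tensorLift_inl_mul_inr, antipode₀_gen_mul,
      map_mul]
    cases hx : x.isOdd
    · simp [genSign, hx, mul_assoc]
    · simp [genSign, hx, mul_assoc, (mem_homogeneous K).1 ha, Units.smul_def]

/-- Moving a generator out of the first factor through `m(S₀ ⊗ id)`. -/
theorem tensorLift_antipode₀_mul_inl_gen (x : GenSl12)
    (w : SuperTensor K (Usl12 K) (Usl12 K)) :
    tensorLift (antipode₀ K) LinearMap.id (w * tensorInl K _ _ (genSl12 K x)) =
      -(genSl12 K x * genSign K x (tensorLift (antipode₀ K) LinearMap.id w)) := by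
  induction w using superTensor_induction with
  | h0 => simp
  | hadd w w' h h' => simp only [mul_add, map_add, h, h', add_mul, neg_add]
  | hmul ha hb =>
    rename_i i j a b
    rw [mul_assoc, inr_mul_inl K (gen_mem K x) hb, Units.smul_def, mul_smul_comm, ← mul_assoc,
      ← map_mul, map_zsmul, tensorLift_inl_mul_inr, tensorLift_inl_mul_inr,
      antipode₀_mul K ha (gen_mem K x), antipode₀_gen, map_mul]
    cases hx : x.isOdd
    · simp [genSign, hx, mul_assoc]
    · simp [genSign, hx, mul_assoc, (mem_homogeneous K).1 hb, Units.smul_def, ← antipode₀_parity,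
        (mem_homogeneous K).1 ha, -zsmul_eq_mul, map_zsmul]

theorem antipode₀_right (a : Usl12 K) :
    tensorLift LinearMap.id (antipode₀ K) (comul₀ K a) = algebraMap K _ (counit₀ K a) := by
  induction a using gen_mul_induction with
  | h1 =>
    rw [map_one (comul₀ K), map_one (counit₀ K),
      IsCocommutativeHopf.tensorLift_one, antipode₀_one]
    simp
  | hsmul c a ha => rw [map_smul, map_smul, ha, map_smul, smul_eq_mul, map_mul, Algebra.smul_def]
  | hadd a b ha hb => simp only [map_add, ha, hb]
  | hgen x a ha =>
    change tensorLift _ _ (comul₀ K (genSl12 K x * a)) =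
      algebraMap K _ (counit₀ K (genSl12 K x * a))
    have h : ∀ w, tensorLift LinearMap.id (antipode₀ K) (tensorInl K _ _ (genSl12 K x) * w) =
        genSl12 K x * tensorLift LinearMap.id (antipode₀ K) w := fun w => by
      induction w using superTensor_induction with
      | h0 => simp
      | hadd w w' h h' => simp only [mul_add, map_add, h, h']
      | hmul _ _ =>
        rw [← mul_assoc, ← map_mul, tensorLift_inl_mul_inr, tensorLift_inl_mul_inr]
        exact mul_assoc _ _ _
    rw [map_mul, comul₀_gen, add_mul, map_add, h, tensorLift_antipode₀_inr_gen_mul, ha,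
      AlgHom.commutes, map_mul, counit₀_gen, zero_mul, map_zero, Algebra.commutes, add_neg_cancel]

theorem antipode₀_left (a : Usl12 K) :
    tensorLift (antipode₀ K) LinearMap.id (comul₀ K a) = algebraMap K _ (counit₀ K a) := by
  induction a using mul_gen_induction with
  | h1 =>
    rw [map_one (comul₀ K), map_one (counit₀ K),
      IsCocommutativeHopf.tensorLift_one, antipode₀_one]
    simp
  | hsmul c a ha => rw [map_smul, map_smul, ha, map_smul, smul_eq_mul, map_mul, Algebra.smul_def]
  | hadd a b ha hb => simp only [map_add, ha, hb]
  | hgen x a ha =>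
    change tensorLift _ _ (comul₀ K (a * genSl12 K x)) =
      algebraMap K _ (counit₀ K (a * genSl12 K x))
    have h : ∀ w, tensorLift (antipode₀ K) LinearMap.id (w * tensorInr K _ _ (genSl12 K x)) =
        tensorLift (antipode₀ K) LinearMap.id w * genSl12 K x := fun w => by
      induction w using superTensor_induction with
      | h0 => simp
      | hadd w w' h h' => simp only [add_mul, map_add, h, h']
      | hmul _ _ =>
        rw [mul_assoc, ← map_mul, tensorLift_inl_mul_inr, tensorLift_inl_mul_inr]
        exact (mul_assoc _ _ _).symm
    rw [map_mul, comul₀_gen, mul_add, map_add, h, tensorLift_antipode₀_mul_inl_gen, ha,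
      AlgHom.commutes, map_mul, counit₀_gen, mul_zero, map_zero, Algebra.commutes, neg_add_cancel]

theorem isCocommutativeHopf_sl12 :
    IsCocommutativeHopf (comul₀ K) (counit₀ K) (antipode₀ K) where
  comul_parity := comul₀_parity K
  counit_parity := counit₀_parity K
  coassoc a := by
    have hl := (superCommute_leg₁₂_leg₃ K (Usl12 K)).comp_left (comul₀_parity K)
    have hr := (superCommute_leg₁_leg₂₃ K (Usl12 K)).comp_right (comul₀_parity K)
    rw [tensorLift_toLinearMap _ _ hl, tensorLift_toLinearMap _ _ hr]
    refine DFunLike.congr_fun (algHom_ext_gen (f := (superLift _ _ hl).comp (comul₀ K))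
      (g := (superLift _ _ hr).comp (comul₀ K)) fun x => ?_) a
    change superLift _ _ hl (comul₀ K (genSl12 K x)) = superLift _ _ hr (comul₀ K (genSl12 K x))
    simp only [comul₀_gen, map_add, superLift_inl, superLift_inr, AlgHom.comp_apply, leg₁₂_inl,
      leg₁₂_inr, leg₂₃_inl, leg₂₃_inr, add_assoc]
  counit_left a := by
    refine DFunLike.congr_fun (algHom_ext_gen
      (f := (superLift _ _ (superCommute_counit₀ K)).comp (comul₀ K)) (g := AlgHom.id K _)
      fun x => ?_) a
    change superLift _ _ (superCommute_counit₀ K) (comul₀ K (genSl12 K x)) = genSl12 K x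
    simp [comul₀_gen, superLift_inl, superLift_inr, counit₀_gen]
  counit_right a := by
    refine DFunLike.congr_fun (algHom_ext_gen
      (f := (superLift _ _ (superCommute_counit₀ K).symm).comp (comul₀ K)) (g := AlgHom.id K _)
      fun x => ?_) a
    change superLift _ _ (superCommute_counit₀ K).symm (comul₀ K (genSl12 K x)) = genSl12 K x
    simp [comul₀_gen, superLift_inl, superLift_inr, counit₀_gen]
  cocomm a := by
    refine DFunLike.congr_fun (algHom_ext_gen (f := (flipHom K _).comp (comul₀ K))
      (g := comul₀ K) fun x => ?_) a
    change flipHom K _ (comul₀ K (genSl12 K x)) = comul₀ K (genSl12 K x)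
    rw [comul₀_gen, map_add, flipHom_inl, flipHom_inr, add_comm]
  antipode_parity := antipode₀_parity K
  antipode_one := antipode₀_one K
  antipode_mul := antipode₀_mul K
  antipode_left := antipode₀_left K
  antipode_right := antipode₀_right K

end Sl12

end
end TwistedSl12

namespace TwistedSl12

open scoped TensorProduct

noncomputable section

/-! ### The twist element -/

section TwistFactors
variable {K : Type*} [Field K] [CharZero K]
variable {Q : Type*} [Ring Q] [Algebra K Q]
variable {Q' : Type*} [Ring Q'] [Algebra K Q']

variable (K) in
/-- `exp(g τ(x) z)`, the first factor of the twist, with the legs of the arguments left open. -/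
def twistG (x z : Q) : FPS Q := expSeries K (parG Q * (tau K x * constSeries K z))

variable (K) in
/-- `exp(-(1 / 2) y σ(x))`, the second factor of the twist, with the legs of the arguments left
open. -/
def twistJ (y x : Q) : FPS Q := expSeries K (-((2⁻¹ : K) • (constSeries K y * sigma K x)))

theorem constantCoeff_parG_mul (x : FPS Q) : MvPowerSeries.constantCoeff (parG Q * x) = 0 := by
  rw [map_mul, constantCoeff_parG, zero_mul]

theorem constantCoeff_smul_mul_sigma (c : K) (y : FPS Q) (x : Q) :
    MvPowerSeries.constantCoeff (-(c • (y * sigma K x))) = 0 := by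
  have h : MvPowerSeries.constantCoeff (c • (y * sigma K x)) =
      c • MvPowerSeries.constantCoeff (y * sigma K x) := rfl
  rw [map_neg, h, map_mul, constantCoeff_sigma, mul_zero, smul_zero, neg_zero]

theorem commute_constSeries {a b : Q} (h : Commute a b) :
    Commute (constSeries K a) (constSeries K b) :=
  h.map (MvPowerSeries.C (σ := Fin 2) (R := Q))

theorem map_twistG (φ : Q →ₐ[K] Q') (x z : Q) :
    mapHom φ (twistG K x z) = twistG K (φ x) (φ z) := by
  rw [twistG, map_expSeries, map_mul, map_mul, mapAlgHom_parG, map_tau, mapHom_constSeries, twistG]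

theorem map_twistJ (φ : Q →ₐ[K] Q') (y x : Q) :
    mapHom φ (twistJ K y x) = twistJ K (φ y) (φ x) := by
  rw [twistJ, map_expSeries, map_neg, map_smul, map_mul, map_sigma, mapHom_constSeries, twistJ]

theorem constantCoeff_twistG (x z : Q) : MvPowerSeries.constantCoeff (twistG K x z) = 1 :=
  constantCoeff_expSeries _

theorem constantCoeff_twistJ (y x : Q) : MvPowerSeries.constantCoeff (twistJ K y x) = 1 :=
  constantCoeff_expSeries _

theorem twistG_zero_left (z : Q) : twistG K 0 z = 1 := by
  rw [twistG, tau_zero, zero_mul, mul_zero, expSeries_zero]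

theorem twistG_zero_right (x : Q) : twistG K x 0 = 1 := by
  rw [twistG, map_zero, mul_zero, mul_zero, expSeries_zero]

theorem twistJ_zero_left (x : Q) : twistJ K 0 x = 1 := by
  rw [twistJ, map_zero, zero_mul, smul_zero, neg_zero, expSeries_zero]

theorem twistJ_zero_right (y : Q) : twistJ K y 0 = 1 := by
  rw [twistJ, sigma_zero, mul_zero, smul_zero, neg_zero, expSeries_zero]

theorem commute_twistG {x z : Q} {b : FPS Q} (hx : Commute (constSeries K x) b)
    (hz : Commute (constSeries K z) b) : Commute (twistG K x z) b :=
  commute_expSeries (constantCoeff_parG_mul _)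
    ((commute_parG b).mul_left ((commute_tau hx).mul_left hz))

theorem commute_twistJ {y x : Q} {b : FPS Q} (hy : Commute (constSeries K y) b)
    (hx : Commute (constSeries K x) b) : Commute (twistJ K y x) b :=
  commute_expSeries (constantCoeff_smul_mul_sigma _ _ _)
    (((hy.mul_left (commute_sigma hx)).smul_left _).neg_left)

theorem twistG_add_right {x z z' : Q} (hz : Commute x z) (hz' : Commute x z')
    (hzz : Commute z z') : twistG K x (z + z') = twistG K x z * twistG K x z' := by
  rw [twistG, map_add, mul_add, mul_add,
    expSeries_add (constantCoeff_parG_mul _) (constantCoeff_parG_mul _)]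
  · rfl
  have h1 : Commute (tau K x) (tau K x * constSeries K z') :=
    (Commute.refl _).mul_right (commute_tau (commute_constSeries hz'))
  have h2 : Commute (constSeries K z) (tau K x * constSeries K z') :=
    (commute_tau (commute_constSeries hz)).symm.mul_right (commute_constSeries hzz)
  exact (commute_parG _).mul_left ((commute_parG _).symm.mul_right (h1.mul_left h2))

theorem twistJ_add_left {y y' x : Q} (hy : Commute x y) (hy' : Commute x y')
    (hyy : Commute y y') : twistJ K (y + y') x = twistJ K y x * twistJ K y' x := by
  rw [twistJ, map_add, add_mul, smul_add, neg_add,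
    expSeries_add (constantCoeff_smul_mul_sigma _ _ _) (constantCoeff_smul_mul_sigma _ _ _)]
  · rfl
  have h1 : Commute (sigma K x) (constSeries K y' * sigma K x) :=
    (commute_sigma (commute_constSeries hy')).mul_right (Commute.refl _)
  have h2 : Commute (constSeries K y) (constSeries K y' * sigma K x) :=
    (commute_constSeries hyy).mul_right (commute_sigma (commute_constSeries hy)).symm
  exact (((h2.mul_left h1).smul_left _).smul_right _).neg_left.neg_right

/-- Conjugation by `exp(-(1 / 2) y σ(x'))` multiplies the vectors of `y`-weight `n` by
`exp(-(n / 2) σ(x'))`. -/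
theorem twistJ_mul_of_weight {y x' : Q} {b : FPS Q} {n : K}
    (hb : constSeries K y * b = b * constSeries K y + n • b) (hx : Commute x' y)
    (hx' : Commute (constSeries K x') b) :
    twistJ K y x' * b = b * expSeries K (-((2⁻¹ * n) • sigma K x')) * twistJ K y x' := by
  have hs : Commute (sigma K x') (constSeries K y) := commute_sigma (commute_constSeries hx)
  have hn : MvPowerSeries.constantCoeff (-((2⁻¹ * n) • sigma K x')) = 0 := by
    simpa using constantCoeff_smul_mul_sigma (2⁻¹ * n) (1 : FPS Q) x'
  rw [twistJ, mul_assoc, ← expSeries_add hn (constantCoeff_smul_mul_sigma _ _ _)]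
  · refine semiconj_expSeries (constantCoeff_smul_mul_sigma _ _ _) ?_ ?_
    · rw [map_add, hn, constantCoeff_smul_mul_sigma, add_zero]
    · rw [neg_mul, smul_mul_assoc, mul_assoc, (commute_sigma hx').eq, ← mul_assoc, hb, add_mul,
        mul_add, mul_neg, mul_neg, mul_smul_comm, mul_smul_comm, smul_mul_assoc, smul_add,
        smul_smul, neg_add, mul_assoc, add_comm]
  · exact ((hs.mul_right (Commute.refl _)).smul_left _).smul_right _ |>.neg_left.neg_right

section Pair
variable {y x x' : Q} (hyx : y * x = x * y + (2 : K) • x) (hy : Commute x' y) (hx : Commute x' x)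
include hyx hy hx

/-- The second factor of the twist carries `σ(x + x')` to `σ(x) + σ(x')`, as
`exp(-σ(x)) exp(-σ(x')) = 1 - 2h(x exp(-σ(x')) + x')`. -/
theorem twistJ_mul_sigma_add :
    twistJ K y x' * sigma K (x + x') = (sigma K x + sigma K x') * twistJ K y x' := by
  have hb : constSeries K y * constSeries K x = constSeries K x * constSeries K y +
      (2 : K) • constSeries K x := by
    rw [← constSeries_mul, hyx, map_add, map_smul, constSeries_mul]
  have h1 := twistJ_mul_of_weight hb hy (commute_constSeries hx)
  rw [inv_mul_cancel₀ (two_ne_zero (α := K)), one_smul] at h1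
  have h2 : Commute (twistJ K y x') (constSeries K x') :=
    commute_twistJ (commute_constSeries hy.symm) (Commute.refl _)
  set w : FPS Q := constSeries K x * expSeries K (-sigma K x') + constSeries K x' with hw
  have h3 : -(2 * parH Q * w) * twistJ K y x' =
      twistJ K y x' * -(2 * parH Q * constSeries K (x + x')) := by
    have h4 : w * twistJ K y x' = twistJ K y x' * constSeries K (x + x') := by
      rw [hw, add_mul, ← h1, ← h2.eq, map_add, mul_add]
    have h5 : Commute (2 * parH Q) (twistJ K y x') :=
      (Commute.ofNat_left 2 _).mul_left (commute_parH _)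
    rw [neg_mul, mul_assoc, h4, mul_neg, ← mul_assoc, h5.eq, mul_assoc]
  have hss : Commute (-sigma K x) (-sigma K x') :=
    (commute_sigma (commute_sigma (commute_constSeries hx)).symm).neg_left.neg_right
  have h6 : substSeries K (PowerSeries.log K) (-(2 * parH Q * w)) =
      -(sigma K x + sigma K x') := by
    refine log_eq_neg (by rw [map_add, constantCoeff_sigma, constantCoeff_sigma, add_zero]) ?_
    rw [neg_add, expSeries_add (by simp [constantCoeff_sigma]) (by simp [constantCoeff_sigma]) hss,
      expSeries_neg_sigma x, sub_mul, one_mul, hw, mul_add, neg_add, expSeries_neg_sigma x']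
    simp only [mul_assoc, sub_eq_add_neg]
    abel
  have h7 := semiconj_substSeries (by simp [constantCoeff_parH])
    (constantCoeff_neg_two_h (K := K) (x + x')) h3 (PowerSeries.log K)
  rw [h6] at h7
  rw [sigma, mul_neg, ← h7, neg_mul, neg_neg]

theorem twistJ_mul_tau_add :
    twistJ K y x' * tau K (x + x') = (tau K x + tau K x') * twistJ K y x' := by
  have h5 : Commute (2 * parH Q) (twistJ K y x') :=
    (Commute.ofNat_left 2 _).mul_left (commute_parH _)
  refine two_parH_mul_cancel (K := K) ?_
  rw [← mul_assoc, h5.eq, mul_assoc, two_h_mul_tau, ← mul_assoc, mul_add, two_h_mul_tau,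
    two_h_mul_tau, twistJ_mul_sigma_add hyx hy hx]

/-- `J₁₂ (Δ₀ ⊗ id)(G) J₁₂⁻¹ = G₁₃ G₂₃`, where `G` and `J` are the factors of the twist: `z` is taken
in the third leg. -/
theorem twistJ_mul_twistG_add {z : Q} (hzx : Commute x z) (hzx' : Commute x' z)
    (hzy : Commute y z) :
    twistJ K y x' * twistG K (x + x') z = twistG K x z * twistG K x' z * twistJ K y x' := by
  have hJ : Commute (twistJ K y x') (constSeries K z) :=
    commute_twistJ (commute_constSeries hzy) (commute_constSeries hzx')
  have h1 : twistG K x z * twistG K x' z =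
      expSeries K (parG Q * ((tau K x + tau K x') * constSeries K z)) := by
    rw [add_mul, mul_add, expSeries_add (constantCoeff_parG_mul _) (constantCoeff_parG_mul _)]
    · rfl
    · have ht : Commute (tau K x) (tau K x') :=
        commute_tau (commute_tau (commute_constSeries hx)).symm
      have h2 : Commute (tau K x) (tau K x' * constSeries K z) :=
        ht.mul_right (commute_tau (commute_constSeries hzx))
      have h3 : Commute (constSeries K z) (tau K x' * constSeries K z) :=
        (commute_tau (commute_constSeries hzx')).symm.mul_right (Commute.refl _)
      exact (commute_parG _).mul_left ((commute_parG _).symm.mul_right (h2.mul_left h3))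
  rw [h1]
  refine (semiconj_expSeries (constantCoeff_parG_mul _) (constantCoeff_parG_mul _) ?_).symm
  rw [mul_assoc, mul_assoc, ← hJ.eq, ← mul_assoc (_ + _), ← twistJ_mul_tau_add hyx hy hx,
    ← mul_assoc, ← mul_assoc, (commute_parG _).eq]
  simp only [mul_assoc]

/-- The analogue of `twistJ_mul_sigma_add` for the factors `exp(-(1 / 2) y' σ)`, with `y'` in a
further leg. -/
theorem twistJ_mul_twistJ_add {y' : Q} (hyx' : Commute x y') (hyy' : Commute y' y)
    (hx'y' : Commute x' y') :
    twistJ K y x' * twistJ K y' (x + x') = twistJ K y' x * twistJ K y' x' * twistJ K y x' := by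
  have hJ : Commute (twistJ K y x') (constSeries K y') :=
    commute_twistJ (commute_constSeries hyy'.symm) (commute_constSeries hx'y')
  have h1 : twistJ K y' x * twistJ K y' x' =
      expSeries K (-((2⁻¹ : K) • (constSeries K y' * (sigma K x + sigma K x')))) := by
    rw [mul_add, smul_add, neg_add, expSeries_add (constantCoeff_smul_mul_sigma _ _ _)
      (constantCoeff_smul_mul_sigma _ _ _)]
    · rfl
    · have ht : Commute (sigma K x) (sigma K x') :=
        commute_sigma (commute_sigma (commute_constSeries hx)).symm
      have h2 : Commute (sigma K x) (constSeries K y' * sigma K x') :=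
        (commute_sigma (commute_constSeries hyx')).mul_right ht
      have h3 : Commute (constSeries K y') (constSeries K y' * sigma K x') :=
        (Commute.refl _).mul_right (commute_sigma (commute_constSeries hx'y')).symm
      exact (((h3.mul_left h2).smul_left _).smul_right _).neg_left.neg_right
  rw [h1]
  refine (semiconj_expSeries ?_ (constantCoeff_smul_mul_sigma _ _ _) ?_).symm
  · rw [mul_add, smul_add, neg_add, map_add, constantCoeff_smul_mul_sigma,
      constantCoeff_smul_mul_sigma, add_zero]
  · rw [neg_mul, mul_neg, smul_mul_assoc, mul_smul_comm, mul_assoc,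
      ← twistJ_mul_sigma_add hyx hy hx, ← mul_assoc, ← hJ.eq, mul_assoc]

end Pair

/-- The cocycle identity; the index of a variable is the leg in which it lives. Both sides are
equal to `G₁₂ G₁₃ G₂₃ J₁₂ J₁₃ J₂₃`. -/
theorem twist_cocycle {x₁ x₂ x₃ y₁ y₂ z₂ z₃ : Q} (hyx₁ : y₁ * x₁ = x₁ * y₁ + (2 : K) • x₁)
    (hyx₂ : y₂ * x₂ = x₂ * y₂ + (2 : K) • x₂)
    (hx₂y₁ : Commute x₂ y₁) (hx₃y₁ : Commute x₃ y₁) (hx₃y₂ : Commute x₃ y₂) (hx₁y₂ : Commute x₁ y₂)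
    (hx₂x₁ : Commute x₂ x₁) (hx₃x₂ : Commute x₃ x₂) (hy₁y₂ : Commute y₁ y₂)
    (hx₁z₂ : Commute x₁ z₂) (hx₂z₂ : Commute x₂ z₂) (hx₃z₂ : Commute x₃ z₂) (hy₂z₂ : Commute y₂ z₂)
    (hx₁z₃ : Commute x₁ z₃) (hx₂z₃ : Commute x₂ z₃) (hx₃z₃ : Commute x₃ z₃) (hy₁z₃ : Commute y₁ z₃)
    (hy₂z₃ : Commute y₂ z₃) (hz₂z₃ : Commute z₂ z₃) (hx₃x₁ : Commute x₃ x₁) :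
    twistG K x₁ z₂ * twistJ K y₁ x₂ * (twistG K (x₁ + x₂) z₃ * twistJ K (y₁ + y₂) x₃) =
      twistG K x₂ z₃ * twistJ K y₂ x₃ * (twistG K x₁ (z₂ + z₃) * twistJ K y₁ (x₂ + x₃)) := by
  have h1 := twistJ_mul_twistG_add hyx₁ hx₂y₁ hx₂x₁ hx₁z₃ hx₂z₃ hy₁z₃
  have h2 := twistJ_add_left (K := K) hx₃y₁ hx₃y₂ hy₁y₂
  have h3 := twistG_add_right (K := K) hx₁z₂ hx₁z₃ hz₂z₃
  have h4 := twistJ_mul_twistJ_add hyx₂ hx₃y₂ hx₃x₂ hx₂y₁ hy₁y₂ hx₃y₁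
  have hx₁J : Commute (constSeries K x₁) (twistJ K y₂ x₃) :=
    (commute_twistJ (commute_constSeries hx₁y₂.symm) (commute_constSeries hx₃x₁)).symm
  have hz₂J : Commute (constSeries K z₂) (twistJ K y₂ x₃) :=
    (commute_twistJ (commute_constSeries hy₂z₂) (commute_constSeries hx₃z₂)).symm
  have hz₃J : Commute (constSeries K z₃) (twistJ K y₂ x₃) :=
    (commute_twistJ (commute_constSeries hy₂z₃) (commute_constSeries hx₃z₃)).symm
  have h5 : Commute (twistG K x₁ z₂ * twistG K x₁ z₃) (twistJ K y₂ x₃) :=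
    (commute_twistG hx₁J hz₂J).mul_left (commute_twistG hx₁J hz₃J)
  have hx₁G : Commute (constSeries K x₁) (twistG K x₂ z₃) :=
    (commute_twistG (commute_constSeries hx₂x₁) (commute_constSeries hx₁z₃.symm)).symm
  have hz₂G : Commute (constSeries K z₂) (twistG K x₂ z₃) :=
    (commute_twistG (commute_constSeries hx₂z₂) (commute_constSeries hz₂z₃.symm)).symm
  have hz₃G : Commute (constSeries K z₃) (twistG K x₂ z₃) :=
    (commute_twistG (commute_constSeries hx₂z₃) (Commute.refl _)).symm
  have h6 : Commute (twistG K x₁ z₂ * twistG K x₁ z₃) (twistG K x₂ z₃) :=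
    (commute_twistG hx₁G hz₂G).mul_left (commute_twistG hx₁G hz₃G)
  calc _ = twistG K x₁ z₂ * (twistJ K y₁ x₂ * twistG K (x₁ + x₂) z₃) *
        twistJ K (y₁ + y₂) x₃ := by simp only [mul_assoc]
    _ = (twistG K x₁ z₂ * twistG K x₁ z₃) * twistG K x₂ z₃ *
        (twistJ K y₁ x₂ * twistJ K y₁ x₃ * twistJ K y₂ x₃) := by
      rw [h1, h2]; simp only [mul_assoc]
    _ = twistG K x₂ z₃ * ((twistG K x₁ z₂ * twistG K x₁ z₃) * twistJ K y₂ x₃) *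
        twistJ K y₁ (x₂ + x₃) := by
      rw [h6.eq, ← h4]; simp only [mul_assoc]
    _ = _ := by
      rw [h5.eq, h3]; simp only [mul_assoc]

end TwistFactors

section TwistElement
variable {K : Type*} [Field K] [CharZero K]
variable {A : Type*} [Ring A] [Algebra K A] [Superalgebra K A]
variable {Q : Type*} [Ring Q] [Algebra K Q]

theorem twistElement_eq (z y x : A) : twistElement K z y x =
    twistG K (tensorInl K A A x) (tensorInr K A A z) *
      twistJ K (tensorInl K A A y) (tensorInr K A A x) := by
  rw [twistElement, ten, ten, mapSeries_toLinearMap, mapSeries_toLinearMap, mapSeries_toLinearMap,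
    mapSeries_toLinearMap, map_tau, map_sigma, mapHom_constSeries, mapHom_constSeries, twistG,
    twistJ]

theorem map_twistElement (φ : SuperTensor K A A →ₐ[K] Q) (z y x : A) :
    mapHom φ (twistElement K z y x) =
      twistG K (φ (tensorInl K A A x)) (φ (tensorInr K A A z)) *
        twistJ K (φ (tensorInl K A A y)) (φ (tensorInr K A A x)) := by
  rw [twistElement_eq, map_mul, map_twistG, map_twistJ]

theorem constantCoeff_twistElement (z y x : A) :
    MvPowerSeries.constantCoeff (twistElement K z y x) = 1 := by
  rw [twistElement_eq, map_mul, constantCoeff_twistG, constantCoeff_twistJ, one_mul]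

theorem isUnit_twistElement (z y x : A) : IsUnit (twistElement K z y x) := by
  rw [MvPowerSeries.isUnit_iff_constantCoeff, constantCoeff_twistElement]
  exact isUnit_one

end TwistElement

section Sl12
variable (K : Type*) [Field K] [CharZero K]

theorem commute_of_rel {x y : GenSl12} (h : RelSl12 K (commWord K x y) 0) :
    Commute (genSl12 K x) (genSl12 K y) := by
  have := rel_eq h
  simp only [commWord, letter, map_sub, map_mul, FreeAlgebra.lift_ι_apply, map_zero] at this
  exact sub_eq_zero.1 this

theorem H_mul_Xp : genSl12 K .H * genSl12 K .Xp =
    genSl12 K .Xp * genSl12 K .H + (2 : K) • genSl12 K .Xp := by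
  have := rel_eq (RelSl12.H_Xp (K := K))
  simp only [commWord, letter, map_sub, map_mul, FreeAlgebra.lift_ι_apply, map_smul] at this
  rw [add_comm]
  exact sub_eq_iff_eq_add.1 this

theorem embTensor_inl (a : Ugl2 K) :
    embTensor K (tensorInl K _ _ a) = tensorInl K _ _ (embGl2 K a) := by
  change tensorInl K _ _ (embGl2 K a) * tensorInr K _ _ (embGl2 K 1) = _
  rw [map_one, map_one, mul_one]

theorem embTensor_inr (a : Ugl2 K) :
    embTensor K (tensorInr K _ _ a) = tensorInr K _ _ (embGl2 K a) := by
  change tensorInl K _ _ (embGl2 K 1) * tensorInr K _ _ (embGl2 K a) = _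
  rw [map_one, map_one, one_mul]

theorem twistSl12_eq : twistSl12 K =
    twistElement K (genSl12 K .Z) (genSl12 K .H) (genSl12 K .Xp) := by
  have hg : embGl2 K (genGl2 K .Z) = genSl12 K .Z ∧ embGl2 K (genGl2 K .H) = genSl12 K .H ∧
      embGl2 K (genGl2 K .Xp) = genSl12 K .Xp :=
    ⟨liftGen_gen _ _ _, liftGen_gen _ _ _, liftGen_gen _ _ _⟩
  rw [twistSl12, twistGl2, mapSeries_toLinearMap, map_twistElement, twistElement_eq]
  simp only [embTensor_inl, embTensor_inr, hg]

theorem isTwist_twistSl12 :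
    IsTwist (comul₀ K).toLinearMap (counit₀ K).toLinearMap (twistSl12 K) := by
  have H := isCocommutativeHopf_sl12 K
  have e : ∀ x : GenSl12, x.isOdd = false → genSl12 K x ∈ homogeneous K (Usl12 K) 0 :=
    fun x hx => by simpa [hx] using gen_mem K x
  have eZ := e .Z rfl
  have eH := e .H rfl
  have eX := e .Xp rfl
  have hXZ := (commute_of_rel K .Z_Xp).symm
  have hHZ := (commute_of_rel K .Z_H).symm
  rw [twistSl12_eq]
  refine ⟨isUnit_twistElement _ _ _, ?_, ?_, ?_, ?_⟩
  · rw [mapSeries_toLinearMap, map_twistElement, twistElement_eq]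
    simp only [parity_inl, parity_inr, parity_gen]
    rfl
  · rw [H.counitLeft_mapSeries, map_twistElement]
    simp [IsCocommutativeHopf.counitLeftHom, superLift_inl, superLift_inr, counit₀_gen,
      twistG_zero_left, twistJ_zero_left]
  · rw [H.counitRight_mapSeries, map_twistElement]
    simp [IsCocommutativeHopf.counitRightHom, superLift_inl, superLift_inr, counit₀_gen,
      twistG_zero_right, twistJ_zero_right]
  · rw [H.comulLeft_mapSeries, H.comulRight_mapSeries, mapSeries_toLinearMap,
      mapSeries_toLinearMap, map_twistElement, map_twistElement, map_twistElement,
      map_twistElement]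
    simp only [IsCocommutativeHopf.comulLeftHom, IsCocommutativeHopf.comulRightHom, superLift_inl,
      superLift_inr, AlgHom.comp_apply, comul₀_gen, map_add, leg₁₂_inl, leg₁₂_inr, leg₂₃_inl,
      leg₂₃_inr]
    have h12 := fun a (b : Usl12 K) hb =>
      (superCommute_leg₁_leg₂ K (Usl12 K)).even_right a (b := b) hb
    have h13 := fun a (b : Usl12 K) hb =>
      (superCommute_leg₁_leg₃ K (Usl12 K)).even_right a (b := b) hb
    have h23 := fun a (b : Usl12 K) hb =>
      (superCommute_leg₂_leg₃ K (Usl12 K)).even_right a (b := b) hb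
    refine twist_cocycle ?_ ?_ (h12 _ _ eX).symm (h13 _ _ eX).symm (h23 _ _ eX).symm (h12 _ _ eH)
      (h12 _ _ eX).symm (h23 _ _ eX).symm (h12 _ _ eH) (h12 _ _ eZ) (hXZ.map _)
      (h23 _ _ eX).symm (hHZ.map _) (h13 _ _ eZ) (h23 _ _ eZ) (hXZ.map _) (h13 _ _ eZ)
      (h23 _ _ eZ) (h23 _ _ eZ) (h13 _ _ eX).symm
    · rw [← map_mul, H_mul_Xp, map_add, map_mul, map_smul]
    · rw [← map_mul, H_mul_Xp, map_add, map_mul, map_smul]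

theorem constantCoeff_twistSl12 : MvPowerSeries.constantCoeff (twistSl12 K) = 1 := by
  rw [twistSl12_eq, constantCoeff_twistElement]

end Sl12

end
end TwistedSl12

namespace TwistedSl12

open scoped TensorProduct

noncomputable section

/-! ### Coproducts of the generators -/

section Conjugation
variable {K : Type*} [Field K] [CharZero K]
variable {A : Type*} [Ring A] [Algebra K A] [Superalgebra K A]

theorem ten_eq (a b : FPS A) :
    ten K a b = mapHom (tensorInl K A A) a * mapHom (tensorInr K A A) b := rfl

theorem commute_inl_inr_of_even_left {x : FPS A} (hx : mapHom (parity K) x = x) (y : FPS A) :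
    Commute (mapHom (tensorInl K A A) x) (mapHom (tensorInr K A A) y) := by
  refine IsParLinear.ext (K := K)
    (Φ := LinearMap.mulLeft K _ ∘ₗ mapSeries K (tensorInr K A A).toLinearMap)
    (Ψ := LinearMap.mulRight K _ ∘ₗ mapSeries K (tensorInr K A A).toLinearMap)
    ((IsParLinear.mulLeft _).comp (IsParLinear.mapSeries _))
    ((IsParLinear.mulRight _).comp (IsParLinear.mapSeries _)) (fun b => ?_) y
  rw [LinearMap.comp_apply, LinearMap.comp_apply, mapSeries_constSeries]
  exact SuperCommute.inl_inr.commute_mapHom hx b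

theorem commute_inl_inr_of_even_right (x : FPS A) {y : FPS A} (hy : mapHom (parity K) y = y) :
    Commute (mapHom (tensorInl K A A) x) (mapHom (tensorInr K A A) y) := by
  refine IsParLinear.ext (K := K)
    (Φ := LinearMap.mulRight K _ ∘ₗ mapSeries K (tensorInl K A A).toLinearMap)
    (Ψ := LinearMap.mulLeft K _ ∘ₗ mapSeries K (tensorInl K A A).toLinearMap)
    ((IsParLinear.mulRight _).comp (IsParLinear.mapSeries _))
    ((IsParLinear.mulLeft _).comp (IsParLinear.mapSeries _)) (fun b => ?_) x
  rw [LinearMap.comp_apply, LinearMap.comp_apply, mapSeries_constSeries]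
  exact (SuperCommute.inl_inr.symm.commute_mapHom hy b).symm

theorem parity_sigma {x : A} (hx : parity K x = x) :
    mapHom (parity K) (sigma K x) = sigma K x := by
  rw [map_sigma, hx]

theorem parity_tau {x : A} (hx : parity K x = x) : mapHom (parity K) (tau K x) = tau K x := by
  rw [map_tau, hx]

variable {x y z : A} {b d : FPS A}

/-- Conjugation by `exp(g τ ⊗ z)` carries `b ⊗ 1` to `b ⊗ 1 + g [τ, b] ⊗ z`. -/
theorem twistG_mul_inl (hz : parity K z = z) (hb : tau K x * b = b * tau K x + d)
    (hd : Commute (tau K x) d) :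
    twistG K (tensorInl K A A x) (tensorInr K A A z) * mapHom (tensorInl K A A) b =
      (mapHom (tensorInl K A A) b + parG _ * (mapHom (tensorInl K A A) d *
        mapHom (tensorInr K A A) (constSeries K z))) *
      twistG K (tensorInl K A A x) (tensorInr K A A z) := by
  have hz' : mapHom (parity K) (constSeries K z) = constSeries K z := by
    rw [mapHom_constSeries, hz]
  have h1 := commute_inl_inr_of_even_right b hz'
  have h2 := commute_inl_inr_of_even_right d hz'
  have h3 : mapHom (tensorInl K A A) (tau K x) * mapHom (tensorInl K A A) b =
      mapHom (tensorInl K A A) b * mapHom (tensorInl K A A) (tau K x) +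
        mapHom (tensorInl K A A) d := by
    rw [← map_mul, hb, map_add, map_mul]
  have h4 := commute_inl_inr_of_even_right (tau K x) hz'
  have h5 : Commute (mapHom (tensorInl K A A) (tau K x)) (mapHom (tensorInl K A A) d) :=
    hd.map (mapHom (tensorInl K A A))
  rw [twistG, ← map_tau, ← mapHom_constSeries]
  refine expSeries_mul_of_commutator (constantCoeff_parG_mul _) ?_ ?_
  · rw [mul_assoc, mul_assoc, ← h1.eq, ← mul_assoc (mapHom (tensorInl K A A) (tau K x)), h3,
      add_mul, mul_add, ← mul_assoc _ (parG _), ← (commute_parG _).eq]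
    simp only [mul_assoc]
  · exact (commute_parG _).mul_left ((commute_parG _).symm.mul_right
      ((h5.mul_right h4).mul_left (h2.symm.mul_right (Commute.refl _))))

/-- Conjugation by `exp(g τ ⊗ z)` carries `1 ⊗ b`, for `b` of `z`-weight `n`, to
`exp(n g τ) ⊗ b`. -/
theorem twistG_mul_inr (hx : parity K x = x) (hz : parity K z = z) {n : K}
    (hb : constSeries K z * b = b * constSeries K z + n • b) :
    twistG K (tensorInl K A A x) (tensorInr K A A z) * mapHom (tensorInr K A A) b =
      mapHom (tensorInl K A A) (expSeries K (n • (parG A * tau K x))) *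
        mapHom (tensorInr K A A) b * twistG K (tensorInl K A A x) (tensorInr K A A z) := by
  have hz' : mapHom (parity K) (constSeries K z) = constSeries K z := by
    rw [mapHom_constSeries, hz]
  have h1 := commute_inl_inr_of_even_left (parity_tau hx) b
  have h4 := commute_inl_inr_of_even_right (tau K x) hz'
  have h3 : mapHom (tensorInr K A A) (constSeries K z) * mapHom (tensorInr K A A) b =
      mapHom (tensorInr K A A) b * mapHom (tensorInr K A A) (constSeries K z) +
        n • mapHom (tensorInr K A A) b := by
    rw [← map_mul, hb, map_add, map_mul, map_smul]
  have h6 : MvPowerSeries.constantCoeff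
      (n • (parG (SuperTensor K A A) * mapHom (tensorInl K A A) (tau K x))) = 0 := by
    rw [← mul_smul_comm, constantCoeff_parG_mul]
  have h7 : Commute (expSeries K (n • (parG _ * mapHom (tensorInl K A A) (tau K x))))
      (mapHom (tensorInr K A A) b) :=
    commute_expSeries h6 (((commute_parG _).mul_left h1).smul_left _)
  rw [twistG, ← map_tau, ← mapHom_constSeries, map_expSeries, map_smul, map_mul, mapAlgHom_parG,
    h7.eq, mul_assoc, ← expSeries_add h6 (constantCoeff_parG_mul _)]
  · refine semiconj_expSeries (constantCoeff_parG_mul _) ?_ ?_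
    · rw [map_add, h6, constantCoeff_parG_mul, add_zero]
    · have hP : ∀ y, parG _ * (mapHom (tensorInr K A A) b * y) =
          mapHom (tensorInr K A A) b * (parG _ * y) := fun y => by
        rw [← mul_assoc, (commute_parG _).eq, mul_assoc]
      have hT : ∀ y, mapHom (tensorInl K A A) (tau K x) * (mapHom (tensorInr K A A) b * y) =
          mapHom (tensorInr K A A) b * (mapHom (tensorInl K A A) (tau K x) * y) := fun y => by
        rw [← mul_assoc, h1.eq, mul_assoc]
      rw [mul_assoc, mul_assoc, h3, mul_add, hT, mul_smul_comm, h1.eq, mul_add, hP, mul_smul_comm,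
        hP, mul_add, mul_smul_comm, add_comm]
  · exact ((commute_parG _).mul_left ((commute_parG _).symm.mul_right
      ((Commute.refl _).mul_right h4))).smul_left _

/-- Conjugation by `exp(-(1 / 2) y ⊗ σ)` carries `b ⊗ 1`, for `b` of `y`-weight `n`, to
`b ⊗ exp(-(n / 2) σ)`. -/
theorem twistJ_mul_inl (hx : parity K x = x) {n : K}
    (hb : constSeries K y * b = b * constSeries K y + n • b) :
    twistJ K (tensorInl K A A y) (tensorInr K A A x) * mapHom (tensorInl K A A) b =
      mapHom (tensorInl K A A) b *
        mapHom (tensorInr K A A) (expSeries K (-((2⁻¹ * n) • sigma K x))) *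
        twistJ K (tensorInl K A A y) (tensorInr K A A x) := by
  have hx' : mapHom (parity K) (constSeries K x) = constSeries K x := by
    rw [mapHom_constSeries, hx]
  rw [map_expSeries, map_neg, map_smul, map_sigma]
  refine twistJ_mul_of_weight ?_ (SuperCommute.inl_inr.even_right y ((mem_even K).2 hx)).symm ?_
  · rw [← mapHom_constSeries, ← map_mul, hb, map_add, map_mul, map_smul]
  · rw [← mapHom_constSeries]
    exact (commute_inl_inr_of_even_right b hx').symm

/-- Conjugation by `exp(-(1 / 2) y ⊗ σ)` carries `1 ⊗ b` to `1 ⊗ b - (1 / 2) y ⊗ [σ, b]`. -/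
theorem twistJ_mul_inr (hy : parity K y = y)
    (hb : sigma K x * b = b * sigma K x + d) (hd : Commute (sigma K x) d) :
    twistJ K (tensorInl K A A y) (tensorInr K A A x) * mapHom (tensorInr K A A) b =
      (mapHom (tensorInr K A A) b - (2⁻¹ : K) • (mapHom (tensorInl K A A) (constSeries K y) *
        mapHom (tensorInr K A A) d)) * twistJ K (tensorInl K A A y) (tensorInr K A A x) := by
  have hy' : mapHom (parity K) (constSeries K y) = constSeries K y := by
    rw [mapHom_constSeries, hy]
  have h1 := commute_inl_inr_of_even_left hy' b
  have h2 := commute_inl_inr_of_even_left hy' d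
  have h4 := commute_inl_inr_of_even_left hy' (sigma K x)
  have h3 : mapHom (tensorInr K A A) (sigma K x) * mapHom (tensorInr K A A) b =
      mapHom (tensorInr K A A) b * mapHom (tensorInr K A A) (sigma K x) +
        mapHom (tensorInr K A A) d := by
    rw [← map_mul, hb, map_add, map_mul]
  have h5 : Commute (mapHom (tensorInr K A A) (sigma K x)) (mapHom (tensorInr K A A) d) :=
    hd.map (mapHom (tensorInr K A A))
  rw [twistJ, ← map_sigma, ← mapHom_constSeries, sub_eq_add_neg]
  refine expSeries_mul_of_commutator ?_ ?_ ?_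
  · rw [map_sigma]
    exact constantCoeff_smul_mul_sigma _ _ _
  · rw [neg_mul, smul_mul_assoc, mul_assoc, h3, mul_add, ← mul_assoc, h1.eq, smul_add, neg_add,
      mul_assoc, mul_neg, mul_smul_comm]
  · exact ((((Commute.refl _).mul_right h2).mul_left (h4.symm.mul_right h5)).smul_left _
      |>.smul_right _).neg_left.neg_right

end Conjugation

section Sl12
variable (K : Type*) [Field K] [CharZero K]

/-- A generator, as a constant series. -/
abbrev constGen (x : GenSl12) : FPS (Usl12 K) := constSeries K (genSl12 K x)

/-- The series `σ` of `U(sl(1/2))`. -/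
abbrev sigmaXp : FPS (Usl12 K) := sigma K (genSl12 K .Xp)

/-- The series `τ` of `U(sl(1/2))`. -/
abbrev tauXp : FPS (Usl12 K) := tau K (genSl12 K .Xp)

theorem constGen_mul_of_rel {x y z : GenSl12} {c : K}
    (h : RelSl12 K (commWord K x y) (c • letter K z)) :
    constGen K x * constGen K y = constGen K y * constGen K x + c • constGen K z := by
  have := rel_eq h
  simp only [commWord, letter, map_sub, map_mul, FreeAlgebra.lift_ι_apply, map_smul] at this
  rw [← constSeries_mul, ← constSeries_mul, ← map_smul, ← map_add, add_comm]
  exact congrArg _ (sub_eq_iff_eq_add.1 this)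

theorem constGen_mul_of_rel_one {x y z : GenSl12}
    (h : RelSl12 K (commWord K x y) (letter K z)) :
    constGen K x * constGen K y = constGen K y * constGen K x + (1 : K) • constGen K z :=
  constGen_mul_of_rel K (by rwa [one_smul])

theorem constGen_mul_of_rel_neg {x y z : GenSl12}
    (h : RelSl12 K (commWord K x y) (-letter K z)) :
    constGen K x * constGen K y = constGen K y * constGen K x + (-1 : K) • constGen K z :=
  constGen_mul_of_rel K (by rwa [neg_one_smul])

theorem commute_constGen {x y : GenSl12} (h : RelSl12 K (commWord K x y) 0) :
    Commute (constGen K x) (constGen K y) :=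
  commute_constSeries (commute_of_rel K h)

theorem parity_even_gen {x : GenSl12} (hx : x.isOdd = false) :
    parity K (genSl12 K x) = genSl12 K x := by
  simp [parity_gen, hx]

theorem parity_constGen {x : GenSl12} (hx : x.isOdd = false) :
    mapHom (parity K) (constGen K x) = constGen K x := by
  rw [mapHom_constSeries, parity_even_gen K hx]

theorem commute_sigma_vp : Commute (sigmaXp K) (constGen K .vp) :=
  commute_sigma (commute_constGen K .Xp_vp)

theorem commute_tau_vp : Commute (tauXp K) (constGen K .vp) :=
  commute_tau (commute_constGen K .Xp_vp)

theorem commute_tau_wp : Commute (tauXp K) (constGen K .wp) :=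
  commute_tau (commute_constGen K .Xp_wp)

theorem commute_sigma_Z : Commute (sigmaXp K) (constGen K .Z) :=
  commute_sigma (commute_constGen K .Z_Xp).symm

theorem commute_tau_Z : Commute (tauXp K) (constGen K .Z) :=
  commute_tau (commute_constGen K .Z_Xp).symm

theorem commute_tau_sigma : Commute (tauXp K) (sigmaXp K) :=
  commute_tau (commute_sigma (Commute.refl _)).symm

theorem commute_tau_expSigma : Commute (tauXp K) (expSeries K (sigmaXp K)) :=
  (commute_expSeries (constantCoeff_sigma _) (commute_tau_sigma K).symm).symm

theorem sigma_mul_vm : sigmaXp K * constGen K .vm = constGen K .vm * sigmaXp K +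
    -(2 * parH _ * (constGen K .vp * expSeries K (sigmaXp K))) := by
  have h := constGen_mul_of_rel_neg K .Xp_vm
  rw [neg_one_smul] at h
  rw [sigma_mul_of_commutator h (commute_constGen K .Xp_vp).neg_right, neg_mul, mul_neg]

theorem tau_mul_vm : tauXp K * constGen K .vm = constGen K .vm * tauXp K +
    -(constGen K .vp * expSeries K (sigmaXp K)) := by
  have h := constGen_mul_of_rel_neg K .Xp_vm
  rw [neg_one_smul] at h
  rw [tau_mul_of_commutator h (commute_constGen K .Xp_vp).neg_right, neg_mul]

theorem tau_mul_H : tauXp K * constGen K .H = constGen K .H * tauXp K +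
    -(2 * (constGen K .Xp * expSeries K (sigmaXp K))) := by
  have h : constGen K .Xp * constGen K .H =
      constGen K .H * constGen K .Xp + -(2 * constGen K .Xp) := by
    rw [constGen_mul_of_rel K .H_Xp, two_smul, two_mul]
    abel
  rw [tau_mul_of_commutator h ((Commute.ofNat_right _ 2).mul_right (Commute.refl _)).neg_right,
    neg_mul, mul_assoc]

theorem commute_expSigma_vp : Commute (expSeries K (sigmaXp K)) (constGen K .vp) :=
  commute_expSeries (constantCoeff_sigma _) (commute_sigma_vp K)

theorem isUnit_twistSl12 : IsUnit (twistSl12 K) := (isTwist_twistSl12 K).isUnit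

theorem twistedComul_sl12_eq {x : FPS (Usl12 K)} {D : FPS (SuperTensor K (Usl12 K) (Usl12 K))}
    (h : twistSl12 K * mapHom (comul₀ K) x = D * twistSl12 K) :
    twistedComul (comul₀ K).toLinearMap (twistSl12 K) x = D := by
  rw [IsCocommutativeHopf.twistedComul_apply, h, mul_assoc,
    Ring.mul_inverse_cancel _ (isUnit_twistSl12 K), mul_one]

theorem mapHom_comul₀_constGen (x : GenSl12) : mapHom (comul₀ K) (constGen K x) =
    mapHom (tensorInl K _ _) (constGen K x) + mapHom (tensorInr K _ _) (constGen K x) := by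
  rw [mapHom_constSeries, comul₀_gen, map_add, mapHom_constSeries, mapHom_constSeries]

theorem twistSl12_eq_mul : twistSl12 K =
    twistG K (tensorInl K _ _ (genSl12 K .Xp)) (tensorInr K _ _ (genSl12 K .Z)) *
      twistJ K (tensorInl K _ _ (genSl12 K .H)) (tensorInr K _ _ (genSl12 K .Xp)) := by
  rw [twistSl12_eq, twistElement_eq]

/-- The coproduct of the odd vectors that commute with `X₊`. -/
theorem twistedComul_highest {v : GenSl12} {n : K} (hX : Commute (constGen K .Xp) (constGen K v))
    (hH : constGen K .H * constGen K v = constGen K v * constGen K .H + (1 : K) • constGen K v)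
    (hZ : constGen K .Z * constGen K v = constGen K v * constGen K .Z + n • constGen K v) :
    twistedComul (comul₀ K).toLinearMap (twistSl12 K) (constGen K v) =
      ten K (constGen K v) (expSeries K (-((2⁻¹ : K) • sigmaXp K))) +
        ten K (expSeries K (n • (parG _ * tauXp K))) (constGen K v) := by
  refine twistedComul_sl12_eq K ?_
  have pX := parity_even_gen K (x := .Xp) rfl
  have pZ := parity_even_gen K (x := .Z) rfl
  have pH := parity_even_gen K (x := .H) rfl
  have j1 := twistJ_mul_inl pX hH
  have j2 := twistJ_mul_inr (y := genSl12 K .H) (d := 0) pH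
    ((commute_sigma hX).eq.trans (add_zero _).symm) (Commute.zero_right _)
  have g1 := twistG_mul_inl (d := 0) pZ ((commute_tau hX).eq.trans (add_zero _).symm)
    (Commute.zero_right _)
  have g2 := twistG_mul_inr pX pZ hZ
  have g3 := twistG_mul_inr (n := 0) (b := expSeries K (-((2⁻¹ : K) • sigmaXp K))) pX pZ (by
    have h : Commute (expSeries K (-((2⁻¹ : K) • sigmaXp K))) (constGen K .Z) :=
      commute_expSeries (by simpa using constantCoeff_smul_mul_sigma (2⁻¹ : K) 1 (genSl12 K .Xp))
        ((commute_sigma_Z K).smul_left _).neg_left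
    rw [← h.eq, zero_smul, add_zero])
  rw [map_zero, mul_zero, smul_zero, sub_zero] at j2
  rw [map_zero, zero_mul, mul_zero, add_zero] at g1
  rw [mul_one] at j1
  rw [zero_smul, expSeries_zero, map_one, one_mul] at g3
  rw [twistSl12_eq_mul, mapHom_comul₀_constGen, ten, ten, mapSeries_toLinearMap,
    mapSeries_toLinearMap, mapSeries_toLinearMap, mapSeries_toLinearMap, mul_add, mul_assoc, j1,
    mul_assoc _ _ (mapHom _ (constGen K v)), j2, add_mul, ← mul_assoc, ← mul_assoc, g1,
    mul_assoc _ _ (mapHom _ (expSeries K _)), g3, ← mul_assoc, ← mul_assoc, g2]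
  simp only [mul_assoc]

/-- The conjugate of `h y` under `G`, from that of `y`; here `y = H ⊗ 1`, `a = X₊ exp σ ⊗ 1`,
`e = (exp σ - 1) ⊗ 1` and `z = 1 ⊗ Z`, while `h` and `p` are the parameters. -/
theorem mul_scalar_mul_of_conj {Q : Type*} [Ring Q] {h p G y a e z : Q} (hG : Commute h G)
    (hp : Commute h p) (he : e = 2 * h * a) (hy : G * y = (y + p * (-(2 * a) * z)) * G) :
    G * (h * y) = (h * y - p * (e * z)) * G := by
  have h2 : p * (e * z) = h * (p * (2 * a * z)) := by
    rw [he, ← mul_assoc h p, hp.eq, mul_assoc p, ← mul_assoc h, ← mul_assoc h,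
      (Commute.ofNat_right h 2).eq]
  rw [← mul_assoc, ← hG.eq, mul_assoc, hy, h2, neg_mul, mul_neg, ← sub_eq_add_neg, ← mul_sub]
  simp only [mul_assoc]

/-- Conjugation of `v + v'` by `GJ`, from the conjugates under the two factors. -/
theorem mul_mul_add_of_conj {Q : Type*} [Ring Q] {E z v p w s G J v' h y e w' : Q}
    (hE : Commute E z) (j1 : J * v = v * s * J) (j2 : J * v' = (v' + h * y * w') * J)
    (g1 : G * v = (v - p * (w * z)) * G) (g2 : G * v' = E * v' * G) (g3 : G * s = s * G)
    (g4 : G * (h * y) = (h * y - p * (e * z)) * G) (g5 : G * w' = E * w' * G) :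
    G * J * (v + v') =
      (v * s + E * v' + h * (y * E * w') - p * (w * (z * s)) - p * (e * E * (z * w'))) *
        (G * J) := by
  have h1 : ∀ x, z * (E * x) = E * (z * x) := fun x => by
    rw [← mul_assoc, ← hE.eq, mul_assoc]
  calc G * J * (v + v') = G * v * s * J + (G * v' * J + G * (h * y) * w' * J) := by
        rw [mul_add, mul_assoc, mul_assoc, j1, j2]
        simp only [add_mul, mul_add, mul_assoc]
    _ = (v - p * (w * z)) * (G * s) * J + (E * v' * G * J +
          (h * y - p * (e * z)) * (G * w') * J) := by
        rw [g1, g2, g4]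
        simp only [mul_assoc]
    _ = _ := by
        rw [g3, g5]
        simp only [sub_mul, add_mul, mul_assoc, h1]
        abel

theorem twistedComul_vm :
    twistedComul (comul₀ K).toLinearMap (twistSl12 K) (constGen K .vm) =
      ten K (constGen K .vm) (expSeries K ((2⁻¹ : K) • sigmaXp K)) +
      ten K (expSeries K (parG _ * tauXp K)) (constGen K .vm) +
      parH _ * ten K (constGen K .H * expSeries K (parG _ * tauXp K))
        (constGen K .vp * expSeries K (sigmaXp K)) -
      parG _ * ten K (constGen K .vp * expSeries K (sigmaXp K))
        (constGen K .Z * expSeries K ((2⁻¹ : K) • sigmaXp K)) -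
      parG _ * ten K ((expSeries K (sigmaXp K) - 1) * expSeries K (parG _ * tauXp K))
        (constGen K .Z * constGen K .vp * expSeries K (sigmaXp K)) := by
  refine twistedComul_sl12_eq K ?_
  have pX := parity_even_gen K (x := .Xp) rfl
  have pZ := parity_even_gen K (x := .Z) rfl
  have pH := parity_even_gen K (x := .H) rfl
  have cs : Commute (sigmaXp K) (constGen K .vp * expSeries K (sigmaXp K)) :=
    (commute_sigma_vp K).mul_right
      (commute_expSeries (constantCoeff_sigma _) (Commute.refl _)).symm
  have j1 := twistJ_mul_inl (n := (-1 : K)) pX (constGen_mul_of_rel_neg K .H_vm)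
  have j2 := twistJ_mul_inr (y := genSl12 K .H) pH (sigma_mul_vm K)
    (((Commute.ofNat_right _ 2).mul_right (commute_parH _).symm).mul_right cs).neg_right
  have g1 := twistG_mul_inl pZ (tau_mul_vm K)
    ((commute_tau_vp K).mul_right (commute_tau_expSigma K)).neg_right
  have g2 := twistG_mul_inr (n := (1 : K)) pX pZ (constGen_mul_of_rel_one K .Z_vm)
  have g3 := twistG_mul_inr (n := 0) (b := expSeries K ((2⁻¹ : K) • sigmaXp K)) pX pZ (by
    have h : Commute (expSeries K ((2⁻¹ : K) • sigmaXp K)) (constGen K .Z) :=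
      commute_expSeries (by simpa using constantCoeff_smul_mul_sigma (2⁻¹ : K) 1 (genSl12 K .Xp))
        ((commute_sigma_Z K).smul_left _)
    rw [← h.eq, zero_smul, add_zero])
  have g4 := twistG_mul_inl pZ (tau_mul_H K) ((Commute.ofNat_right _ 2).mul_right
    ((commute_tau (Commute.refl _)).mul_right (commute_tau_expSigma K))).neg_right
  have g5 := twistG_mul_inr (n := (1 : K)) (b := constGen K .vp * expSeries K (sigmaXp K)) pX pZ (by
    have h : Commute (expSeries K (sigmaXp K)) (constGen K .Z) :=
      commute_expSeries (constantCoeff_sigma _) (commute_sigma_Z K)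
    rw [← mul_assoc, constGen_mul_of_rel_one K .Z_vp, add_mul, mul_assoc, ← h.eq, mul_assoc,
      smul_mul_assoc])
  rw [zero_smul, expSeries_zero, map_one, one_mul] at g3
  rw [one_smul] at g2 g5
  rw [mul_neg_one, neg_smul, neg_neg] at j1
  have j2' : twistJ K (tensorInl K _ _ (genSl12 K .H)) (tensorInr K _ _ (genSl12 K .Xp)) *
        mapHom (tensorInr K _ _) (constGen K .vm) =
      (mapHom (tensorInr K _ _) (constGen K .vm) + parH _ *
        mapHom (tensorInl K _ _) (constGen K .H) * mapHom (tensorInr K _ _)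
          (constGen K .vp * expSeries K (sigmaXp K))) *
      twistJ K (tensorInl K _ _ (genSl12 K .H)) (tensorInr K _ _ (genSl12 K .Xp)) := by
    rw [j2, map_neg, map_mul (mapHom _) (2 * parH (Usl12 K)), map_mul (mapHom _) 2,
      mapAlgHom_parH, mul_neg, smul_neg, sub_neg_eq_add, map_ofNat,
      mul_assoc (2 : FPS (SuperTensor K (Usl12 K) (Usl12 K))),
      show (2 : FPS (SuperTensor K (Usl12 K) (Usl12 K))) = (2 : K) • 1 from
        (by rw [two_smul, one_add_one_eq_two]), smul_mul_assoc, one_mul, mul_smul_comm, smul_smul,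
      inv_mul_cancel₀ (two_ne_zero (α := K)), one_smul, ← mul_assoc, ← (commute_parH _).eq]
  have e1 : mapHom (tensorInl K (Usl12 K) (Usl12 K)) (expSeries K (sigmaXp K) - 1) =
      2 * parH _ * (mapHom (tensorInl K (Usl12 K) (Usl12 K))
        (constGen K .Xp * expSeries K (sigmaXp K))) := by
    rw [expSeries_sigma_sub_one, map_mul, map_mul (mapHom _) 2, mapAlgHom_parH, map_ofNat]
  have e2 : mapHom (tensorInl K (Usl12 K) (Usl12 K))
      (-(2 * (constGen K .Xp * expSeries K (sigmaXp K)))) =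
      -(2 * mapHom (tensorInl K (Usl12 K) (Usl12 K))
        (constGen K .Xp * expSeries K (sigmaXp K))) := by
    rw [map_neg, map_mul (mapHom _) 2, map_ofNat]
  rw [e2] at g4
  have g4' := mul_scalar_mul_of_conj (commute_parH _) (commute_parH _) e1 g4
  rw [map_neg, neg_mul, mul_neg, ← sub_eq_add_neg] at g1
  rw [twistSl12_eq_mul, mapHom_comul₀_constGen, ten_eq, ten_eq, ten_eq, ten_eq, ten_eq,
    mul_assoc (constGen K .Z)]
  simp only [map_mul (mapHom (tensorInl K (Usl12 K) (Usl12 K))) (constGen K .H),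
    map_mul (mapHom (tensorInr K (Usl12 K) (Usl12 K))) (constGen K .Z),
    map_mul (mapHom (tensorInl K (Usl12 K) (Usl12 K))) (expSeries K (sigmaXp K) - 1)]
  exact mul_mul_add_of_conj (commute_inl_inr_of_even_right _ (parity_constGen K rfl))
    j1 j2' g1 g2 g3 g4' g5

end Sl12

end
end TwistedSl12

namespace TwistedSl12

open scoped TensorProduct

noncomputable section

/-! ### Antipodes of the generators -/

section Antipode
variable {K : Type*} [Field K] [CharZero K]
variable {A : Type*} [Ring A] [Algebra K A] [Superalgebra K A]

/-- `m(p ⊗ q)(a ⊗ b) = p(a) q(b)` for series `a` and `b`. -/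
theorem mulTensor_ten {p q : FPS A →ₗ[K] FPS A} (hp : IsParLinear p) (hq : IsParLinear q)
    (a b : FPS A) : mulTensor K p q (ten K a b) = p a * q b := by
  refine IsParLinear.ext (K := K) (Φ := mulTensor K p q ∘ₗ
      LinearMap.mulRight K (mapHom (tensorInr K A A) b) ∘ₗ
      mapSeries K (tensorInl K A A).toLinearMap)
    (Ψ := LinearMap.mulRight K (q b) ∘ₗ p)
    ((isParLinear_mulTensor _ _).comp ((IsParLinear.mulRight _).comp (IsParLinear.mapSeries _)))
    ((IsParLinear.mulRight _).comp hp) (fun a => ?_) a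
  refine IsParLinear.ext (K := K) (Φ := mulTensor K p q ∘ₗ
      LinearMap.mulLeft K (mapHom (tensorInl K A A) (constSeries K a)) ∘ₗ
      mapSeries K (tensorInr K A A).toLinearMap)
    (Ψ := LinearMap.mulLeft K (p (constSeries K a)) ∘ₗ q)
    ((isParLinear_mulTensor _ _).comp ((IsParLinear.mulLeft _).comp (IsParLinear.mapSeries _)))
    ((IsParLinear.mulLeft _).comp hq) (fun b => ?_) b
  rw [LinearMap.comp_apply, LinearMap.comp_apply, LinearMap.mulLeft_apply, mapHom_constSeries,
    mapSeries_constSeries, AlgHom.toLinearMap_apply, ← constSeries_mul, mulTensor_const]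
  rfl

theorem eq_mul_of_mul_eq {Q : Type*} [Ring Q] {a a' y z : Q} (ha : a' * a = 1) (h : a * y = z) :
    y = a' * z := by
  rw [← h, ← mul_assoc, ha, one_mul]

theorem scalar_one : scalar K (1 : FPS K) = (1 : FPS A) :=
  map_one (mapHom (Algebra.ofId K A))

namespace IsCocommutativeHopf
variable {Δ₀ : A →ₐ[K] SuperTensor K A A} {ε₀ : A →ₐ[K] K} {S₀ : A →ₗ[K] A}
variable (H : IsCocommutativeHopf Δ₀ ε₀ S₀)
include H

theorem antipode_mul_of_even (a : A) {b : A} (hb : b ∈ homogeneous K A 0) :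
    S₀ (a * b) = S₀ b * S₀ a := by
  obtain ⟨a₀, ha₀, a₁, ha₁, rfl⟩ := exists_even_add_odd K a
  have h0 := H.antipode_mul ha₀ hb
  have h1 := H.antipode_mul ha₁ hb
  rw [zero_mul, uzpow_zero, one_smul] at h0 h1
  rw [add_mul, map_add, h0, h1, map_add, mul_add]

theorem mapSeries_antipode_mul (x : FPS A) {y : FPS A} (hy : mapHom (parity K) y = y) :
    mapSeries K S₀ (x * y) = mapSeries K S₀ y * mapSeries K S₀ x := by
  classical
  ext n
  change S₀ (MvPowerSeries.coeff n (x * y)) = _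
  rw [MvPowerSeries.coeff_mul, MvPowerSeries.coeff_mul, map_sum]
  refine (Finsupp.sum_antidiagonal_swap n fun a b =>
    S₀ (MvPowerSeries.coeff a x * MvPowerSeries.coeff b y)).trans ?_
  refine Finset.sum_congr rfl fun p _ => ?_
  exact H.antipode_mul_of_even _ ((mem_even K).2 (congrArg (MvPowerSeries.coeff p.1) hy))

theorem twistedAntipode_mul {F : FPS (SuperTensor K A A)}
    (hF1 : MvPowerSeries.constantCoeff F = 1) (x : FPS A) {y : FPS A}
    (hy : mapHom (parity K) y = y) :
    twistedAntipode S₀ F (x * y) = twistedAntipode S₀ F y * twistedAntipode S₀ F x := by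
  simp only [twistedAntipode_eq, LinearMap.comp_apply, conjBy_apply]
  rw [H.mapSeries_antipode_mul x hy]
  simp only [mul_assoc]
  rw [← mul_assoc (Ring.inverse _) (mulRightAntipode S₀ F),
    Ring.inverse_mul_cancel _ (H.isUnit_mulRightAntipode hF1), one_mul]

end IsCocommutativeHopf
end Antipode

section Sl12
variable (K : Type*) [Field K] [CharZero K]

/-- The antipode of the twisted `U(sl(1/2))`. -/
abbrev antipodeSl12 : FPS (Usl12 K) →ₗ[K] FPS (Usl12 K) :=
  twistedAntipode (antipode₀ K) (twistSl12 K)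

theorem isTriangular_sl12 :
    IsTriangularHopfSuperalgebra (twistedComul (comul₀ K).toLinearMap (twistSl12 K))
      (mapSeries K (counit₀ K).toLinearMap) (antipodeSl12 K) (twistedR (twistSl12 K)) :=
  (isCocommutativeHopf_sl12 K).isTriangular_twisted (isTwist_twistSl12 K)
    (constantCoeff_twistSl12 K)

theorem mulTensor_antipode_ten (a b : FPS (Usl12 K)) :
    mulTensor K LinearMap.id (antipodeSl12 K) (ten K a b) = a * antipodeSl12 K b :=
  mulTensor_ten IsParLinear.id IsCocommutativeHopf.isParLinear_twistedAntipode a b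

theorem antipode_mul_sl12 (x : FPS (Usl12 K)) {y : FPS (Usl12 K)}
    (hy : mapHom (parity K) y = y) :
    antipodeSl12 K (x * y) = antipodeSl12 K y * antipodeSl12 K x :=
  (isCocommutativeHopf_sl12 K).twistedAntipode_mul (constantCoeff_twistSl12 K) x hy

theorem counit_constGen (x : GenSl12) :
    mapSeries K (counit₀ K).toLinearMap (constGen K x) = 0 := by
  rw [mapSeries_constSeries, AlgHom.toLinearMap_apply, counit₀_gen, map_zero]

theorem antipode_right_constGen (x : GenSl12) :
    mulTensor K LinearMap.id (antipodeSl12 K)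
      (twistedComul (comul₀ K).toLinearMap (twistSl12 K) (constGen K x)) = 0 := by
  rw [(isTriangular_sl12 K).antipode_right, counit_constGen]
  exact map_zero (mapSeries K (Algebra.linearMap K _))

theorem constantCoeff_smul_sigma (c : K) :
    MvPowerSeries.constantCoeff (c • sigmaXp K) = 0 := by
  simpa using constantCoeff_smul_mul_sigma c 1 (genSl12 K .Xp)

theorem constantCoeff_parG_tau : MvPowerSeries.constantCoeff (parG _ * tauXp K) = 0 :=
  constantCoeff_parG_mul _

theorem commute_inl_twistG_Z (b : FPS (Usl12 K)) (hb : Commute (tauXp K) b) :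
    Commute (mapHom (tensorInl K _ _) b)
      (twistG K (tensorInl K _ _ (genSl12 K .Xp)) (tensorInr K _ _ (genSl12 K .Z))) := by
  have h := twistG_mul_inl (d := 0) (parity_even_gen K (x := .Z) rfl)
    (hb.eq.trans (add_zero _).symm) (Commute.zero_right _)
  rw [map_zero, zero_mul, mul_zero, add_zero] at h
  exact h.symm

theorem commute_inr_twistG_Z (b : FPS (Usl12 K)) (hb : Commute (constGen K .Z) b) :
    Commute (mapHom (tensorInr K _ _) b)
      (twistG K (tensorInl K _ _ (genSl12 K .Xp)) (tensorInr K _ _ (genSl12 K .Z))) := by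
  have h := twistG_mul_inr (n := 0) (parity_even_gen K (x := .Xp) rfl)
    (parity_even_gen K (x := .Z) rfl) (b := b) (by rw [hb.eq, zero_smul, add_zero])
  rw [zero_smul, expSeries_zero, map_one, one_mul] at h
  exact h.symm

/-- `exp(c σ)` is group-like. -/
theorem twistedComul_expSigma (c : K) :
    twistedComul (comul₀ K).toLinearMap (twistSl12 K) (expSeries K (c • sigmaXp K)) =
      ten K (expSeries K (c • sigmaXp K)) (expSeries K (c • sigmaXp K)) := by
  refine twistedComul_sl12_eq K ?_
  have eX : genSl12 K .Xp ∈ homogeneous K (Usl12 K) 0 := gen_mem K .Xp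
  have h1 := twistJ_mul_sigma_add (K := K) (y := tensorInl K _ _ (genSl12 K .H))
    (x := tensorInl K _ _ (genSl12 K .Xp)) (x' := tensorInr K _ _ (genSl12 K .Xp))
    (by rw [← map_mul, H_mul_Xp, map_add, map_mul, map_smul])
    (SuperCommute.inl_inr.even_right _ eX).symm (SuperCommute.inl_inr.even_right _ eX).symm
  have h2 := commute_inl_twistG_Z K (sigmaXp K) (commute_tau_sigma K)
  have h3 := commute_inr_twistG_Z K (sigmaXp K) (commute_sigma_Z K).symm
  have hc : Commute (mapHom (tensorInl K _ _) (c • sigmaXp K))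
      (mapHom (tensorInr K _ _) (c • sigmaXp K)) :=
    commute_inl_inr_of_even_right _
      (by rw [map_smul, parity_sigma (parity_even_gen K (x := .Xp) rfl)])
  have c0 : ∀ f : Usl12 K →ₐ[K] SuperTensor K (Usl12 K) (Usl12 K),
      MvPowerSeries.constantCoeff (mapHom f (c • sigmaXp K)) = 0 := fun f => by
    rw [map_smul, map_sigma]
    simpa using constantCoeff_smul_mul_sigma c 1 (f (genSl12 K .Xp))
  rw [ten_eq, map_expSeries, map_expSeries, map_expSeries, ← expSeries_add (c0 _) (c0 _) hc]
  refine (semiconj_expSeries (by rw [map_add, c0, c0, add_zero]) (c0 _) ?_).symm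
  rw [map_smul, map_smul, map_smul, ← smul_add, smul_mul_assoc, mul_smul_comm, map_sigma (comul₀ K),
    comul₀_gen, twistSl12_eq_mul, mul_assoc, h1, ← mul_assoc, ← mul_assoc, ← map_sigma, ← map_sigma,
    (h2.add_left h3).eq]

theorem antipode_expSigma (c : K) :
    antipodeSl12 K (expSeries K (c • sigmaXp K)) = expSeries K (-(c • sigmaXp K)) := by
  have h := (isTriangular_sl12 K).antipode_right (expSeries K (c • sigmaXp K))
  rw [twistedComul_expSigma, mulTensor_antipode_ten, mapSeries_toLinearMap, map_expSeries, map_smul,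
    map_sigma, counit₀_gen, sigma_zero, smul_zero, expSeries_zero, scalar_one] at h
  rw [eq_mul_of_mul_eq (expSeries_neg_mul (constantCoeff_smul_sigma K c)) h, mul_one]

theorem antipodeSl12_one : antipodeSl12 K 1 = 1 := by
  have h := antipode_expSigma K 0
  rwa [zero_smul, neg_zero, expSeries_zero] at h

theorem twistedComul_Z : twistedComul (comul₀ K).toLinearMap (twistSl12 K) (constGen K .Z) =
    ten K (constGen K .Z) 1 + ten K 1 (constGen K .Z) := by
  refine twistedComul_sl12_eq K ?_
  have j1 := twistJ_mul_inl (x := genSl12 K .Xp) (y := genSl12 K .H) (b := constGen K .Z) (n := 0)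
    (parity_even_gen K rfl) (by rw [← (commute_constGen K .Z_H).eq, zero_smul, add_zero])
  have j2 := twistJ_mul_inr (y := genSl12 K .H) (x := genSl12 K .Xp) (d := 0)
    (parity_even_gen K rfl) ((commute_sigma_Z K).eq.trans (add_zero _).symm) (Commute.zero_right _)
  rw [mul_zero, zero_smul, neg_zero, expSeries_zero, map_one, mul_one] at j1
  rw [map_zero, mul_zero, smul_zero, sub_zero] at j2
  have h2 := commute_inl_twistG_Z K (constGen K .Z) (commute_tau_Z K)
  have h3 := commute_inr_twistG_Z K (constGen K .Z) (Commute.refl _)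
  rw [ten_eq, ten_eq, map_one, map_one, one_mul, mul_one, twistSl12_eq_mul, mapHom_comul₀_constGen,
    mul_assoc, mul_add, j1, j2, ← add_mul, ← mul_assoc, ← (h2.add_left h3).eq, mul_assoc]

theorem antipode_Z : antipodeSl12 K (constGen K .Z) = -constGen K .Z := by
  have h := antipode_right_constGen K .Z
  rw [twistedComul_Z, map_add, mulTensor_antipode_ten, mulTensor_antipode_ten, antipodeSl12_one,
    mul_one, one_mul] at h
  exact eq_neg_of_add_eq_zero_right h

/-- The antipode of the odd vectors that commute with `X₊`. -/
theorem antipode_highest {v : GenSl12} {n : K} (hX : Commute (constGen K .Xp) (constGen K v))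
    (hH : constGen K .H * constGen K v = constGen K v * constGen K .H + (1 : K) • constGen K v)
    (hZ : constGen K .Z * constGen K v = constGen K v * constGen K .Z + n • constGen K v) :
    antipodeSl12 K (constGen K v) = -(expSeries K (-(n • (parG _ * tauXp K))) * constGen K v *
      expSeries K ((2⁻¹ : K) • sigmaXp K)) := by
  have h := antipode_right_constGen K v
  have hn : MvPowerSeries.constantCoeff (n • (parG _ * tauXp K)) = 0 := by
    rw [← mul_smul_comm, constantCoeff_parG_mul]
  rw [twistedComul_highest K hX hH hZ, map_add, mulTensor_antipode_ten, mulTensor_antipode_ten,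
    ← neg_smul, antipode_expSigma, neg_smul, neg_neg] at h
  rw [eq_mul_of_mul_eq (expSeries_neg_mul hn) (eq_neg_of_add_eq_zero_right h), mul_neg, mul_assoc]

theorem antipode_wp : antipodeSl12 K (constGen K .wp) =
    -(constGen K .wp * expSeries K ((2⁻¹ : K) • sigmaXp K + parG _ * tauXp K)) := by
  have hc : Commute ((2⁻¹ : K) • sigmaXp K) (parG _ * tauXp K) :=
    ((commute_parG _).symm.mul_right (commute_tau_sigma K).symm).smul_left _
  have hw : Commute (expSeries K (parG _ * tauXp K)) (constGen K .wp) :=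
    commute_expSeries (constantCoeff_parG_tau K) ((commute_parG _).mul_left (commute_tau_wp K))
  have hs : Commute (expSeries K ((2⁻¹ : K) • sigmaXp K)) (expSeries K (parG _ * tauXp K)) :=
    commute_expSeries (constantCoeff_smul_sigma K _)
      (commute_expSeries (constantCoeff_parG_tau K) hc.symm).symm
  rw [antipode_highest K (commute_constGen K .Xp_wp) (constGen_mul_of_rel_one K .H_wp)
    (constGen_mul_of_rel_neg K .Z_wp), neg_smul, neg_neg, one_smul, hw.eq, mul_assoc, ← hs.eq,
    expSeries_add (constantCoeff_smul_sigma K _) (constantCoeff_parG_tau K) hc]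

theorem Commute.of_inverse_left {Q : Type*} [Ring Q] {a a' b : Q} (h : a' * a = 1) (h' : a * a' = 1)
    (hb : Commute a' b) : Commute a b :=
  show a * b = b * a by
    rw [← mul_one (a * b), ← h, ← mul_assoc, mul_assoc a, ← hb.eq, ← mul_assoc a, h', one_mul]

/-- The value `y` of the antipode at `v₋`, from the equation given by the coproduct of `v₋`; here
`E`, `E'`, `e`, `s`, `s'` stand for `exp(gτ)`, `exp(-gτ)`, `exp σ`, `exp(σ/2)`, `exp(-σ/2)`. -/
theorem eq_of_antipode_relation {Q : Type*} [Ring Q] {E E' e s s' v w Z H h g y : Q}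
    (hE : E' * E = 1) (hE' : E * E' = 1) (hs : s' * s = 1) (hs' : s * s' = 1)
    (hg : ∀ x, Commute g x) (he : e = s * s) (hEs : Commute E' s')
    (hEv : Commute E' v) (hEZ : Commute E' Z) (hsv : Commute s' v) (hsZ : Commute s' Z)
    (hev : Commute e v) (hZv : Z * v = v * Z + v)
    (hEw : E' * w = (w + g * (v * e)) * E')
    (hEH : E' * (h * H) = (h * H + g * (e - 1)) * E')
    (hy : w * s' + E * y + h * (H * E * (s' * s' * -(E' * v * s))) -
      g * (v * e * (s' * -Z)) -
      g * ((e - 1) * E * (s' * s' * ((1 - Z) * -(E' * v * s)))) = 0) :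
    y = -((w - h * H * v + g * v * (1 + Z)) * (s' * E')) := by
  have hEs0 : Commute E s' := Commute.of_inverse_left hE hE' hEs
  have hEZ0 : Commute E Z := Commute.of_inverse_left hE hE' hEZ
  have hsZ0 : Commute s Z := Commute.of_inverse_left hs hs' hsZ
  have hsv0 : Commute s v := Commute.of_inverse_left hs hs' hsv
  have hes : e * s' = s := by rw [he, mul_assoc, hs', mul_one]
  have h1 : H * E * (s' * s' * -(E' * v * s)) = -(H * v * s') := by
    have : E * (s' * s') = s' * s' * E := (hEs0.mul_right hEs0).eq
    rw [mul_assoc H, ← mul_assoc E, this, mul_neg, mul_neg, mul_assoc (s' * s'), mul_assoc E',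
      ← mul_assoc E, hE', one_mul, ← mul_assoc (s' * s'), (hsv.mul_left hsv).eq]
    simp only [mul_assoc, hs, mul_one]
  have h2 : v * e * (s' * -Z) = -(v * Z * s) := by
    rw [mul_assoc, ← mul_assoc e, hes, mul_neg, mul_neg, hsZ0.eq, mul_assoc]
  have h3 : (e - 1) * E * (s' * s' * ((1 - Z) * -(E' * v * s))) = v * Z * (s - s') := by
    have hc : E * (s' * s' * (1 - Z)) = s' * s' * (1 - Z) * E :=
      ((hEs0.mul_right hEs0).mul_right ((Commute.one_right _).sub_right hEZ0)).eq
    have hv : (1 - Z) * v = -(v * Z) := by rw [sub_mul, one_mul, hZv]; abel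
    have hvZ : s' * s' * (v * Z) = v * Z * (s' * s') :=
      ((hsv.mul_left hsv).mul_right (hsZ.mul_left hsZ)).eq
    have hee : e * (v * Z) = v * Z * e := by
      have : Commute e Z := by rw [he]; exact hsZ0.mul_left hsZ0
      exact (hev.mul_right this).eq
    calc (e - 1) * E * (s' * s' * ((1 - Z) * -(E' * v * s)))
        = -((e - 1) * (E * (s' * s' * (1 - Z))) * (E' * (v * s))) := by
          simp only [mul_neg, mul_assoc]
      _ = -((e - 1) * (s' * s') * ((1 - Z) * ((E * E') * v)) * s) := by
          rw [hc]; simp only [mul_assoc]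
      _ = (e - 1) * (s' * s' * (v * Z)) * s := by
          rw [hE', one_mul, hv]; simp only [mul_assoc, mul_neg, neg_mul, neg_neg]
      _ = v * Z * ((e * s' - s') * (s' * s)) := by
          rw [hvZ, ← mul_assoc (e - 1), sub_mul e 1, one_mul, hee]
          simp only [sub_mul, mul_sub, mul_assoc]
      _ = _ := by rw [hes, hs, mul_one]
  rw [h1, h2, h3] at hy
  have h4 : E * y = -((w - h * H * v + g * v * Z) * s') := by
    refine eq_neg_of_add_eq_zero_left (Eq.trans ?_ hy)
    simp only [mul_sub, mul_neg, add_mul, sub_mul, mul_assoc]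
    abel
  have h5 : E' * (w - h * H * v + g * v * Z) = (w - h * H * v + g * v * (1 + Z)) * E' := by
    have a1 : E' * (g * v * Z) = g * v * Z * E' :=
      (((hg E').symm.mul_right hEv).mul_right hEZ).eq
    rw [mul_add, mul_sub, a1, ← mul_assoc E' (h * H), hEH, hEw, mul_assoc _ E', hEv.eq, ← mul_assoc,
      add_mul (h * H), mul_assoc g (e - 1), sub_mul e, one_mul, ← mul_assoc e v, hev.eq]
    simp only [mul_add, add_mul, sub_mul, mul_sub, mul_one, mul_assoc]
    abel
  rw [eq_mul_of_mul_eq hE h4, mul_neg, ← mul_assoc, h5, mul_assoc, hEs.eq]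

/-- The antipode of `v₋`: apply `m(id ⊗ S)` to the coproduct of `v₋` and solve for `S(v₋)`, the
values of `S` on `Z`, `v₊` and `exp(c σ)` being known. -/
theorem antipode_vm : antipodeSl12 K (constGen K .vm) =
    -((constGen K .vm - parH _ * constGen K .H * constGen K .vp +
      parG _ * constGen K .vp * (1 + constGen K .Z)) *
      expSeries K (-((2⁻¹ : K) • sigmaXp K + parG _ * tauXp K))) := by
  have pX := parity_even_gen K (x := .Xp) rfl
  have hgt := constantCoeff_parG_tau K
  have hhs := constantCoeff_smul_sigma K (2⁻¹ : K)
  have hgt' : MvPowerSeries.constantCoeff (-(parG _ * tauXp K)) = 0 := by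
    rw [map_neg, hgt, neg_zero]
  have hhs' : MvPowerSeries.constantCoeff (-((2⁻¹ : K) • sigmaXp K)) = 0 := by
    rw [map_neg, hhs, neg_zero]
  have hc : Commute ((2⁻¹ : K) • sigmaXp K) (parG _ * tauXp K) :=
    ((commute_parG _).symm.mul_right (commute_tau_sigma K).symm).smul_left _
  -- the coproduct formula, read through `m ∘ (id ⊗ S)`
  have h := antipode_right_constGen K .vm
  have hvp := antipode_highest K (commute_constGen K .Xp_vp) (constGen_mul_of_rel_one K .H_vp)
    (constGen_mul_of_rel_one K .Z_vp)
  have hZvp : constGen K .Z * constGen K .vp = constGen K .vp * constGen K .Z + constGen K .vp := by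
    rw [constGen_mul_of_rel_one K .Z_vp, one_smul]
  have hZvp' : constGen K .Z * constGen K .vp = constGen K .vp * (constGen K .Z + 1) := by
    rw [hZvp, mul_add, mul_one]
  have pe : ∀ c : K, mapHom (parity K) (expSeries K (c • sigmaXp K)) =
      expSeries K (c • sigmaXp K) := fun c => by
    rw [map_expSeries, map_smul, parity_sigma pX]
  have pe1 := pe 1
  have hSe := antipode_expSigma K 1
  rw [one_smul] at pe1 hSe
  have hSZ : antipodeSl12 K (constGen K .Z + 1) = 1 - constGen K .Z := by
    rw [map_add, antipodeSl12_one, antipode_Z, neg_add_eq_sub]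
  have pZ1 : mapHom (parity K) (constGen K .Z + 1) = constGen K .Z + 1 := by
    rw [map_add, parity_constGen K rfl, map_one]
  have hs2 : expSeries K (sigmaXp K) = expSeries K ((2⁻¹ : K) • sigmaXp K) *
      expSeries K ((2⁻¹ : K) • sigmaXp K) := by
    rw [← expSeries_add hhs hhs (Commute.refl _), half_add_half]
  have hs2' : expSeries K (-sigmaXp K) = expSeries K (-((2⁻¹ : K) • sigmaXp K)) *
      expSeries K (-((2⁻¹ : K) • sigmaXp K)) := by
    rw [← expSeries_add hhs' hhs' (Commute.refl _), ← neg_add, half_add_half]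
  rw [one_smul] at hvp
  rw [twistedComul_vm, map_sub, map_sub, map_add, map_add,
    (isParLinear_mulTensor _ _).map_parH, (isParLinear_mulTensor _ _).map_parG,
    (isParLinear_mulTensor _ _).map_parG, mulTensor_antipode_ten, mulTensor_antipode_ten,
    mulTensor_antipode_ten, mulTensor_antipode_ten, mulTensor_antipode_ten,
    antipode_mul_sl12 K _ (pe _), antipode_mul_sl12 K _ pe1, antipode_mul_sl12 K _ pe1, hZvp',
    antipode_mul_sl12 K _ pZ1, antipode_expSigma, hSe, antipode_Z, hSZ, hvp, hs2'] at h
  -- commutation of the exponentials with the generators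
  have hEs : Commute (expSeries K (-(parG _ * tauXp K))) (expSeries K (-((2⁻¹ : K) • sigmaXp K))) :=
    commute_expSeries hgt' (commute_expSeries hhs' hc.neg_left.neg_right).symm
  have hEvp : Commute (expSeries K (-(parG _ * tauXp K))) (constGen K .vp) :=
    commute_expSeries hgt' ((commute_parG _).mul_left (commute_tau_vp K)).neg_left
  have hEZ : Commute (expSeries K (-(parG _ * tauXp K))) (constGen K .Z) :=
    commute_expSeries hgt' ((commute_parG _).mul_left (commute_tau_Z K)).neg_left
  have hsvp : Commute (expSeries K (-((2⁻¹ : K) • sigmaXp K))) (constGen K .vp) :=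
    commute_expSeries hhs' ((commute_sigma_vp K).smul_left _).neg_left
  have hsZ : Commute (expSeries K (-((2⁻¹ : K) • sigmaXp K))) (constGen K .Z) :=
    commute_expSeries hhs' ((commute_sigma_Z K).smul_left _).neg_left
  have hevp := commute_expSigma_vp K
  have hEvm : expSeries K (-(parG _ * tauXp K)) * constGen K .vm =
      (constGen K .vm + parG _ * (constGen K .vp * expSeries K (sigmaXp K))) *
        expSeries K (-(parG _ * tauXp K)) := by
    refine expSeries_mul_of_commutator hgt' ?_ ?_
    · rw [neg_mul, mul_assoc, tau_mul_vm, mul_add, mul_neg, ← mul_assoc, (commute_parG _).eq,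
        neg_add, neg_neg, mul_neg, mul_assoc]
    · exact ((commute_parG _).mul_left ((commute_parG _).symm.mul_right
        ((commute_tau_vp K).mul_right (commute_tau_expSigma K)))).neg_left
  have hEH : expSeries K (-(parG _ * tauXp K)) * (parH _ * constGen K .H) =
      (parH _ * constGen K .H + parG _ * (expSeries K (sigmaXp K) - 1)) *
        expSeries K (-(parG _ * tauXp K)) := by
    refine expSeries_mul_of_commutator hgt' ?_ ?_
    · rw [expSeries_sigma_sub_one, neg_mul, ← mul_assoc, ← (commute_parH _).eq, mul_assoc,
        mul_assoc, tau_mul_H, mul_add, mul_add, mul_neg, mul_neg, neg_add, neg_neg]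
      congr 1
      · rw [mul_neg, mul_assoc, ← mul_assoc (parG _), (commute_parG _).eq, mul_assoc]
      · rw [← mul_assoc, (commute_parH _).eq, mul_assoc, ← mul_assoc (parH _),
          ← (Commute.ofNat_left 2 (parH _)).eq]
    · exact ((commute_parG _).mul_left ((commute_parG _).symm.mul_right
        ((commute_tau_expSigma K).sub_right (Commute.one_right _)))).neg_left
  rw [neg_add, expSeries_add hhs' hgt' hc.neg_left.neg_right]
  exact eq_of_antipode_relation (expSeries_neg_mul hgt) (expSeries_mul_neg hgt)
    (expSeries_neg_mul hhs) (expSeries_mul_neg hhs) commute_parG hs2 hEs hEvp hEZ hsvp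
    hsZ hevp hZvp hEvm hEH h

end Sl12

end
end TwistedSl12

namespace TwistedSl12

open scoped TensorProduct

noncomputable section

/-! ### The universal R-matrix -/

section RMatrix
variable {K : Type*} [Field K] [CharZero K]
variable {A : Type*} [Ring A] [Algebra K A] [Superalgebra K A]

theorem inverse_mul_eq {Q : Type*} [Ring Q] {a a' b b' : Q} (ha : a * a' = 1) (ha' : a' * a = 1)
    (hb : b * b' = 1) (hb' : b' * b = 1) : Ring.inverse (a * b) = b' * a' :=
  Ring.inverse_unit ((⟨a, a', ha, ha'⟩ : Qˣ) * ⟨b, b', hb, hb'⟩)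

theorem constantCoeff_inverse {x : FPS A} (hx : MvPowerSeries.constantCoeff x = 1) :
    MvPowerSeries.constantCoeff (Ring.inverse x) = 1 := by
  have hu : IsUnit x := by
    rw [MvPowerSeries.isUnit_iff_constantCoeff, hx]
    exact isUnit_one
  have h := congrArg MvPowerSeries.constantCoeff (Ring.inverse_mul_cancel _ hu)
  rwa [map_mul, hx, mul_one, map_one] at h

theorem inverse_twistElement (z y x : A) : Ring.inverse (twistElement K z y x) =
    expSeries K ((2⁻¹ : K) • ten K (constSeries K y) (sigma K x)) *
      expSeries K (-(parG _ * ten K (tau K x) (constSeries K z))) := by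
  have h1 := constantCoeff_parG_mul (ten K (tau K x) (constSeries K z))
  have h2 : MvPowerSeries.constantCoeff
      (-((2⁻¹ : K) • ten K (constSeries K y) (sigma K x))) = 0 := by
    rw [ten_eq, map_sigma]
    exact constantCoeff_smul_mul_sigma _ _ _
  have h3 := expSeries_neg_mul (K := K) h1
  have h4 := expSeries_mul_neg (K := K) h1
  have h5 := expSeries_neg_mul (K := K) h2
  have h6 := expSeries_mul_neg (K := K) h2
  rw [neg_neg] at h5 h6
  exact inverse_mul_eq h4 h3 h6 h5

/-- No sign appears in the flip, since `b` is even. -/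
theorem flip_ten (a : FPS A) {b : FPS A} (hb : mapHom (parity K) b = b) :
    mapHom (flipHom K A) (ten K a b) = ten K b a := by
  have hl : (flipHom K A).comp (tensorInl K A A) = tensorInr K A A := AlgHom.ext (flipHom_inl K A)
  have hr : (flipHom K A).comp (tensorInr K A A) = tensorInl K A A := AlgHom.ext (flipHom_inr K A)
  rw [ten_eq, map_mul, mapHom_mapHom, mapHom_mapHom, hl, hr, ten_eq,
    (commute_inl_inr_of_even_left hb a).eq]

theorem twistedR_twistElement {z y x : A} (hz : parity K z = z) (hx : parity K x = x) :
    twistedR (twistElement K z y x) =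
      expSeries K (parG _ * ten K (constSeries K z) (tau K x)) *
        expSeries K (-((2⁻¹ : K) • ten K (sigma K x) (constSeries K y))) *
        expSeries K ((2⁻¹ : K) • ten K (constSeries K y) (sigma K x)) *
        expSeries K (-(parG _ * ten K (tau K x) (constSeries K z))) := by
  have h : mapHom (flipHom K A) (twistElement K z y x) =
      expSeries K (parG _ * ten K (constSeries K z) (tau K x)) *
        expSeries K (-((2⁻¹ : K) • ten K (sigma K x) (constSeries K y))) := by
    rw [twistElement, map_mul, map_expSeries, map_expSeries, map_mul, mapAlgHom_parG, map_neg,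
      map_smul, flip_ten _ (by rw [mapHom_constSeries, hz]), flip_ten _ (parity_sigma hx)]
  rw [mul_assoc (expSeries K _ * expSeries K _), ← h, ← inverse_twistElement]
  rfl

end RMatrix

section Sl12
variable (K : Type*) [Field K] [CharZero K]

theorem twistedR_sl12 : twistedR (twistSl12 K) =
    expSeries K (parG _ * ten K (constGen K .Z) (tauXp K)) *
      expSeries K (-((2⁻¹ : K) • ten K (sigmaXp K) (constGen K .H))) *
      expSeries K ((2⁻¹ : K) • ten K (constGen K .H) (sigmaXp K)) *
      expSeries K (-(parG _ * ten K (tauXp K) (constGen K .Z))) := by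
  rw [twistSl12_eq, twistedR_twistElement (parity_even_gen K rfl) (parity_even_gen K rfl)]

theorem twistedR_sl12_eq_map :
    twistedR (twistSl12 K) = mapSeries K (embTensor K).toLinearMap (twistedR (twistGl2 K)) := by
  have h : (embTensor K).comp (flipHom K (Ugl2 K)) = (flipHom K (Usl12 K)).comp (embTensor K) :=
    superTensor_algHom_ext
      (fun a => by simp [flipHom_inl, embTensor_inl, embTensor_inr])
      (fun a => by simp [flipHom_inr, embTensor_inl, embTensor_inr])
  have h1 : mapHom (embTensor K) (mapHom (flipHom K _) (twistGl2 K)) =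
      mapHom (flipHom K _) (mapHom (embTensor K) (twistGl2 K)) := by
    rw [mapHom_mapHom, mapHom_mapHom, h]
  have h2 := mapHom_inverse (embTensor K)
    (isUnit_twistElement (K := K) (genGl2 K .Z) (genGl2 K .H) (genGl2 K .Xp))
  have h3 : mapHom (embTensor K) (twistedR (twistGl2 K)) =
      mapHom (embTensor K) (mapHom (flipHom K _) (twistGl2 K)) *
        mapHom (embTensor K) (Ring.inverse (twistGl2 K)) := map_mul _ _ _
  rw [mapSeries_toLinearMap, h3, h1]
  exact congrArg (_ * ·) h2.symm

theorem constantCoeff_twistedComul (x : FPS (Usl12 K)) :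
    MvPowerSeries.constantCoeff (twistedComul (comul₀ K).toLinearMap (twistSl12 K) x) =
      comul₀ K (MvPowerSeries.constantCoeff x) := by
  rw [IsCocommutativeHopf.twistedComul_apply, map_mul, map_mul,
    constantCoeff_inverse (constantCoeff_twistSl12 K), constantCoeff_twistSl12, one_mul, mul_one]
  rfl

theorem constantCoeff_antipode (x : FPS (Usl12 K)) :
    MvPowerSeries.constantCoeff (antipodeSl12 K x) =
      antipode₀ K (MvPowerSeries.constantCoeff x) := by
  have hu : MvPowerSeries.constantCoeff
      (IsCocommutativeHopf.mulRightAntipode (antipode₀ K) (twistSl12 K)) = 1 := by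
    change tensorLift LinearMap.id (antipode₀ K)
      (MvPowerSeries.constantCoeff (twistSl12 K)) = 1
    rw [constantCoeff_twistSl12, IsCocommutativeHopf.tensorLift_one, antipode₀_one,
      LinearMap.id_apply, mul_one]
  rw [antipodeSl12, IsCocommutativeHopf.twistedAntipode_eq, LinearMap.comp_apply, conjBy_apply,
    map_mul, map_mul, constantCoeff_inverse hu, hu, one_mul, mul_one]
  rfl

theorem constantCoeff_twistedR : MvPowerSeries.constantCoeff (twistedR (twistSl12 K)) = 1 := by
  have h : MvPowerSeries.constantCoeff (mapHom (flipHom K (Usl12 K)) (twistSl12 K)) =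
      flipHom K _ (MvPowerSeries.constantCoeff (twistSl12 K)) := rfl
  change MvPowerSeries.constantCoeff (mapHom (flipHom K (Usl12 K)) (twistSl12 K) * _) = 1
  rw [map_mul, h, constantCoeff_inverse (constantCoeff_twistSl12 K), constantCoeff_twistSl12,
    map_one, mul_one]

/-- The remaining generators are `v₊ = -[X₊, v₋]` and `v̄₋ = [X₋, v̄₊]`. -/
theorem adjoin_generators :
    Algebra.adjoin K (genSl12 K '' {.Z, .H, .Xp, .Xm, .wp, .vm}) = ⊤ := by
  set s := Algebra.adjoin K (genSl12 K '' {.Z, .H, .Xp, .Xm, .wp, .vm})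
  have hs : ∀ x ∈ ({.Z, .H, .Xp, .Xm, .wp, .vm} : Set GenSl12), genSl12 K x ∈ s :=
    fun x hx => Algebra.subset_adjoin ⟨x, hx, rfl⟩
  have hvp : genSl12 K .vp ∈ s := by
    have h := rel_eq (RelSl12.Xp_vm (K := K))
    simp only [commWord, letter, map_sub, map_mul, map_neg, FreeAlgebra.lift_ι_apply] at h
    rw [genSl12, ← neg_neg (gen _ _), ← h]
    exact neg_mem (sub_mem (mul_mem (hs .Xp (by simp)) (hs .vm (by simp)))
      (mul_mem (hs .vm (by simp)) (hs .Xp (by simp))))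
  have hwm : genSl12 K .wm ∈ s := by
    have h := rel_eq (RelSl12.Xm_wp (K := K))
    simp only [commWord, letter, map_sub, map_mul, FreeAlgebra.lift_ι_apply] at h
    rw [genSl12, ← h]
    exact sub_mem (mul_mem (hs .Xm (by simp)) (hs .wp (by simp)))
      (mul_mem (hs .wp (by simp)) (hs .Xm (by simp)))
  refine Algebra.eq_top_iff.2 fun a => ?_
  induction a using gen_induction with
  | halg c => exact s.algebraMap_mem c
  | hgen x => cases x <;> first | exact hvp | exact hwm | exact hs _ (by simp)
  | hmul a b ha hb => exact mul_mem ha hb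
  | hadd a b ha hb => exact add_mem ha hb

end Sl12

end
end TwistedSl12

namespace TwistedSl12

open scoped TensorProduct Kronecker

noncomputable section

/-! ### The R-matrix in the fundamental representation -/

section SquareZero
variable {K : Type*} [Field K]
variable {A : Type*} [Ring A] [Algebra K A]

theorem substSeries_of_sq_eq_zero (f : PowerSeries K) {x : FPS A} (hx : x * x = 0)
    (h0 : MvPowerSeries.constantCoeff x = 0) :
    substSeries K f x = PowerSeries.coeff 0 f • (1 : FPS A) + PowerSeries.coeff 1 f • x := by
  have hp : ∀ k, x ^ (k + 2) = 0 := fun k => by rw [pow_add, pow_two, hx, mul_zero]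
  ext n
  change ∑ k ∈ Finset.range (n.degree + 1), PowerSeries.coeff k f • MvPowerSeries.coeff n (x ^ k) =
    PowerSeries.coeff 0 f • MvPowerSeries.coeff n (1 : FPS A) +
      PowerSeries.coeff 1 f • MvPowerSeries.coeff n x
  rcases hn : n.degree with _ | d
  · have hn0 : n = 0 := (Finsupp.degree_eq_zero_iff n).1 hn
    subst hn0
    rw [MvPowerSeries.coeff_zero_eq_constantCoeff_apply x, h0]
    simp
  · rw [Finset.sum_range_succ', Finset.sum_range_succ', Finset.sum_eq_zero fun k _ => by
      rw [hp, map_zero, smul_zero]]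
    simp [add_comm]

theorem tau_of_sq_eq_zero {a : A} (ha : a * a = 0) : tau K a = constSeries K a := by
  have hc : constSeries K a * constSeries K a = 0 := by rw [← constSeries_mul, ha, map_zero]
  have hx : constSeries K a * (2 * parH A * constSeries K a) = 0 := by
    have h : Commute (constSeries K a) (2 * parH A) :=
      (Commute.ofNat_right _ 2).mul_right (commute_parH _).symm
    rw [← mul_assoc, h.eq, mul_assoc, hc, mul_zero]
  rw [tau, substSeries_of_sq_eq_zero, mul_add, mul_smul_comm, mul_smul_comm, hx]
  · simp
  · rw [mul_assoc, hx, mul_zero]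
  · simp [constantCoeff_parH]

variable [CharZero K]

theorem sigma_of_sq_eq_zero {a : A} (ha : a * a = 0) :
    sigma K a = 2 * parH A * constSeries K a := by
  rw [← two_h_mul_tau, tau_of_sq_eq_zero ha]

theorem expSeries_of_sq_eq_zero {x : FPS A} (hx : x * x = 0)
    (h0 : MvPowerSeries.constantCoeff x = 0) : expSeries K x = 1 + x := by
  rw [expSeries, substSeries_of_sq_eq_zero _ hx h0]
  simp

theorem expSeries_mul_constSeries {p : FPS A} (hp : ∀ x, Commute p x)
    (h0 : MvPowerSeries.constantCoeff p = 0) {a : A} (ha : a * a = 0) :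
    expSeries K (p * constSeries K a) = 1 + p * constSeries K a := by
  refine expSeries_of_sq_eq_zero ?_ (by rw [map_mul, h0, zero_mul])
  rw [mul_assoc, ← mul_assoc (constSeries K a), ← (hp _).eq, mul_assoc p (constSeries K a),
    ← constSeries_mul, ha, map_zero, mul_zero, mul_zero]

end SquareZero

section Entries
variable {K : Type*} [Field K] {n : Type*} [Fintype n] [DecidableEq n]

variable (K n) in
/-- A power series of matrices as a matrix of power series. -/
def seriesEntries : FPS (Matrix n n K) →+* Matrix n n (FPS K) where
  toFun x := Matrix.of fun p q => fun k => MvPowerSeries.coeff k x p q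
  map_one' := by
    classical
    ext p q k
    change (MvPowerSeries.coeff k (1 : FPS (Matrix n n K))) p q =
      MvPowerSeries.coeff k ((1 : Matrix n n (FPS K)) p q)
    rw [MvPowerSeries.coeff_one, Matrix.one_apply]
    split_ifs <;> simp_all [MvPowerSeries.coeff_one, Matrix.one_apply]
  map_mul' x y := by
    classical
    ext p q k
    change (MvPowerSeries.coeff k (x * y)) p q = MvPowerSeries.coeff k (∑ r, _ * _)
    rw [map_sum, MvPowerSeries.coeff_mul, Matrix.sum_apply]
    simp only [MvPowerSeries.coeff_mul, Matrix.mul_apply]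
    exact Finset.sum_comm
  map_zero' := rfl
  map_add' _ _ := rfl

theorem seriesEntries_constSeries (M : Matrix n n K) :
    seriesEntries K n (constSeries K M) = M.map (MvPowerSeries.C : K →+* FPS K) := by
  classical
  ext p q k
  change (MvPowerSeries.coeff k (MvPowerSeries.C M : FPS (Matrix n n K))) p q =
    MvPowerSeries.coeff k (MvPowerSeries.C (M p q) : FPS K)
  rw [MvPowerSeries.coeff_C, MvPowerSeries.coeff_C]
  split_ifs <;> rfl

theorem seriesEntries_X (i : Fin 2) :
    seriesEntries K n (MvPowerSeries.X i) = (MvPowerSeries.X i : FPS K) • 1 := by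
  classical
  ext p q k
  change (MvPowerSeries.coeff k (MvPowerSeries.X i : FPS (Matrix n n K))) p q =
    MvPowerSeries.coeff k ((MvPowerSeries.X i : FPS K) * (1 : Matrix n n (FPS K)) p q)
  rw [MvPowerSeries.coeff_X, Matrix.one_apply]
  split_ifs <;> simp_all [MvPowerSeries.coeff_X, Matrix.one_apply]

end Entries

section Kronecker
variable (K : Type*) [Field K] (m n : Type*) [Fintype m] [Fintype n] [DecidableEq m] [DecidableEq n]

/-- `M ↦ M ⊗ 1`. -/
def kroneckerLeft : Matrix m m K →ₐ[K] Matrix (m × n) (m × n) K :=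
  AlgHom.ofLinearMap
    { toFun := fun M => M ⊗ₖ (1 : Matrix n n K)
      map_add' := fun _ _ => Matrix.add_kronecker _ _ _
      map_smul' := fun _ _ => Matrix.smul_kronecker _ _ _ }
    Matrix.one_kronecker_one
    fun M N => by
      change (M * N) ⊗ₖ (1 : Matrix n n K) = M ⊗ₖ 1 * N ⊗ₖ 1
      rw [← Matrix.mul_kronecker_mul, one_mul]

/-- `M ↦ 1 ⊗ M`. -/
def kroneckerRight : Matrix n n K →ₐ[K] Matrix (m × n) (m × n) K :=
  AlgHom.ofLinearMap
    { toFun := fun M => (1 : Matrix m m K) ⊗ₖ M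
      map_add' := fun _ _ => Matrix.kronecker_add _ _ _
      map_smul' := fun _ _ => Matrix.kronecker_smul _ _ _ }
    Matrix.one_kronecker_one
    fun M N => by
      change (1 : Matrix m m K) ⊗ₖ (M * N) = 1 ⊗ₖ M * 1 ⊗ₖ N
      rw [← Matrix.mul_kronecker_mul, one_mul]

variable {K m n}

theorem kroneckerLeft_mul_kroneckerRight (M : Matrix m m K) (N : Matrix n n K) :
    kroneckerLeft K m n M * kroneckerRight K m n N = M ⊗ₖ N := by
  change M ⊗ₖ (1 : Matrix n n K) * (1 : Matrix m m K) ⊗ₖ N = _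
  rw [← Matrix.mul_kronecker_mul, one_mul, mul_one]

theorem kroneckerRight_mul_kroneckerLeft (M : Matrix m m K) (N : Matrix n n K) :
    kroneckerRight K m n N * kroneckerLeft K m n M = M ⊗ₖ N := by
  change (1 : Matrix m m K) ⊗ₖ N * M ⊗ₖ (1 : Matrix n n K) = _
  rw [← Matrix.mul_kronecker_mul, one_mul, mul_one]

end Kronecker

section Gl2
variable (K : Type*) [Field K] [CharZero K]

/-- The restriction of the fundamental representation to `U(gl(2))`. -/
def fundRepGl2 : Ugl2 K →ₐ[K] Matrix (Fin 3) (Fin 3) K := (fundRep K).comp (embGl2 K)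

theorem superCommute_gl2 : SuperCommute
    ((kroneckerLeft K (Fin 3) (Fin 3)).comp (fundRepGl2 K))
    ((kroneckerRight K (Fin 3) (Fin 3)).comp (fundRepGl2 K)) := by
  intro i j a b ha hb
  simp only [AlgHom.comp_apply, kroneckerLeft_mul_kroneckerRight, kroneckerRight_mul_kroneckerLeft]
  induction i using zmod_two_cases
  · simp
  · have h : a = -a := (mem_odd K).1 ha
    have h0 : (2 : K) • a = 0 := by rw [two_smul, add_eq_zero_iff_eq_neg]; exact h
    rw [(smul_eq_zero.1 h0).resolve_left two_ne_zero]
    simp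

/-- The tensor square of the fundamental representation, on `U(gl(2)) ⊗ U(gl(2))`: there are no
signs, all of `U(gl(2))` being even. -/
def tensorRepGl2 : SuperTensor K (Ugl2 K) (Ugl2 K) →ₐ[K]
    Matrix (Fin 3 × Fin 3) (Fin 3 × Fin 3) K :=
  superLift _ _ (superCommute_gl2 K)

/-- On the image of `U(gl(2)) ⊗ U(gl(2))` the Koszul signs of `V ⊗ V` disappear, the second tensor
factor acting by even operators. -/
theorem tensorRep_embTensor (z : SuperTensor K (Ugl2 K) (Ugl2 K)) :
    tensorRep K (embTensor K z) = tensorRepGl2 K z := by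
  refine DFunLike.congr_fun (superTensor_linear_ext
    (f := tensorRep K ∘ₗ (embTensor K).toLinearMap) (g := (tensorRepGl2 K).toLinearMap)
    fun i j a b _ _ => ?_) z
  rw [LinearMap.comp_apply, AlgHom.toLinearMap_apply, AlgHom.toLinearMap_apply,
    map_mul (embTensor K), map_mul (tensorRepGl2 K), embTensor_inl, embTensor_inr, tensorRepGl2,
    superLift_inl, superLift_inr, AlgHom.comp_apply, AlgHom.comp_apply,
    kroneckerLeft_mul_kroneckerRight, inl_mul_inr]
  ext p q
  change fundRep K (embGl2 K a) p.1 q.1 *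
    fundRep K (if q.1 = 0 then embGl2 K b else parity K (embGl2 K b)) p.2 q.2 =
    fundRep K (embGl2 K a) p.1 q.1 * fundRep K (embGl2 K b) p.2 q.2
  rw [← embGl2_parity, show parity K b = b from rfl, ite_self]

theorem rMatrix_twistedR : rMatrix K (twistedR (twistSl12 K)) =
    seriesEntries K _ (mapHom (tensorRepGl2 K) (twistedR (twistGl2 K))) := by
  rw [twistedR_sl12_eq_map]
  ext p q k
  exact congrFun (congrFun (tensorRep_embTensor K (MvPowerSeries.coeff k _)) p) q

theorem fundRepGl2_gen : fundRepGl2 K (genGl2 K .Z) = fundMatrix K .Z ∧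
    fundRepGl2 K (genGl2 K .H) = fundMatrix K .H ∧
    fundRepGl2 K (genGl2 K .Xp) = fundMatrix K .Xp := by
  have h : ∀ x, fundRep K (genSl12 K x) = fundMatrix K x := fun x => liftGen_gen _ _ x
  simp only [fundRepGl2, AlgHom.comp_apply, embGl2, genGl2, liftGen_gen, h, and_self]

theorem map_ten_gl2 (a b : FPS (Ugl2 K)) : mapHom (tensorRepGl2 K) (ten K a b) =
    mapHom (kroneckerLeft K (Fin 3) (Fin 3)) (mapHom (fundRepGl2 K) a) *
      mapHom (kroneckerRight K (Fin 3) (Fin 3)) (mapHom (fundRepGl2 K) b) := by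
  rw [ten_eq, map_mul, mapHom_mapHom, mapHom_mapHom, mapHom_mapHom, mapHom_mapHom]
  have hl : (tensorRepGl2 K).comp (tensorInl K _ _) =
      (kroneckerLeft K (Fin 3) (Fin 3)).comp (fundRepGl2 K) :=
    AlgHom.ext (superLift_inl _ _ (superCommute_gl2 K))
  have hr : (tensorRepGl2 K).comp (tensorInr K _ _) =
      (kroneckerRight K (Fin 3) (Fin 3)).comp (fundRepGl2 K) :=
    AlgHom.ext (superLift_inr _ _ (superCommute_gl2 K))
  rw [hl, hr]

theorem fundMatrix_Xp_mul_self : fundMatrix K .Xp * fundMatrix K .Xp = 0 := by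
  ext i j
  fin_cases i <;> fin_cases j <;> simp [fundMatrix, Matrix.mul_apply, Fin.sum_univ_succ]

theorem map_tau_gl2 :
    mapHom (fundRepGl2 K) (tau K (genGl2 K .Xp)) = constSeries K (fundMatrix K .Xp) := by
  rw [map_tau, (fundRepGl2_gen K).2.2, tau_of_sq_eq_zero (fundMatrix_Xp_mul_self K)]

theorem map_sigma_gl2 : mapHom (fundRepGl2 K) (sigma K (genGl2 K .Xp)) =
    2 * parH _ * constSeries K (fundMatrix K .Xp) := by
  rw [map_sigma, (fundRepGl2_gen K).2.2, sigma_of_sq_eq_zero (fundMatrix_Xp_mul_self K)]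

theorem map_kronecker_const (a b : Matrix (Fin 3) (Fin 3) K) :
    mapHom (kroneckerLeft K (Fin 3) (Fin 3)) (constSeries K a) *
      mapHom (kroneckerRight K (Fin 3) (Fin 3)) (constSeries K b) = constSeries K (a ⊗ₖ b) := by
  rw [mapHom_constSeries, mapHom_constSeries, ← constSeries_mul, kroneckerLeft_mul_kroneckerRight]

theorem half_two_mul {A : Type*} [Ring A] [Algebra K A] (x y : FPS A) :
    (2⁻¹ : K) • (2 * x * y) = x * y := by
  rw [mul_assoc, show (2 : FPS A) = (2 : K) • 1 from (by rw [two_smul, one_add_one_eq_two]),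
    smul_mul_assoc, one_mul, smul_smul, inv_mul_cancel₀ two_ne_zero, one_smul]

/-- The matrix of `R` as a product of four factors: each exponential stops after the linear term, as
`X₊² = 0` in the fundamental representation. -/
theorem map_twistedR_gl2 : mapHom (tensorRepGl2 K) (twistedR (twistGl2 K)) =
    (1 + parG _ * constSeries K (fundMatrix K .Z ⊗ₖ fundMatrix K .Xp)) *
      (1 + -parH _ * constSeries K (fundMatrix K .Xp ⊗ₖ fundMatrix K .H)) *
      (1 + parH _ * constSeries K (fundMatrix K .H ⊗ₖ fundMatrix K .Xp)) *
      (1 + -parG _ * constSeries K (fundMatrix K .Xp ⊗ₖ fundMatrix K .Z)) := by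
  have hX := fundMatrix_Xp_mul_self K
  have hZ : ∀ M : Matrix (Fin 3) (Fin 3) K,
      (M ⊗ₖ fundMatrix K .Xp) * (M ⊗ₖ fundMatrix K .Xp) = 0 := fun M => by
    rw [← Matrix.mul_kronecker_mul, hX, Matrix.kronecker_zero]
  have hZ' : ∀ M : Matrix (Fin 3) (Fin 3) K,
      (fundMatrix K .Xp ⊗ₖ M) * (fundMatrix K .Xp ⊗ₖ M) = 0 := fun M => by
    rw [← Matrix.mul_kronecker_mul, hX, Matrix.zero_kronecker]
  have e1 : mapHom (tensorRepGl2 K)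
      (parG _ * ten K (constSeries K (genGl2 K .Z)) (tau K (genGl2 K .Xp))) =
      parG _ * constSeries K (fundMatrix K .Z ⊗ₖ fundMatrix K .Xp) := by
    rw [map_mul, mapAlgHom_parG, map_ten_gl2, map_tau_gl2, mapHom_constSeries,
      (fundRepGl2_gen K).1, map_kronecker_const]
  have e4 : mapHom (tensorRepGl2 K)
      (-(parG _ * ten K (tau K (genGl2 K .Xp)) (constSeries K (genGl2 K .Z)))) =
      -parG _ * constSeries K (fundMatrix K .Xp ⊗ₖ fundMatrix K .Z) := by
    rw [map_neg, map_mul, mapAlgHom_parG, map_ten_gl2, map_tau_gl2,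
      mapHom_constSeries (fundRepGl2 K), (fundRepGl2_gen K).1, map_kronecker_const, neg_mul]
  have e2 : mapHom (tensorRepGl2 K)
      (-((2⁻¹ : K) • ten K (sigma K (genGl2 K .Xp)) (constSeries K (genGl2 K .H)))) =
      -parH _ * constSeries K (fundMatrix K .Xp ⊗ₖ fundMatrix K .H) := by
    rw [map_neg, map_smul, map_ten_gl2, map_sigma_gl2, mapHom_constSeries (fundRepGl2 K),
      (fundRepGl2_gen K).2.1, map_mul, map_mul, mapAlgHom_parH, map_ofNat, mul_assoc (2 * parH _),
      map_kronecker_const, half_two_mul, neg_mul]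
  have e3 : mapHom (tensorRepGl2 K)
      ((2⁻¹ : K) • ten K (constSeries K (genGl2 K .H)) (sigma K (genGl2 K .Xp))) =
      parH _ * constSeries K (fundMatrix K .H ⊗ₖ fundMatrix K .Xp) := by
    have hc : ∀ x : FPS (Matrix (Fin 3 × Fin 3) (Fin 3 × Fin 3) K), Commute x (2 * parH _) :=
      fun x => (Commute.ofNat_right x 2).mul_right (commute_parH _).symm
    rw [map_smul, map_ten_gl2, map_sigma_gl2, mapHom_constSeries (fundRepGl2 K),
      (fundRepGl2_gen K).2.1, map_mul, map_mul, mapAlgHom_parH, map_ofNat, ← mul_assoc, (hc _).eq,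
      mul_assoc (2 * parH _), map_kronecker_const, half_two_mul]
  have pH : ∀ x : FPS (Matrix (Fin 3 × Fin 3) (Fin 3 × Fin 3) K), Commute (-parH _) x :=
    fun x => (commute_parH x).neg_left
  have pG : ∀ x : FPS (Matrix (Fin 3 × Fin 3) (Fin 3 × Fin 3) K), Commute (-parG _) x :=
    fun x => (commute_parG x).neg_left
  rw [twistGl2, twistedR_twistElement rfl rfl, map_mul, map_mul, map_mul, map_expSeries,
    map_expSeries, map_expSeries, map_expSeries, e1, e2, e3, e4,
    expSeries_mul_constSeries commute_parG constantCoeff_parG (hZ _),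
    expSeries_mul_constSeries pH (by rw [map_neg, constantCoeff_parH, neg_zero]) (hZ' _),
    expSeries_mul_constSeries commute_parH constantCoeff_parH (hZ _),
    expSeries_mul_constSeries pG (by rw [map_neg, constantCoeff_parG, neg_zero]) (hZ' _)]

end Gl2

section Blocks
variable {R : Type*} [CommRing R]

theorem directSum₄_mul (A A' : Matrix (Fin 1) (Fin 1) R) (B B' C C' : Matrix (Fin 2) (Fin 2) R)
    (D D' : Matrix (Fin 4) (Fin 4) R) : directSum₄ A B C D * directSum₄ A' B' C' D' =
      directSum₄ (A * A') (B * B') (C * C') (D * D') := by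
  simp [directSum₄, Matrix.fromBlocks_multiply]

end Blocks

section Fundamental
variable (K : Type*) [Field K] [CharZero K]

/-- The entries of `1 + p (M ⊗ N)`, for a scalar series `p` with value `c` in `K[[h, g]]`. -/
theorem seriesEntries_one_add (p : FPS (Matrix (Fin 3 × Fin 3) (Fin 3 × Fin 3) K)) (c : FPS K)
    (hp : seriesEntries K _ p = c • 1) (M N : Matrix (Fin 3) (Fin 3) K)
    (i j : Fin 3 × Fin 3) :
    seriesEntries K _ (1 + p * constSeries K (M ⊗ₖ N)) i j =
      (1 : Matrix (Fin 3 × Fin 3) (Fin 3 × Fin 3) (FPS K)) i j +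
        c * (MvPowerSeries.C (M i.1 j.1) * MvPowerSeries.C (N i.2 j.2)) := by
  rw [map_add, map_one, map_mul, hp, seriesEntries_constSeries, smul_mul_assoc, one_mul, ← map_mul]
  rfl

variable {p : FPS (Matrix (Fin 3 × Fin 3) (Fin 3 × Fin 3) K)} {c : FPS K}
  (hp : seriesEntries K _ p = c • 1)
include hp

theorem seriesEntries_Z_Xp :
    (seriesEntries K _ (1 + p * constSeries K (fundMatrix K .Z ⊗ₖ fundMatrix K .Xp))).submatrix
      basisOrder basisOrder =
    directSum₄ 1 !![1, 2 * c; 0, 1] 1 !![1, c, 0, 0; 0, 1, 0, 0; 0, 0, 1, c; 0, 0, 0, 1] := by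
  have h_two : (MvPowerSeries.C (2 : K) : FPS K) = 2 := map_ofNat _ 2
  ext1 i j
  rw [Matrix.submatrix_apply, seriesEntries_one_add K p c hp]
  rcases i with i | i | i | i <;> rcases j with j | j | j | j <;> fin_cases i <;> fin_cases j <;>
    simp [directSum₄, basisOrder, fundMatrix, Matrix.one_apply, mul_comm, h_two]

theorem seriesEntries_Xp_H :
    (seriesEntries K _ (1 + p * constSeries K (fundMatrix K .Xp ⊗ₖ fundMatrix K .H))).submatrix
      basisOrder basisOrder =
    directSum₄ 1 1 1 !![1, 0, c, 0; 0, 1, 0, -c; 0, 0, 1, 0; 0, 0, 0, 1] := by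
  ext1 i j
  rw [Matrix.submatrix_apply, seriesEntries_one_add K p c hp]
  rcases i with i | i | i | i <;> rcases j with j | j | j | j <;> fin_cases i <;> fin_cases j <;>
    simp [directSum₄, basisOrder, fundMatrix, Matrix.one_apply]

theorem seriesEntries_H_Xp :
    (seriesEntries K _ (1 + p * constSeries K (fundMatrix K .H ⊗ₖ fundMatrix K .Xp))).submatrix
      basisOrder basisOrder =
    directSum₄ 1 1 1 !![1, c, 0, 0; 0, 1, 0, 0; 0, 0, 1, -c; 0, 0, 0, 1] := by
  ext1 i j
  rw [Matrix.submatrix_apply, seriesEntries_one_add K p c hp]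
  rcases i with i | i | i | i <;> rcases j with j | j | j | j <;> fin_cases i <;> fin_cases j <;>
    simp [directSum₄, basisOrder, fundMatrix, Matrix.one_apply]

theorem seriesEntries_Xp_Z :
    (seriesEntries K _ (1 + p * constSeries K (fundMatrix K .Xp ⊗ₖ fundMatrix K .Z))).submatrix
      basisOrder basisOrder =
    directSum₄ 1 1 !![1, 2 * c; 0, 1] !![1, 0, c, 0; 0, 1, 0, c; 0, 0, 1, 0; 0, 0, 0, 1] := by
  have h_two : (MvPowerSeries.C (2 : K) : FPS K) = 2 := map_ofNat _ 2
  ext1 i j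
  rw [Matrix.submatrix_apply, seriesEntries_one_add K p c hp]
  rcases i with i | i | i | i <;> rcases j with j | j | j | j <;> fin_cases i <;> fin_cases j <;>
    simp [directSum₄, basisOrder, fundMatrix, Matrix.one_apply, mul_comm, h_two]

omit hp in
theorem rMatrix_submatrix :
    (rMatrix K (twistedR (twistSl12 K))).submatrix basisOrder basisOrder =
      directSum₄ 1 !![1, 2 * parG K; 0, 1] (!![1, 2 * parG K; 0, 1])⁻¹
        !![1, parH K + parG K, -parH K - parG K, parH K ^ 2 - parG K ^ 2;
           0, 1, 0, parH K - parG K;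
           0, 0, 1, -parH K + parG K;
           0, 0, 0, 1] := by
  have hH : seriesEntries K (Fin 3 × Fin 3) (parH _) = parH K • 1 := seriesEntries_X 0
  have hG : seriesEntries K (Fin 3 × Fin 3) (parG _) = parG K • 1 := seriesEntries_X 1
  have hH' : seriesEntries K (Fin 3 × Fin 3) (-parH _) = (-parH K) • 1 := by
    rw [map_neg, hH, neg_smul]
  have hG' : seriesEntries K (Fin 3 × Fin 3) (-parG _) = (-parG K) • 1 := by
    rw [map_neg, hG, neg_smul]
  have hb := basisOrder_bijective
  rw [rMatrix_twistedR, map_twistedR_gl2, map_mul, map_mul, map_mul,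
    Matrix.submatrix_mul _ _ _ _ _ hb, Matrix.submatrix_mul _ _ _ _ _ hb,
    Matrix.submatrix_mul _ _ _ _ _ hb, seriesEntries_Z_Xp K hG, seriesEntries_Xp_H K hH',
    seriesEntries_H_Xp K hH, seriesEntries_Xp_Z K hG', directSum₄_mul, directSum₄_mul,
    directSum₄_mul, mul_one, mul_one, mul_one, mul_one, mul_one, mul_one, one_mul, one_mul]
  congr 1
  · refine (Matrix.inv_eq_right_inv ?_).symm
    ext1 i j
    fin_cases i <;> fin_cases j <;> simp [Matrix.mul_apply, Fin.sum_univ_succ]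
  · ext1 i j
    fin_cases i <;> fin_cases j <;> simp [Matrix.mul_apply, Fin.sum_univ_succ] <;> ring

end Fundamental

end
end TwistedSl12

theorem mainTheorem2 (K : Type*) [Field K] [CharZero K] :
    let F : FPS (SuperTensor K (Usl12 K) (Usl12 K)) := twistSl12 K
    let Δ : FPS (Usl12 K) →ₗ[K] FPS (SuperTensor K (Usl12 K) (Usl12 K)) :=
      twistedComul (comul₀ K).toLinearMap F
    let ε : FPS (Usl12 K) →ₗ[K] FPS K := mapSeries K (counit₀ K).toLinearMap
    let S : FPS (Usl12 K) →ₗ[K] FPS (Usl12 K) := twistedAntipode (antipode₀ K) F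
    let R : FPS (SuperTensor K (Usl12 K) (Usl12 K)) := twistedR F
    let c : GenSl12 → FPS (Usl12 K) := fun x => constSeries K (genSl12 K x)
    let σ : FPS (Usl12 K) := sigma K (genSl12 K .Xp)
    let τ : FPS (Usl12 K) := tau K (genSl12 K .Xp)
    let exp : FPS (Usl12 K) → FPS (Usl12 K) := expSeries K
    let T : FPS (Usl12 K) → FPS (Usl12 K) → FPS (SuperTensor K (Usl12 K) (Usl12 K)) :=
      fun a b => ten K a b
    let h : FPS (Usl12 K) := parH (Usl12 K)
    let g : FPS (Usl12 K) := parG (Usl12 K)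
    let h₂ : FPS (SuperTensor K (Usl12 K) (Usl12 K)) := parH (SuperTensor K (Usl12 K) (Usl12 K))
    let g₂ : FPS (SuperTensor K (Usl12 K) (Usl12 K)) := parG (SuperTensor K (Usl12 K) (Usl12 K))
    let hK : FPS K := parH K
    let gK : FPS K := parG K
    -- the generators
    Algebra.adjoin K (genSl12 K '' {.Z, .H, .Xp, .Xm, .wp, .vm}) = ⊤ ∧
    -- the twist element, and the triangular Hopf superalgebra that it defines
    F = expSeries K (g₂ * T τ (c .Z)) * expSeries K (-((2⁻¹ : K) • T (c .H) σ)) ∧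
    IsTwist (comul₀ K).toLinearMap (counit₀ K).toLinearMap F ∧
    IsTriangularHopfSuperalgebra Δ ε S R ∧
    -- it is a deformation of the enveloping algebra
    (∀ x, MvPowerSeries.constantCoeff (Δ x) = comul₀ K (MvPowerSeries.constantCoeff x)) ∧
    (∀ x, MvPowerSeries.constantCoeff (S x) = antipode₀ K (MvPowerSeries.constantCoeff x)) ∧
    MvPowerSeries.constantCoeff R = 1 ∧
    -- the universal R-matrix is the one of the deformation of `gl(2)`
    R = mapSeries K (embTensor K).toLinearMap (twistedR (twistGl2 K)) ∧
    R = expSeries K (g₂ * T (c .Z) τ) * expSeries K (-((2⁻¹ : K) • T σ (c .H))) *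
      expSeries K ((2⁻¹ : K) • T (c .H) σ) * expSeries K (-(g₂ * T τ (c .Z))) ∧
    -- coproduct, antipode and counit of the odd generators
    Δ (c .wp) = T (c .wp) (exp (-((2⁻¹ : K) • σ))) + T (exp (-(g * τ))) (c .wp) ∧
    Δ (c .vm) = T (c .vm) (exp ((2⁻¹ : K) • σ)) + T (exp (g * τ)) (c .vm) +
      h₂ * T (c .H * exp (g * τ)) (c .vp * exp σ) -
      g₂ * T (c .vp * exp σ) (c .Z * exp ((2⁻¹ : K) • σ)) -
      g₂ * T ((exp σ - 1) * exp (g * τ)) (c .Z * c .vp * exp σ) ∧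
    S (c .wp) = -(c .wp * exp ((2⁻¹ : K) • σ + g * τ)) ∧
    S (c .vm) = -((c .vm - h * c .H * c .vp + g * c .vp * (1 + c .Z)) *
      exp (-((2⁻¹ : K) • σ + g * τ))) ∧
    ε (c .wp) = 0 ∧ ε (c .vm) = 0 ∧
    -- the R-matrix in the fundamental representation
    (rMatrix K R).submatrix basisOrder basisOrder =
      directSum₄ 1 !![1, 2 * gK; 0, 1] (!![1, 2 * gK; 0, 1])⁻¹
        !![1, hK + gK, -hK - gK, hK ^ 2 - gK ^ 2;
           0, 1, 0, hK - gK;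
           0, 0, 1, -hK + gK;
           0, 0, 0, 1] := by
  intro F Δ ε S R c σ τ exp T h g h₂ g₂ hK gK
  have h_wp : Δ (c .wp) = T (c .wp) (exp (-((2⁻¹ : K) • σ))) + T (exp (-(g * τ))) (c .wp) := by
    have key := twistedComul_highest K (commute_constGen K .Xp_wp)
      (constGen_mul_of_rel_one K .H_wp) (constGen_mul_of_rel_neg K .Z_wp)
    rw [neg_smul, one_smul] at key
    exact key
  exact ⟨adjoin_generators K, twistSl12_eq K, isTwist_twistSl12 K, isTriangular_sl12 K,
    constantCoeff_twistedComul K, constantCoeff_antipode K, constantCoeff_twistedR K,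
    twistedR_sl12_eq_map K, twistedR_sl12 K, h_wp, twistedComul_vm K, antipode_wp K, antipode_vm K,
    counit_constGen K .wp, counit_constGen K .vm, rMatrix_submatrix K⟩
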